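/- Setting. Let $\mathcal H$ be a reflexive real Banach space, $T>0$, and let $-A$ generate a strongly continuous semigroup $e^{-tA}$ on $\mathcal H$. Let $\Psi_0,B_1,\Psi_{dT}\in\mathcal H$, $B_2\in\mathcal L(\mathcal H)$, $f\in L^\infty(0,T;\mathcal H)$, $\Psi_d\in C([0,T];\mathcal H)$, $\alpha\in\mathbb R$, let $Q,Q_T\in\mathcal L(\mathcal H,\mathcal H^*)$ be symmetric, $q(y)=\langle Qy,y\rangle$, $q_T(y)=\langle Q_Ty,y\rangle$. For $u\in L^1(0,T)$ let $\Psi[u]\in C([0,T];\mathcal H)$ be the mild solution of $\dot\Psi+A\Psi=f+u(B_1+B_2\Psi)$, $\Psi(0)=\Psi_0$, and $$J(u)=\alpha\int_0^Tu\,dt+\tfrac12\int_0^Tq(\Psi[u]-\Psi_d)\,dt+\tfrac12q_T(\Psi[u](T)-\Psi_{dT}).$$ Given constants $u_m<u_M$, let $\hat u$ be measurable with $u_m\le\hat u\le u_M$ a.e. on $(0,T)$. Put $\hat\Psi=\Psi[\hat u]$, $\mathcal B=B_1+B_2\hat\Psi$, let $\hat p\in C([0,T];\mathcal H^*)$ be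 the mild solution of $-\dot p+A^*p=Q(\hat\Psi-\Psi_d)+\hat uB_2^*p$, $p(T)=Q_T(\hat\Psi(T)-\Psi_{dT})$, and $\Lambda=\alpha+\langle\hat p,\mathcal B\rangle$. For $v\in L^1(0,T)$ let $z[v]$ be the mild solution of $\dot z+Az=\hat uB_2z+v\mathcal B$, $z(0)=0$. The Goh transform of $v$ is $$w(t)=\int_0^tv\,ds,\qquad \xi[w]=z[v]-w\,\mathcal B .$$ Hypotheses. Let $E_1$ be a Banach space continuously included in $\mathcal H$ with $\mathrm{dom}(A)\subset E_1$, such that $e^{-tA}$ restricts to a strongly continuous semigroup on $E_1$ and $B_2$ restricts to an element of $\mathcal L(E_1)$. Assume $B_1\in\mathrm{dom}(A)$, $B_2\,\mathrm{dom}(A)\subset\mathrm{dom}(A)$, $B_2^*\,\mathrm{dom}(A^*)\subset\mathrm{dom}(A^*)$; that $[A,B_2^k]=AB_2^k-B_2^kA$ has a continuous extension $M_k\in\mathcal L(E_1,\mathcal H)$ for $k=1,2$; that $\hat\Psi\in L^2(0,T;E_1)$ and $[M_1,B_2]\hat\Psi\in L^\infty(0,T;\mathcal H)$; that $B_2^2f\in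 C([0,T];\mathcal H)$; and that $M_k^*\hat p\in C([0,T];\mathcal H^*)$ for $k=1,2$. Quadratic form. Set $\widehat\Omega(\xi,w,h)=\widehat\Omega_T(\xi,h)+\widehat\Omega_a(\xi,w)+\int_0^TR\,w^2\,dt$, where $$\widehat\Omega_T(\xi,h)=q_T(\xi(T)+h\mathcal B(T))+h^2\langle\hat p(T),B_2B_1+B_2^2\hat\Psi(T)\rangle+2h\langle\hat p(T),B_2\xi(T)\rangle,$$ $$\widehat\Omega_a(\xi,w)=\int_0^T\big(q(\xi)+2w\langle Q\xi,\mathcal B\rangle+2w\langle Q(\hat\Psi-\Psi_d),B_2\xi\rangle-2w\langle M_1^*\hat p,\xi\rangle\big)dt,$$ $$R=q(\mathcal B)+\langle Q(\hat\Psi-\Psi_d),B_2\mathcal B\rangle+\langle\hat p,\;B_2^2f-AB_2B_1+2B_2AB_1-[M_1,B_2]\hat\Psi\rangle .$$ Proposition. Let $(v_k)$ be bounded in $L^\infty(0,T)$ with $\|v_k\|_{1}\to0$, and let $w_k(t)=\int_0^tv_k\,ds$. Then, as $k\to\infty$, $$J(\hat u+v_k)=J(\hat u)+\int_0^T\Lambda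 v_k\,dt+\tfrac12\widehat\Omega(\xi[w_k],w_k,w_k(T))+o\big(\|w_k\|_2^2+w_k(T)^2\big).$$ -/

import Mathlib

open MeasureTheory Filter Topology Asymptotics

noncomputable section

/-- A strongly continuous one-parameter semigroup `(S t)_{t ≥ 0}` of bounded operators on `X`.
Only the values at `t ≥ 0` are meaningful. -/
structure C0Semigroup (X : Type*) [NormedAddCommGroup X] [NormedSpace ℝ X] where
  toFun : ℝ → X →L[ℝ] X
  toFun_zero : toFun 0 = ContinuousLinearMap.id ℝ X
  toFun_add : ∀ s t : ℝ, 0 ≤ s → 0 ≤ t → toFun (s + t) = (toFun s).comp (toFun t)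
  continuousOn_orbit : ∀ x : X, ContinuousOn (fun t => toFun t x) (Set.Ici 0)

/-- `y` belongs to the domain of the generator when the right derivative at `0` of the orbit of `y`
exists. -/
def C0Semigroup.generatorDomain {X : Type*} [NormedAddCommGroup X] [NormedSpace ℝ X]
    (S : C0Semigroup X) : Submodule ℝ X where
  carrier := {y | ∃ l : X, Tendsto (fun t : ℝ => t⁻¹ • (S.toFun t y - y)) (𝓝[>] 0) (𝓝 l)}
  zero_mem' := ⟨0, by simp⟩
  add_mem' := by
    rintro x y ⟨a, ha⟩ ⟨b, hb⟩
    refine ⟨a + b, (ha.add hb).congr fun t => ?_⟩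
    rw [← smul_add, map_add]
    congr 1
    abel
  smul_mem' := by
    rintro c x ⟨a, ha⟩
    refine ⟨c • a, (ha.const_smul c).congr fun t => ?_⟩
    rw [smul_comm c, map_smul, smul_sub]

/-- The operator `A` such that `S t = e^{-tA}`:
`A y = - lim_{t ↓ 0} t⁻¹ (S t y - y)` on its domain. -/
def C0Semigroup.opA {X : Type*} [NormedAddCommGroup X] [NormedSpace ℝ X]
    (S : C0Semigroup X) : X →ₗ.[ℝ] X where
  domain := S.generatorDomain
  toFun :=
    { toFun := fun y => -(y.2.choose)
      map_add' := by
        intro x y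
        have h := tendsto_nhds_unique (x + y).2.choose_spec
          ((x.2.choose_spec.add y.2.choose_spec).congr fun t => by
            rw [← smul_add, Submodule.coe_add, map_add]
            congr 1
            abel)
        rw [h]
        abel
      map_smul' := by
        intro c x
        have h := tendsto_nhds_unique (c • x).2.choose_spec
          ((x.2.choose_spec.const_smul c).congr fun t => by
            rw [smul_comm c, Submodule.coe_smul, map_smul, smul_sub])
        rw [h]
        simp }

/-- The domain of the adjoint of an unbounded operator `A` on `X`. -/
def adjointDomain {X : Type*} [NormedAddCommGroup X] [NormedSpace ℝ X] (A : X →ₗ.[ℝ] X) :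
    Set (StrongDual ℝ X) :=
  {φ | ∃ c : ℝ, ∀ y : A.domain, |φ (A y)| ≤ c * ‖(y : X)‖}

/-- Reflexivity of a normed space. -/
def IsReflexiveSpace (X : Type*) [NormedAddCommGroup X] [NormedSpace ℝ X] : Prop :=
  Function.Surjective (NormedSpace.inclusionInDoubleDual ℝ X)

/-- Lebesgue measure on the interval `(0,T)`. -/
abbrev timeMeasure (T : ℝ) : Measure ℝ := volume.restrict (Set.Ioc 0 T)

/-- The class of `g` modulo null sets of `(0,T)` belongs to `C([0,T]; X)`. -/
def HasContinuousRep {X : Type*} [NormedAddCommGroup X] (T : ℝ) (g : ℝ → X) : Prop :=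
  ∃ h : ℝ → X, ContinuousOn h (Set.Icc 0 T) ∧ g =ᵐ[timeMeasure T] h

/-- `y ∈ C([0,T]; X)` is a mild solution of `y' + A y = G(t, y)`, `y(0) = y₀`, with
`S t = e^{-tA}`. -/
def IsMildSolution {X : Type*} [NormedAddCommGroup X] [NormedSpace ℝ X] (S : C0Semigroup X)
    (T : ℝ) (y₀ : X) (G : ℝ → X → X) (y : ℝ → X) : Prop :=
  ContinuousOn y (Set.Icc 0 T) ∧
    ∀ t ∈ Set.Icc 0 T, y t = S.toFun t y₀ + ∫ s in (0 : ℝ)..t, S.toFun (t - s) (G s (y s))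

/-- `p ∈ C([0,T]; X*)` is a mild (backward) solution of `-p' + A* p = G(t, p)`, `p(T) = p_T`, with
`S t = e^{-tA}`; the dual semigroup `e^{-tA*} = (e^{-tA})*` acts by `φ ↦ φ ∘ S t`. -/
def IsMildBackwardSolution {X : Type*} [NormedAddCommGroup X] [NormedSpace ℝ X]
    (S : C0Semigroup X) (T : ℝ) (pT : StrongDual ℝ X)
    (G : ℝ → StrongDual ℝ X → StrongDual ℝ X) (p : ℝ → StrongDual ℝ X) : Prop :=
  ContinuousOn p (Set.Icc 0 T) ∧
    ∀ t ∈ Set.Icc 0 T,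
      p t = pT.comp (S.toFun (T - t)) + ∫ s in t..T, (G s (p s)).comp (S.toFun (s - t))

/-- The data of the bilinear optimal control problem: minimize
`α ∫ u + ½ ∫ q(Ψ - Ψ_d) + ½ q_T(Ψ(T) - Ψ_{dT})` subject to
`Ψ' + A Ψ = f + u (B₁ + B₂ Ψ)`, `Ψ(0) = Ψ₀`, `u_m ≤ u ≤ u_M`,
where `q(y) = ⟨Q y, y⟩` and `q_T(y) = ⟨Q_T y, y⟩`. -/
structure BilinearProblem (H : Type*) [NormedAddCommGroup H] [NormedSpace ℝ H] where
  T : ℝ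
  T_pos : 0 < T
  S : C0Semigroup H
  Ψ₀ : H
  f : ℝ → H
  integrable_f : Integrable f (timeMeasure T)
  B₁ : H
  B₂ : H →L[ℝ] H
  α : ℝ
  Q : H →L[ℝ] StrongDual ℝ H
  Q_symm : ∀ x y, Q x y = Q y x
  QT : H →L[ℝ] StrongDual ℝ H
  QT_symm : ∀ x y, QT x y = QT y x
  Ψd : ℝ → H
  memLp_Ψd : MemLp Ψd ⊤ (timeMeasure T)
  ΨdT : H
  um : ℝ
  uM : ℝ
  um_lt_uM : um < uM

namespace BilinearProblem

/-- The operator `A` with `e^{-tA} = S t`. -/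
abbrev A {H : Type*} [NormedAddCommGroup H] [NormedSpace ℝ H] (P : BilinearProblem H) :
    H →ₗ.[ℝ] H := P.S.opA

/-- The state `Ψ[u]`: the mild solution of `Ψ' + A Ψ = f + u (B₁ + B₂ Ψ)`, `Ψ(0) = Ψ₀`. It exists
and is unique on `[0,T]` for every `u ∈ L¹(0,T)`; values off `[0,T]` are irrelevant. -/
def state {H : Type*} [NormedAddCommGroup H] [NormedSpace ℝ H] (P : BilinearProblem H)
    (u : ℝ → ℝ) : ℝ → H :=
  Classical.epsilon
    (IsMildSolution P.S P.T P.Ψ₀ (fun s y => P.f s + u s • (P.B₁ + P.B₂ y)))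

/-- The cost `J(u, Ψ)`. -/
def cost {H : Type*} [NormedAddCommGroup H] [NormedSpace ℝ H] (P : BilinearProblem H)
    (u : ℝ → ℝ) (Ψ : ℝ → H) : ℝ :=
  P.α * (∫ t in (0 : ℝ)..P.T, u t)
    + 1 / 2 * (∫ t in (0 : ℝ)..P.T, P.Q (Ψ t - P.Ψd t) (Ψ t - P.Ψd t))
    + 1 / 2 * P.QT (Ψ P.T - P.ΨdT) (Ψ P.T - P.ΨdT)

/-- The reduced cost `F(u) = J(u, Ψ[u])`. -/
def reducedCost {H : Type*} [NormedAddCommGroup H] [NormedSpace ℝ H] (P : BilinearProblem H)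
    (u : ℝ → ℝ) : ℝ :=
  P.cost u (P.state u)

/-- The set of feasible controls. -/
def Uad {H : Type*} [NormedAddCommGroup H] [NormedSpace ℝ H] (P : BilinearProblem H) :
    Set (ℝ → ℝ) :=
  {u | Integrable u (timeMeasure P.T) ∧ ∀ᵐ t ∂(timeMeasure P.T), P.um ≤ u t ∧ u t ≤ P.uM}

/-- The costate `p[u]`: the mild solution of `-p' + A* p = Q(Ψ - Ψ_d) + u B₂* p`,
`p(T) = Q_T(Ψ(T) - Ψ_{dT})`, where `Ψ = Ψ[u]`. -/
def costate {H : Type*} [NormedAddCommGroup H] [NormedSpace ℝ H] (P : BilinearProblem H)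
    (u : ℝ → ℝ) : ℝ → StrongDual ℝ H :=
  Classical.epsilon
    (IsMildBackwardSolution P.S P.T (P.QT (P.state u P.T - P.ΨdT))
      (fun s p => P.Q (P.state u s - P.Ψd s) + u s • p.comp P.B₂))

/-- `ℬ(t) = B₁ + B₂ Ψ̂(t)`. -/
def calB {H : Type*} [NormedAddCommGroup H] [NormedSpace ℝ H] (P : BilinearProblem H)
    (u : ℝ → ℝ) (t : ℝ) : H :=
  P.B₁ + P.B₂ (P.state u t)

/-- `Λ(t) = α + ⟨p̂(t), B₁ + B₂ Ψ̂(t)⟩`. -/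
def Lam {H : Type*} [NormedAddCommGroup H] [NormedSpace ℝ H] (P : BilinearProblem H)
    (u : ℝ → ℝ) (t : ℝ) : ℝ :=
  P.α + P.costate u t (P.calB u t)

/-- The linearized state `z[v]` at `u`: the mild solution of
`z' + A z = u B₂ z + v (B₁ + B₂ Ψ[u])`, `z(0) = 0`. -/
def linState {H : Type*} [NormedAddCommGroup H] [NormedSpace ℝ H] (P : BilinearProblem H)
    (u v : ℝ → ℝ) : ℝ → H :=
  Classical.epsilon
    (IsMildSolution P.S P.T 0 (fun s y => u s • P.B₂ y + v s • P.calB u s))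

end BilinearProblem

/-- The primitive `w(t) = ∫₀ᵗ v`. -/
def primitive (v : ℝ → ℝ) (t : ℝ) : ℝ := ∫ s in (0 : ℝ)..t, v s

/-- The state component `ξ = z[v] - w ℬ` of the Goh transform of `(v, z[v])`. -/
def gohXi {H : Type*} [NormedAddCommGroup H] [NormedSpace ℝ H] (P : BilinearProblem H)
    (u v : ℝ → ℝ) (t : ℝ) : H :=
  P.linState u v t - primitive v t • P.calB u t

/-- The standing assumptions on `A`, `B₁`, `B₂` and on the space `E` (embedded in `H` by `ι`):
`E` has the restriction property and contains `dom A`, `B₁ ∈ dom A`, `dom A` is stable under `B₂`,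
`dom A*` is stable under `B₂*`, and `M₁`, `M₂` are the continuous extensions to `E` of the
commutators `[A, B₂]`, `[A, B₂²]` (unique, because `dom A` is dense in `E`). -/
structure GohSetting {H : Type*} [NormedAddCommGroup H] [NormedSpace ℝ H] (P : BilinearProblem H)
    (E : Type*) [NormedAddCommGroup E] [NormedSpace ℝ E] where
  ι : E →L[ℝ] H
  ι_injective : Function.Injective ι
  domain_subset : ∀ y ∈ P.A.domain, y ∈ Set.range ι
  /-- the restriction of the semigroup to `E` -/
  SE : C0Semigroup E
  SE_restrict : ∀ t : ℝ, 0 ≤ t → ∀ e : E, ι (SE.toFun t e) = P.S.toFun t (ι e)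
  /-- the restriction of `B₂` to `E` -/
  B₂E : E →L[ℝ] E
  B₂E_restrict : ∀ e : E, ι (B₂E e) = P.B₂ (ι e)
  B₁_mem : P.B₁ ∈ P.A.domain
  B₂_mem : ∀ y ∈ P.A.domain, P.B₂ y ∈ P.A.domain
  B₂_adjoint_mem : ∀ φ ∈ adjointDomain P.A, φ.comp P.B₂ ∈ adjointDomain P.A
  M₁ : E →L[ℝ] H
  M₁_extends : ∀ (e : E) (he : ι e ∈ P.A.domain),
    M₁ e = P.A ⟨P.B₂ (ι e), B₂_mem _ he⟩ - P.B₂ (P.A ⟨ι e, he⟩)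
  M₂ : E →L[ℝ] H
  M₂_extends : ∀ (e : E) (he : ι e ∈ P.A.domain),
    M₂ e = P.A ⟨P.B₂ (P.B₂ (ι e)), B₂_mem _ (B₂_mem _ he)⟩ - P.B₂ (P.B₂ (P.A ⟨ι e, he⟩))

namespace GohSetting

/-- The commutator `[M₁, B₂] = M₁ B₂ - B₂ M₁`, as an operator from `E` to `H`. -/
def bracketM₁ {H : Type*} [NormedAddCommGroup H] [NormedSpace ℝ H] {P : BilinearProblem H}
    {E : Type*} [NormedAddCommGroup E] [NormedSpace ℝ E] (G : GohSetting P E) : E →L[ℝ] H :=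
  G.M₁.comp G.B₂E - P.B₂.comp G.M₁

/-- `ψ` represents the state `Ψ[u]` as an element of `L²(0,T; E)`. -/
def IsStateRep {H : Type*} [NormedAddCommGroup H] [NormedSpace ℝ H] {P : BilinearProblem H}
    {E : Type*} [NormedAddCommGroup E] [NormedSpace ℝ E] (G : GohSetting P E)
    (u : ℝ → ℝ) (ψ : ℝ → E) : Prop :=
  MemLp ψ 2 (timeMeasure P.T) ∧ ∀ᵐ t ∂(timeMeasure P.T), G.ι (ψ t) = P.state u t

/-- `m` represents `M* p`, for a costate `p` and `M ∈ L(E, H)`, as a function with values in `H*`: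
for a.a. `t` the functional `M* p(t) = p(t) ∘ M ∈ E*` is the restriction to `E` of `m(t) ∈ H*`. -/
def IsAdjointRep {H : Type*} [NormedAddCommGroup H] [NormedSpace ℝ H] {P : BilinearProblem H}
    {E : Type*} [NormedAddCommGroup E] [NormedSpace ℝ E] (G : GohSetting P E)
    (M : E →L[ℝ] H) (p m : ℝ → StrongDual ℝ H) : Prop :=
  ∀ᵐ t ∂(timeMeasure P.T), (m t).comp G.ι = (p t).comp M

/-- `r = B₂² f - A B₂ B₁ + 2 B₂ A B₁ - [M₁, B₂] Ψ̂`, with `ψ` the `E`-valued version of `Ψ̂`. -/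
def r {H : Type*} [NormedAddCommGroup H] [NormedSpace ℝ H] {P : BilinearProblem H}
    {E : Type*} [NormedAddCommGroup E] [NormedSpace ℝ E] (G : GohSetting P E)
    (ψ : ℝ → E) (t : ℝ) : H :=
  P.B₂ (P.B₂ (P.f t)) - P.A ⟨P.B₂ P.B₁, G.B₂_mem _ G.B₁_mem⟩
    + (2 : ℝ) • P.B₂ (P.A ⟨P.B₁, G.B₁_mem⟩) - G.bracketM₁ (ψ t)

/-- `R = q(ℬ) + ⟨Q(Ψ̂ - Ψ_d), B₂ ℬ⟩ + ⟨p̂, r⟩`. -/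
def R {H : Type*} [NormedAddCommGroup H] [NormedSpace ℝ H] {P : BilinearProblem H}
    {E : Type*} [NormedAddCommGroup E] [NormedSpace ℝ E] (G : GohSetting P E)
    (u : ℝ → ℝ) (ψ : ℝ → E) (t : ℝ) : ℝ :=
  P.Q (P.calB u t) (P.calB u t) + P.Q (P.state u t - P.Ψd t) (P.B₂ (P.calB u t))
    + P.costate u t (G.r ψ t)

end GohSetting

/-- The terminal part of the transformed quadratic form. -/
def OmegaT {H : Type*} [NormedAddCommGroup H] [NormedSpace ℝ H] (P : BilinearProblem H)
    (u : ℝ → ℝ) (ξ : ℝ → H) (h : ℝ) : ℝ :=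
  P.QT (ξ P.T + h • P.calB u P.T) (ξ P.T + h • P.calB u P.T)
    + h ^ 2 * P.costate u P.T (P.B₂ P.B₁ + P.B₂ (P.B₂ (P.state u P.T)))
    + 2 * h * P.costate u P.T (P.B₂ (ξ P.T))

/-- The mixed part of the transformed quadratic form; `m₁` represents `M₁* p̂`. -/
def OmegaA {H : Type*} [NormedAddCommGroup H] [NormedSpace ℝ H] (P : BilinearProblem H)
    (u : ℝ → ℝ) (m₁ : ℝ → StrongDual ℝ H) (ξ : ℝ → H) (w : ℝ → ℝ) : ℝ :=
  ∫ t in (0 : ℝ)..P.T,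
    (P.Q (ξ t) (ξ t) + 2 * w t * P.Q (ξ t) (P.calB u t)
      + 2 * w t * P.Q (P.state u t - P.Ψd t) (P.B₂ (ξ t)) - 2 * w t * m₁ t (ξ t))

/-- The part of the transformed quadratic form that depends on `w` only. -/
def OmegaB {H : Type*} [NormedAddCommGroup H] [NormedSpace ℝ H] {P : BilinearProblem H}
    {E : Type*} [NormedAddCommGroup E] [NormedSpace ℝ E] (G : GohSetting P E)
    (u : ℝ → ℝ) (ψ : ℝ → E) (w : ℝ → ℝ) : ℝ :=
  ∫ t in (0 : ℝ)..P.T, w t ^ 2 * G.R u ψ t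

/-- The transformed quadratic form `Ω̂(ξ, w, h)` at the control `u`. -/
def Omega {H : Type*} [NormedAddCommGroup H] [NormedSpace ℝ H] {P : BilinearProblem H}
    {E : Type*} [NormedAddCommGroup E] [NormedSpace ℝ E] (G : GohSetting P E)
    (u : ℝ → ℝ) (ψ : ℝ → E) (m₁ : ℝ → StrongDual ℝ H) (ξ : ℝ → H) (w : ℝ → ℝ) (h : ℝ) : ℝ :=
  OmegaT P u ξ h + OmegaA P u m₁ ξ w + OmegaB G u ψ w

/-- Convergence to `0` in the Pontryagin sense: bounded in `L^∞(0,T)`, and tending to `0` in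
`L¹(0,T)`. -/
def PontryaginTendsto (T : ℝ) (v : ℕ → ℝ → ℝ) : Prop :=
  (∀ k, AEStronglyMeasurable (v k) (timeMeasure T)) ∧
    (∃ C : ℝ, ∀ k, ∀ᵐ t ∂(timeMeasure T), |v k t| ≤ C) ∧
    Tendsto (fun k => ∫ t in (0 : ℝ)..T, |v k t|) atTop (𝓝 0)

end

/-! Notation: w is the primitive of v, z the linearized state, η the second order remainder
`remState`, δ = z + η the exact variation of the state, ξ = z - wℬ, and κ = ‖v‖₁ + ‖v‖₂.

Exact identity. Pairing the equation of δ with that of the costate shows that twice J(û+v) - J(û) -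
∫Λv equals ∫q(δ) + q_T(δ(T)) + 2∫v⟨p̂,B₂δ⟩ (`two_mul_cost_sub`). The last term contains v, whereas
only w may enter the error. It is therefore integrated by parts with v = w', once against ⟨B₂*p̂,δ⟩
and once, with w² as weight, against ⟨B₂*p̂,ℬ⟩ (`two_mul_integral_costate_B₂`). Both pairings must
then be primitives of integrable functions, which holds because ℬ and B₂*p̂ are again mild
solutions, with sources containing the commutator M₁ (`isMildOn_B₂`, `isBackwardMildOn_comp_B₂`).
Inserting z = ξ + wℬ shows that Ω̂ is the same expression with δ replaced by z and the triple
product dropped (`Omega_eq_auxForm`). Hence twice the error is exactly auxForm(δ) - auxForm(z) -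
2∫wv⟨p̂,B₂²δ⟩ (`two_mul_remainder`).

Sizes. The source of ξ contains w but not v, so ‖ξ‖_∞ ≤ k‖w‖₂ and |z(t)| ≤ k‖w‖₂ + b|w(t)|. The
source of η is vB₂z, so ‖η‖_∞ ≤ Kκ‖w‖₂. The difference of the two forms, and the part of the triple
product carrying ξ + η, are thus O(κ)(‖w‖₂² + w(T)²), and κ → 0 because ‖v‖₂² ≤ C‖v‖₁.

What remains is ∫w²vβ with β = ⟨p̂,B₂²ℬ⟩ continuous. The bound on v in L^∞ gives only O(‖w‖₂²). If β
is a polynomial, w²v = (w³)'/3 can be integrated by parts and ‖w‖_∞ ≤ ‖v‖₁ → 0 supplies the missing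
factor; the general case follows by Weierstrass approximation (`isLittleO_cubic`).

Mild solutions need not be differentiable, so the product rules rest on Fubini's theorem on a
triangle. Unbounded operators are handled through averages ε⁻¹∫₀^ε S(r)x dr, which lie in dom A and
tend to x. -/

open MeasureTheory Filter Topology Asymptotics

noncomputable section

set_option linter.unusedSectionVars false

/-! ### Strongly continuous semigroups: bounds, averages, generator, dual semigroup. -/

namespace C0Semigroup

variable {X : Type*} [NormedAddCommGroup X] [NormedSpace ℝ X] (S : C0Semigroup X)

/-- The semigroup, extended by the identity to negative times. -/
def pos (t : ℝ) : X →L[ℝ] X := S.toFun (max t 0)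

lemma pos_of_nonneg {t : ℝ} (ht : 0 ≤ t) : S.pos t = S.toFun t := by
  rw [pos, max_eq_left ht]

lemma pos_of_nonpos {t : ℝ} (ht : t ≤ 0) : S.pos t = ContinuousLinearMap.id ℝ X := by
  rw [pos, max_eq_right ht, S.toFun_zero]

@[simp] lemma pos_zero_apply (x : X) : S.pos 0 x = x := by
  rw [S.pos_of_nonpos le_rfl]; rfl

lemma pos_add {s t : ℝ} (hs : 0 ≤ s) (ht : 0 ≤ t) (x : X) :
    S.pos (s + t) x = S.pos s (S.pos t x) := by
  rw [S.pos_of_nonneg hs, S.pos_of_nonneg ht, S.pos_of_nonneg (add_nonneg hs ht),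
    S.toFun_add s t hs ht]; rfl

lemma pos_sub_comp {r s t : ℝ} (hrs : r ≤ s) (hst : s ≤ t) (x : X) :
    S.pos (t - s) (S.pos (s - r) x) = S.pos (t - r) x := by
  rw [← S.pos_add (sub_nonneg.2 hst) (sub_nonneg.2 hrs)]; congr 2; ring

lemma continuous_pos_apply (x : X) : Continuous fun t => S.pos t x :=
  (S.continuousOn_orbit x).comp_continuous (continuous_id.max continuous_const)
    fun t => le_max_right t 0

/-- Orbits are bounded on a compact interval, so the uniform boundedness principle applies. Negative
times cost nothing, since `pos` is the identity there. -/
lemma exists_bound [CompleteSpace X] (T : ℝ) : ∃ M, 1 ≤ M ∧ ∀ t ≤ T, ‖S.pos t‖ ≤ M := by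
  obtain ⟨C, hC⟩ := banach_steinhaus (g := fun t : Set.Icc (0 : ℝ) (max T 0) => S.pos t)
    (fun x => by
      obtain ⟨C, hC⟩ := (isCompact_Icc (a := (0 : ℝ)) (b := max T 0)).exists_bound_of_continuousOn
        (S.continuous_pos_apply x).continuousOn
      exact ⟨C, fun t => hC t t.2⟩)
  refine ⟨max C 1, le_max_right _ _, fun t ht => ?_⟩
  have h := hC ⟨max t 0, le_max_right _ _, max_le_max_right 0 ht⟩
  refine le_trans ?_ (h.trans (le_max_left _ _))
  simp [pos]

/-- Strong continuity together with locally bounded operator norms. Joint continuity gives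
measurability of s ↦ S(t - s)g(s) and limits in which time and vector both move. -/
lemma continuous_pos [CompleteSpace X] : Continuous fun q : ℝ × X => S.pos q.1 q.2 := by
  rw [continuous_iff_continuousAt]
  rintro ⟨t₀, x₀⟩
  obtain ⟨M, hM1, hM⟩ := S.exists_bound (t₀ + 1)
  rw [ContinuousAt, tendsto_iff_norm_sub_tendsto_zero]
  have h1 : Tendsto (fun q : ℝ × X => M * ‖q.2 - x₀‖ + ‖S.pos q.1 x₀ - S.pos t₀ x₀‖)
      (𝓝 (t₀, x₀)) (𝓝 0) := by
    have : Continuous fun q : ℝ × X => M * ‖q.2 - x₀‖ + ‖S.pos q.1 x₀ - S.pos t₀ x₀‖ := by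
      have := (S.continuous_pos_apply x₀).comp (continuous_fst (X := ℝ) (Y := X))
      simp only [Function.comp_def] at this
      fun_prop
    simpa using this.tendsto (t₀, x₀)
  refine squeeze_zero' (Eventually.of_forall fun _ => norm_nonneg _) ?_ h1
  have : ∀ᶠ q : ℝ × X in 𝓝 (t₀, x₀), q.1 < t₀ + 1 :=
    continuous_fst.tendsto (t₀, x₀) |>.eventually (gt_mem_nhds (lt_add_one t₀))
  filter_upwards [this] with q hq
  calc ‖S.pos q.1 q.2 - S.pos t₀ x₀‖
      = ‖S.pos q.1 (q.2 - x₀) + (S.pos q.1 x₀ - S.pos t₀ x₀)‖ := by rw [map_sub]; congr 1; abel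
    _ ≤ _ := (norm_add_le _ _).trans (add_le_add_left ((S.pos q.1).le_of_opNorm_le
        (hM _ hq.le) _) _)

variable [CompleteSpace X]

lemma _root_.Continuous.c0_pos {α : Type*} [TopologicalSpace α] {S : C0Semigroup X}
    {τ : α → ℝ} {g : α → X} (hτ : Continuous τ) (hg : Continuous g) :
    Continuous fun a => S.pos (τ a) (g a) :=
  S.continuous_pos.comp (hτ.prodMk hg)

lemma _root_.MeasureTheory.AEStronglyMeasurable.c0_pos {α : Type*} [MeasurableSpace α]
    {μ : Measure α} {S : C0Semigroup X} {τ : α → ℝ} {g : α → X} (hτ : AEStronglyMeasurable τ μ)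
    (hg : AEStronglyMeasurable g μ) : AEStronglyMeasurable (fun a => S.pos (τ a) (g a)) μ :=
  S.continuous_pos.comp_aestronglyMeasurable (hτ.prodMk hg)

lemma _root_.MeasureTheory.Integrable.c0_pos {α : Type*} [MeasurableSpace α]
    {μ : Measure α} {S : C0Semigroup X} {τ : α → ℝ} {g : α → X} {T : ℝ}
    (hg : Integrable g μ) (hτ : AEStronglyMeasurable τ μ) (hτT : ∀ᵐ a ∂μ, τ a ≤ T) :
    Integrable (fun a => S.pos (τ a) (g a)) μ := by
  obtain ⟨M, hM1, hM⟩ := S.exists_bound T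
  refine (hg.norm.const_mul M).mono' (hτ.c0_pos hg.1) ?_
  filter_upwards [hτT] with a ha
  exact (S.pos (τ a)).le_of_opNorm_le (hM _ ha) _

/-- The integral `∫₀^ε S r x dr`, as a bounded operator in `x`. -/
def avg (ε : ℝ) : X →L[ℝ] X :=
  LinearMap.mkContinuous
    { toFun := fun x => ∫ r in (0 : ℝ)..ε, S.pos r x
      map_add' := fun x y => by
        simp only [map_add]
        exact intervalIntegral.integral_add ((S.continuous_pos_apply x).intervalIntegrable _ _)
          ((S.continuous_pos_apply y).intervalIntegrable _ _)
      map_smul' := fun c x => by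
        simp only [map_smul, intervalIntegral.integral_smul, RingHom.id_apply] }
    ((S.exists_bound |ε|).choose * |ε|) fun x => by
      obtain ⟨h1, hM⟩ := (S.exists_bound |ε|).choose_spec
      set M := (S.exists_bound |ε|).choose
      have := intervalIntegral.norm_integral_le_of_norm_le_const (a := 0) (b := ε)
        (f := fun r => S.pos r x) (C := M * ‖x‖) fun r hr => by
          refine (S.pos r).le_of_opNorm_le (hM _ ?_) _
          have h2 := (Set.uIoc_subset_uIcc hr).2
          exact h2.trans (sup_le (abs_nonneg _) (le_abs_self _))
      refine this.trans (le_of_eq ?_)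
      rw [sub_zero]; ring

lemma avg_apply (ε : ℝ) (x : X) : S.avg ε x = ∫ r in (0 : ℝ)..ε, S.pos r x := rfl

lemma pos_avg {t : ℝ} (ht : 0 ≤ t) {ε : ℝ} (hε : 0 ≤ ε) (x : X) :
    S.pos t (S.avg ε x) = ∫ r in t..t + ε, S.pos r x := by
  rw [avg_apply, ← ContinuousLinearMap.intervalIntegral_comp_comm _
    ((S.continuous_pos_apply x).intervalIntegrable _ _)]
  have : ∫ r in (0 : ℝ)..ε, S.pos t (S.pos r x) = ∫ r in (0 : ℝ)..ε, S.pos (t + r) x := by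
    refine intervalIntegral.integral_congr fun r hr => ?_
    rw [Set.uIcc_of_le hε] at hr
    exact (S.pos_add ht hr.1 x).symm
  rw [this, intervalIntegral.integral_comp_add_left (fun r => S.pos r x), add_zero]

lemma pos_avg_comm {t : ℝ} (ht : 0 ≤ t) {ε : ℝ} (hε : 0 ≤ ε) (x : X) :
    S.pos t (S.avg ε x) = S.avg ε (S.pos t x) := by
  rw [avg_apply, avg_apply, ← ContinuousLinearMap.intervalIntegral_comp_comm _
    ((S.continuous_pos_apply x).intervalIntegrable _ _)]
  refine intervalIntegral.integral_congr fun r hr => ?_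
  rw [Set.uIcc_of_le hε] at hr
  rw [← S.pos_add ht hr.1, ← S.pos_add hr.1 ht, add_comm]

/-- The semigroup shifts the window of integration, so the difference quotient converges to the
difference of the values of the orbit at the two ends of the window. -/
lemma avg_mem_generatorDomain {ε : ℝ} (hε : 0 ≤ ε) (x : X) : S.avg ε x ∈ S.generatorDomain := by
  refine ⟨S.pos ε x - S.pos 0 x, ?_⟩
  have hc := S.continuous_pos_apply x
  have h1 : HasDerivAt (fun t : ℝ => ∫ r in (0 : ℝ)..t, S.pos r x) (S.pos 0 x) 0 :=
    intervalIntegral.integral_hasDerivAt_right (hc.intervalIntegrable _ _)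
      (hc.stronglyMeasurableAtFilter _ _) hc.continuousAt
  have h2 : HasDerivAt (fun t : ℝ => ∫ r in (0 : ℝ)..t, S.pos r x) (S.pos ε x) (0 + ε) := by
    rw [zero_add]
    exact intervalIntegral.integral_hasDerivAt_right (hc.intervalIntegrable _ _)
      (hc.stronglyMeasurableAtFilter _ _) hc.continuousAt
  have h3 : HasDerivAt (fun t : ℝ => ∫ r in t..t + ε, S.pos r x) (S.pos ε x - S.pos 0 x) 0 := by
    refine ((h2.comp_add_const 0 ε).sub h1).congr_of_eventuallyEq (Eventually.of_forall fun t => ?_)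
    exact (intervalIntegral.integral_interval_sub_left (hc.intervalIntegrable _ _)
      (hc.intervalIntegrable _ _)).symm
  have h4 := h3.tendsto_slope_zero_right
  refine h4.congr' ?_
  filter_upwards [self_mem_nhdsWithin] with t (ht : 0 < t)
  rw [zero_add, ← S.pos_of_nonneg ht.le, S.pos_avg ht.le hε, zero_add]
  rfl

lemma tendsto_avg (x : X) : Tendsto (fun ε : ℝ => ε⁻¹ • S.avg ε x) (𝓝[>] 0) (𝓝 x) := by
  have hc := S.continuous_pos_apply x
  have h1 : HasDerivAt (fun t : ℝ => ∫ r in (0 : ℝ)..t, S.pos r x) (S.pos 0 x) 0 :=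
    intervalIntegral.integral_hasDerivAt_right (hc.intervalIntegrable _ _)
      (hc.stronglyMeasurableAtFilter _ _) hc.continuousAt
  have := h1.tendsto_slope_zero_right
  simpa [avg_apply] using this

/-- Uniformity in ε provides the dominating functions when ε → 0 under an integral. -/
lemma exists_avg_bound : ∃ M, ∀ ε : ℝ, 0 < ε → ε ≤ 1 → ∀ x, ‖ε⁻¹ • S.avg ε x‖ ≤ M * ‖x‖ := by
  obtain ⟨M, h1, hM⟩ := S.exists_bound 1
  refine ⟨M, fun ε hε hε1 x => ?_⟩
  have := intervalIntegral.norm_integral_le_of_norm_le_const (a := 0) (b := ε)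
    (f := fun r => S.pos r x) (C := M * ‖x‖) fun r hr => by
      rw [Set.uIoc_of_le hε.le] at hr
      exact (S.pos r).le_of_opNorm_le (hM _ (hr.2.trans hε1)) _
  rw [norm_smul, norm_inv, Real.norm_of_nonneg hε.le, inv_mul_le_iff₀ hε, avg_apply]
  refine this.trans (le_of_eq ?_)
  rw [sub_zero, abs_of_pos hε]; ring

omit [CompleteSpace X] in
lemma tendsto_opA (y : S.opA.domain) :
    Tendsto (fun t : ℝ => t⁻¹ • (S.pos t y - y)) (𝓝[>] 0) (𝓝 (-(S.opA y))) := by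
  have h : S.opA y = -(y.2.choose) := rfl
  rw [h, neg_neg]
  refine y.2.choose_spec.congr' ?_
  filter_upwards [self_mem_nhdsWithin] with t (ht : 0 < t)
  rw [S.pos_of_nonneg ht.le]

omit [CompleteSpace X] in
-- The operator is defined by a choice of limit; uniqueness of limits allows any exhibited limit to
-- replace that choice.
lemma opA_eq_of_tendsto {y l : X} (h : Tendsto (fun t : ℝ => t⁻¹ • (S.pos t y - y)) (𝓝[>] 0) (𝓝 l)) :
    ∃ hy : y ∈ S.opA.domain, S.opA ⟨y, hy⟩ = -l := by
  have hy : y ∈ S.opA.domain := ⟨l, h.congr' <| by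
    filter_upwards [self_mem_nhdsWithin] with t (ht : 0 < t)
    rw [S.pos_of_nonneg ht.le]⟩
  exact ⟨hy, by rw [eq_neg_iff_add_eq_zero, ← neg_eq_iff_add_eq_zero]
                exact tendsto_nhds_unique (S.tendsto_opA ⟨y, hy⟩) h⟩

omit [CompleteSpace X] in
lemma pos_mem_domain {t : ℝ} (ht : 0 ≤ t) (y : S.opA.domain) :
    ∃ h : S.pos t y ∈ S.opA.domain, S.opA ⟨S.pos t y, h⟩ = S.pos t (S.opA y) := by
  have h1 := ((S.pos t).continuous.tendsto _).comp (S.tendsto_opA y)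
  obtain ⟨h, h'⟩ := S.opA_eq_of_tendsto (y := S.pos t y) (l := S.pos t (-(S.opA y))) <| by
    refine h1.congr' ?_
    filter_upwards [self_mem_nhdsWithin] with s (hs : 0 < s)
    simp only [Function.comp_apply, map_smul, map_sub]
    rw [← S.pos_add ht hs.le, ← S.pos_add hs.le ht, add_comm]
  exact ⟨h, by rw [h', map_neg, neg_neg]⟩

omit [CompleteSpace X] in
-- A right derivative is all that the generator gives directly, and it suffices for the fundamental
-- theorem of calculus along a continuous orbit.
lemma hasDerivWithinAt_pos {t : ℝ} (ht : 0 ≤ t) (y : S.opA.domain) :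
    HasDerivWithinAt (fun s => S.pos s y) (-(S.pos t (S.opA y))) (Set.Ioi t) t := by
  rw [hasDerivWithinAt_iff_tendsto_slope' (by simp)]
  obtain ⟨h, h'⟩ := S.pos_mem_domain ht y
  have h1 := S.tendsto_opA ⟨S.pos t y, h⟩
  rw [h'] at h1
  have h2 : Tendsto (fun s : ℝ => s - t) (𝓝[>] t) (𝓝[>] 0) := by
    refine tendsto_nhdsWithin_iff.2 ⟨?_, ?_⟩
    · have : Tendsto (fun s : ℝ => s - t) (𝓝 t) (𝓝 (t - t)) := by
        exact (continuous_id.sub continuous_const).tendsto t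
      rw [sub_self] at this
      exact this.mono_left nhdsWithin_le_nhds
    · filter_upwards [self_mem_nhdsWithin] with s (hs : t < s)
      exact sub_pos.2 hs
  refine (h1.comp h2).congr' ?_
  filter_upwards [self_mem_nhdsWithin] with s (hs : t < s)
  simp only [Function.comp_apply, slope, vsub_eq_sub]
  rw [← S.pos_add (sub_pos.2 hs).le ht, sub_add_cancel]

/-- Orbits of elements of the domain are integrals of their derivative. -/
lemma pos_apply_sub_self {t : ℝ} (ht : 0 ≤ t) (y : S.opA.domain) :
    S.pos t y - y = -∫ s in (0 : ℝ)..t, S.pos s (S.opA y) := by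
  have := intervalIntegral.integral_eq_sub_of_hasDeriv_right_of_le ht
    (S.continuous_pos_apply (y : X)).continuousOn (f' := fun s => -(S.pos s (S.opA y)))
    (fun s hs => S.hasDerivWithinAt_pos hs.1.le y)
    ((S.continuous_pos_apply _).neg.intervalIntegrable _ _)
  rw [pos_zero_apply] at this
  rw [← this, intervalIntegral.integral_neg]

omit [CompleteSpace X] in
@[simp] lemma pos_max_zero (t : ℝ) : S.pos (max t 0) = S.pos t := by simp [pos]

/-- Averaged functionals are norm continuous along the dual semigroup. -/
lemma continuous_dual_avg (φ : StrongDual ℝ X) {ε : ℝ} (hε : 0 ≤ ε) :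
    Continuous fun t => (φ.comp (S.avg ε)).comp (S.pos t) := by
  rw [continuous_iff_continuousAt]
  intro t₀
  obtain ⟨M, hM1, hM⟩ := S.exists_bound (max t₀ 0 + 1 + ε)
  have main : ∀ s t : ℝ, 0 ≤ s → 0 ≤ t → s ≤ max t₀ 0 + 1 → t ≤ max t₀ 0 + 1 →
      dist ((φ.comp (S.avg ε)).comp (S.pos t)) ((φ.comp (S.avg ε)).comp (S.pos s))
        ≤ ‖φ‖ * (2 * M) * dist t s := by
    intro s t hs ht hs' ht'
    rw [dist_eq_norm]
    refine ContinuousLinearMap.opNorm_le_bound _ (by positivity) fun x => ?_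
    have hc := S.continuous_pos_apply x
    -- The averages at times s and t integrate the same orbit over shifted windows, so only the ends
    -- contribute. The resulting Lipschitz bound is linear in ‖x‖, hence a bound in operator norm.
    have key : S.avg ε (S.pos t x) - S.avg ε (S.pos s x)
        = (∫ r in (s + ε)..(t + ε), S.pos r x) - ∫ r in s..t, S.pos r x := by
      rw [← S.pos_avg_comm ht hε, ← S.pos_avg_comm hs hε, S.pos_avg ht hε, S.pos_avg hs hε]
      exact intervalIntegral.integral_interval_sub_interval_comm' (hc.intervalIntegrable _ _)
        (hc.intervalIntegrable _ _) (hc.intervalIntegrable _ _)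
    have b1 : ‖∫ r in (s + ε)..(t + ε), S.pos r x‖ ≤ M * ‖x‖ * |t + ε - (s + ε)| :=
      intervalIntegral.norm_integral_le_of_norm_le_const fun r hr =>
        (S.pos r).le_of_opNorm_le (hM _ ((Set.uIoc_subset_uIcc hr).2.trans
          (sup_le (by linarith) (by linarith)))) _
    have b2 : ‖∫ r in s..t, S.pos r x‖ ≤ M * ‖x‖ * |t - s| :=
      intervalIntegral.norm_integral_le_of_norm_le_const fun r hr =>
        (S.pos r).le_of_opNorm_le (hM _ ((Set.uIoc_subset_uIcc hr).2.trans
          (sup_le (by linarith) (by linarith)))) _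
    have : ((φ.comp (S.avg ε)).comp (S.pos t) - (φ.comp (S.avg ε)).comp (S.pos s)) x
        = φ (S.avg ε (S.pos t x) - S.avg ε (S.pos s x)) := by simp
    rw [this, key, Real.dist_eq]
    rw [add_sub_add_right_eq_sub] at b1
    calc _ ≤ ‖φ‖ * _ := φ.le_opNorm _
      _ ≤ ‖φ‖ * (M * ‖x‖ * |t - s| + M * ‖x‖ * |t - s|) := by
          gcongr; exact (norm_sub_le _ _).trans (add_le_add b1 b2)
      _ = _ := by ring
  refine continuousAt_of_locally_lipschitz (r := 1) one_pos (‖φ‖ * (2 * M)) fun t hd => ?_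
  have hdm : dist (max t 0) (max t₀ 0) ≤ dist t t₀ := by
    rw [Real.dist_eq, Real.dist_eq]; exact abs_max_sub_max_le_abs t t₀ 0
  have h1 := main (max t₀ 0) (max t 0) (le_max_right _ _) (le_max_right _ _) (by linarith) (by
    have := (abs_lt.1 (lt_of_le_of_lt (by rwa [Real.dist_eq] at hdm) hd)).2
    linarith)
  simp only [pos_max_zero] at h1
  exact h1.trans (by gcongr)

/-- On a reflexive space the dual semigroup is strongly continuous. -/
lemma continuous_dual_pos (hX : IsReflexiveSpace X) (φ : StrongDual ℝ X) :
    Continuous fun t => φ.comp (S.pos t) := by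
  let D : Submodule ℝ (StrongDual ℝ X) :=
    { carrier := {φ | Continuous fun t => φ.comp (S.pos t)}
      zero_mem' := by simpa using continuous_const
      add_mem' := fun {a b} ha hb => by
        simp only [Set.mem_ofPred_eq, ContinuousLinearMap.add_comp] at *
        exact ha.add hb
      smul_mem' := fun c a ha => by
        simp only [Set.mem_ofPred_eq, ContinuousLinearMap.smul_comp] at *
        exact ha.const_smul c }
  -- Norm limits of functionals give locally uniform limits of their orbits, because the semigroup
  -- is bounded up to t₀ + 1.
  have hcl : IsClosed (D : Set (StrongDual ℝ X)) := by
    refine isClosed_of_closure_subset fun φ hφ => ?_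
    refine continuous_of_locally_uniform_approx_of_continuousAt fun t₀ V hV => ?_
    obtain ⟨M, hM1, hM⟩ := S.exists_bound (t₀ + 1)
    obtain ⟨ε, hε, hεV⟩ := Metric.mem_uniformity_dist.1 hV
    have hM0 : 0 < M := by linarith
    obtain ⟨φ', hφ', hd⟩ := Metric.mem_closure_iff.1 hφ (ε / M) (by positivity)
    refine ⟨Set.Iio (t₀ + 1), Iio_mem_nhds (lt_add_one t₀), fun t => φ'.comp (S.pos t),
      Continuous.continuousAt hφ', fun t ht => hεV ?_⟩
    rw [dist_eq_norm, ← ContinuousLinearMap.sub_comp]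
    rw [dist_eq_norm, lt_div_iff₀ hM0] at hd
    exact (ContinuousLinearMap.opNorm_comp_le _ _).trans_lt
      ((mul_le_mul_of_nonneg_left (hM t (le_of_lt ht)) (norm_nonneg _)).trans_lt hd)
  by_contra hφ
  -- A separating functional F vanishes on the subspace D and, by reflexivity, is evaluation at some
  -- x. As ψ ∘ `avg ε` lies in D for every ψ, all averages of x vanish, so x = 0, contradicting the
  -- separation.
  obtain ⟨F, s, hF, hs⟩ := geometric_hahn_banach_point_closed D.convex hcl (x := φ) hφ
  have hF0 : ∀ d ∈ D, F d = 0 := by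
    intro d hd
    by_contra h
    have := hs (((s - 1) / F d) • d) (D.smul_mem _ hd)
    rw [map_smul, smul_eq_mul, div_mul_cancel₀ _ h] at this
    linarith
  obtain ⟨x, rfl⟩ := hX F
  have h0 : ∀ ε : ℝ, 0 ≤ ε → S.avg ε x = 0 := fun ε hε =>
    SeparatingDual.eq_zero_of_forall_dual_eq_zero (R := ℝ) fun ψ => by
      simpa using hF0 (ψ.comp (S.avg ε)) (S.continuous_dual_avg ψ hε)
  have hx : x = 0 := by
    refine tendsto_nhds_unique (S.tendsto_avg x) (Tendsto.congr' ?_ tendsto_const_nhds)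
    filter_upwards [self_mem_nhdsWithin] with ε (hε : 0 < ε)
    rw [h0 ε hε.le, smul_zero]
  have := hs 0 D.zero_mem
  rw [hx] at hF
  simp at hF this
  linarith

end C0Semigroup

/-! ### Fubini's theorem on a triangle. -/

section Triangle

variable {F : Type*} [NormedAddCommGroup F] [NormedSpace ℝ F]

/-- Replacing the variable limit by an indicator moves everything to the square, where integrability
and Fubini are available. -/
lemma triangle_section_left {a b r : ℝ} (hr : r ∈ Set.Ioc a b) (K : ℝ → ℝ → F) :
    ∫ s in a..r, K r s = ∫ s in Set.Ioc a b,
      Set.indicator {q : ℝ × ℝ | q.2 ≤ q.1} (fun q => K q.1 q.2) (r, s) := by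
  have h : (fun s => Set.indicator {q : ℝ × ℝ | q.2 ≤ q.1} (fun q => K q.1 q.2) (r, s))
      = Set.indicator (Set.Iic r) (fun s => K r s) := by
    ext s; simp [Set.indicator]
  rw [h, setIntegral_indicator measurableSet_Iic, intervalIntegral.integral_of_le hr.1.le]
  congr 2
  ext s
  simp only [Set.mem_Ioc, Set.mem_inter_iff, Set.mem_Iic]
  exact ⟨fun h => ⟨⟨h.1, h.2.trans hr.2⟩, h.2⟩, fun h => ⟨h.1.1, h.2⟩⟩

lemma triangle_section_right {a b s : ℝ} (hs : s ∈ Set.Ioc a b) (K : ℝ → ℝ → F) :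
    ∫ r in s..b, K r s = ∫ r in Set.Ioc a b,
      Set.indicator {q : ℝ × ℝ | q.2 ≤ q.1} (fun q => K q.1 q.2) (r, s) := by
  have h : (fun r => Set.indicator {q : ℝ × ℝ | q.2 ≤ q.1} (fun q => K q.1 q.2) (r, s))
      = Set.indicator (Set.Ici s) (fun r => K r s) := by
    ext s; simp [Set.indicator]
  rw [h, setIntegral_indicator measurableSet_Ici, intervalIntegral.integral_of_le hs.2,
    ← integral_Icc_eq_integral_Ioc]
  congr 2
  ext r
  simp only [Set.mem_Ioc, Set.mem_inter_iff, Set.mem_Ici, Set.mem_Icc]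
  exact ⟨fun h => ⟨⟨hs.1.trans_le h.1, h.2⟩, h.1⟩, fun h => ⟨h.2, h.1.2⟩⟩

variable {a b : ℝ} {K : ℝ → ℝ → F}

lemma integrable_indicator_triangle (hK : Integrable (fun q : ℝ × ℝ => K q.1 q.2)
      ((volume.restrict (Set.Ioc a b)).prod (volume.restrict (Set.Ioc a b)))) :
    Integrable (Set.indicator {q : ℝ × ℝ | q.2 ≤ q.1} (fun q => K q.1 q.2))
      ((volume.restrict (Set.Ioc a b)).prod (volume.restrict (Set.Ioc a b))) :=
  hK.indicator (measurableSet_le measurable_snd measurable_fst)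

lemma integrableOn_triangle_left (hK : Integrable (fun q : ℝ × ℝ => K q.1 q.2)
      ((volume.restrict (Set.Ioc a b)).prod (volume.restrict (Set.Ioc a b)))) :
    IntegrableOn (fun r => ∫ s in a..r, K r s) (Set.Ioc a b) :=
  (integrableOn_congr_fun (fun _ hr => triangle_section_left hr K) measurableSet_Ioc).2
    (integrable_indicator_triangle hK).integral_prod_left

lemma integrableOn_triangle_right (hK : Integrable (fun q : ℝ × ℝ => K q.1 q.2)
      ((volume.restrict (Set.Ioc a b)).prod (volume.restrict (Set.Ioc a b)))) :
    IntegrableOn (fun s => ∫ r in s..b, K r s) (Set.Ioc a b) :=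
  (integrableOn_congr_fun (fun _ hr => triangle_section_right hr K) measurableSet_Ioc).2
    (integrable_indicator_triangle hK).integral_prod_right

/-- Fubini's theorem on a triangle. -/
lemma integral_triangle_swap (hab : a ≤ b) (hK : Integrable (fun q : ℝ × ℝ => K q.1 q.2)
      ((volume.restrict (Set.Ioc a b)).prod (volume.restrict (Set.Ioc a b)))) :
    ∫ r in a..b, ∫ s in a..r, K r s = ∫ s in a..b, ∫ r in s..b, K r s := by
  rw [intervalIntegral.integral_of_le hab, intervalIntegral.integral_of_le hab,
    setIntegral_congr_fun measurableSet_Ioc (fun _ hr => triangle_section_left hr K),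
    setIntegral_congr_fun measurableSet_Ioc (fun _ hr => triangle_section_right hr K)]
  exact integral_integral_swap (f := fun r s =>
    Set.indicator {q : ℝ × ℝ | q.2 ≤ q.1} (fun q => K q.1 q.2) (r, s))
    (integrable_indicator_triangle hK)

end Triangle

/-! ### Integrability of products and product rules for primitives. -/

section Bilinear

variable {X Y Z : Type*} [NormedAddCommGroup X] [NormedSpace ℝ X] [NormedAddCommGroup Y]
  [NormedSpace ℝ Y] [NormedAddCommGroup Z] [NormedSpace ℝ Z] {a b : ℝ}

lemma _root_.ContinuousOn.aesm_Ioc {x : ℝ → X} (hx : ContinuousOn x (Set.Icc a b)) :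
    AEStronglyMeasurable x (volume.restrict (Set.Ioc a b)) :=
  (hx.mono Set.Ioc_subset_Icc_self).aestronglyMeasurable measurableSet_Ioc

lemma _root_.ContinuousOn.integrableOn_Ioc {x : ℝ → X} (hx : ContinuousOn x (Set.Icc a b)) :
    IntegrableOn x (Set.Ioc a b) :=
  hx.integrableOn_Icc.mono_set Set.Ioc_subset_Icc_self

lemma integrableOn_bilin_right (B : X →L[ℝ] Y →L[ℝ] Z) {x : ℝ → X} {y : ℝ → Y}
    (hx : ContinuousOn x (Set.Icc a b)) (hy : IntegrableOn y (Set.Ioc a b)) :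
    IntegrableOn (fun s => B (x s) (y s)) (Set.Ioc a b) := by
  obtain ⟨C, hC⟩ := isCompact_Icc.exists_bound_of_continuousOn hx
  refine (hy.norm.const_mul (‖B‖ * C)).mono' (B.aestronglyMeasurable_comp₂ hx.aesm_Ioc hy.1) ?_
  filter_upwards [ae_restrict_mem measurableSet_Ioc] with s hs
  refine (B.le_opNorm₂ _ _).trans ?_
  gcongr
  exact hC s (Set.Ioc_subset_Icc_self hs)

lemma integrableOn_bilin_left (B : X →L[ℝ] Y →L[ℝ] Z) {x : ℝ → X} {y : ℝ → Y}
    (hx : IntegrableOn x (Set.Ioc a b)) (hy : ContinuousOn y (Set.Icc a b)) :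
    IntegrableOn (fun s => B (x s) (y s)) (Set.Ioc a b) :=
  integrableOn_bilin_right B.flip hy hx

lemma integrableOn_apply_right {p : ℝ → X →L[ℝ] Y} {x : ℝ → X}
    (hp : ContinuousOn p (Set.Icc a b)) (hx : IntegrableOn x (Set.Ioc a b)) :
    IntegrableOn (fun s => p s (x s)) (Set.Ioc a b) :=
  integrableOn_bilin_right (ContinuousLinearMap.id ℝ (X →L[ℝ] Y)) hp hx

lemma integrableOn_apply_left {p : ℝ → X →L[ℝ] Y} {x : ℝ → X}
    (hp : IntegrableOn p (Set.Ioc a b)) (hx : ContinuousOn x (Set.Icc a b)) :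
    IntegrableOn (fun s => p s (x s)) (Set.Ioc a b) :=
  integrableOn_bilin_left (ContinuousLinearMap.id ℝ (X →L[ℝ] Y)) hp hx

lemma integrableOn_smul_right {α : ℝ → ℝ} {x : ℝ → X}
    (hα : ContinuousOn α (Set.Icc a b)) (hx : IntegrableOn x (Set.Ioc a b)) :
    IntegrableOn (fun s => α s • x s) (Set.Ioc a b) :=
  integrableOn_bilin_right (ContinuousLinearMap.lsmul ℝ ℝ) hα hx

lemma integrableOn_smul_left {α : ℝ → ℝ} {x : ℝ → X}
    (hα : IntegrableOn α (Set.Ioc a b)) (hx : ContinuousOn x (Set.Icc a b)) :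
    IntegrableOn (fun s => α s • x s) (Set.Ioc a b) :=
  integrableOn_bilin_left (ContinuousLinearMap.lsmul ℝ ℝ) hα hx

lemma _root_.MeasureTheory.IntegrableOn.ii {x : ℝ → X} (hx : IntegrableOn x (Set.Ioc a b))
    (hab : a ≤ b) : IntervalIntegrable x volume a b :=
  (intervalIntegrable_iff_integrableOn_Ioc_of_le hab).2 hx

lemma _root_.MeasureTheory.IntegrableOn.ii_sub {x : ℝ → X} (hx : IntegrableOn x (Set.Ioc a b))
    {c d : ℝ} (hc : a ≤ c) (hcd : c ≤ d) (hd : d ≤ b) : IntervalIntegrable x volume c d :=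
  (intervalIntegrable_iff_integrableOn_Ioc_of_le hcd).2
    (hx.mono_set (Set.Ioc_subset_Ioc hc hd))

lemma continuousOn_primitive_Ioc {x : ℝ → X} (hx : IntegrableOn x (Set.Ioc a b)) :
    ContinuousOn (fun t => ∫ s in a..t, x s) (Set.Icc a b) := by
  rcases le_or_gt a b with hab | hab
  · rw [← Set.uIcc_of_le hab]
    exact intervalIntegral.continuousOn_primitive_interval' (hx.ii hab) Set.left_mem_uIcc
  · rw [Set.Icc_eq_empty hab.not_ge]
    exact continuousOn_empty _

/-- Product rule for a scalar and a vector valued primitive. -/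
lemma primitive_smul_primitive [CompleteSpace X] (hab : a ≤ b) {α : ℝ → ℝ} {β : ℝ → X} (k : X)
    (hα : IntegrableOn α (Set.Ioc a b)) (hβ : IntegrableOn β (Set.Ioc a b)) :
    (∫ s in a..b, α s) • (k + ∫ s in a..b, β s)
      = (∫ s in a..b, α s • (k + ∫ r in a..s, β r))
        + ∫ s in a..b, (∫ r in a..s, α r) • β s := by
  -- Both densities are merely integrable, so the product rule comes from exchanging the integrals
  -- of α r • β s over the triangle, not from differentiation.
  have hK := Integrable.smul_prod hα hβ
  have h1 := integral_triangle_swap hab (K := fun r s => α r • β s) hK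
  have h2 : ∀ s ∈ Set.uIcc a b, ∫ r in s..b, α r • β s
      = (∫ r in a..b, α r) • β s - (∫ r in a..s, α r) • β s := by
    intro s hs
    rw [Set.uIcc_of_le hab] at hs
    rw [intervalIntegral.integral_smul_const, ← sub_smul,
      intervalIntegral.integral_interval_sub_left (hα.ii hab) (hα.ii_sub le_rfl hs.1 hs.2)]
  rw [intervalIntegral.integral_congr h2, intervalIntegral.integral_sub,
    intervalIntegral.integral_smul] at h1
  · have h3 : ∫ s in a..b, α s • (k + ∫ r in a..s, β r)
        = (∫ s in a..b, α s) • k + ∫ r in a..b, ∫ s in a..r, α r • β s := by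
      simp_rw [intervalIntegral.integral_smul, smul_add]
      rw [intervalIntegral.integral_add, intervalIntegral.integral_smul_const]
      · exact IntegrableOn.ii (Integrable.smul_const hα k) hab
      · exact (integrableOn_smul_left hα (continuousOn_primitive_Ioc hβ)).ii hab
    rw [h3, h1, smul_add]
    abel
  · exact IntegrableOn.ii (Integrable.smul (∫ r in a..b, α r) hβ) hab
  · exact (integrableOn_smul_right (continuousOn_primitive_Ioc hα) hβ).ii hab

/-- Product rule for scalar primitives. -/
lemma primitive_mul_primitive (hab : a ≤ b) {α β : ℝ → ℝ} (k : ℝ)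
    (hα : IntegrableOn α (Set.Ioc a b)) (hβ : IntegrableOn β (Set.Ioc a b)) :
    (∫ s in a..b, α s) * (k + ∫ s in a..b, β s)
      = (∫ s in a..b, α s * (k + ∫ r in a..s, β r))
        + ∫ s in a..b, (∫ r in a..s, α r) * β s := by
  simpa using primitive_smul_primitive hab k hα hβ

end Bilinear

/-! ### Mild solutions with a given source, and forward-backward duality. -/

section Mild

variable {X : Type*} [NormedAddCommGroup X] [NormedSpace ℝ X]

/-- `y` is a mild solution on `[a,b]` of `y' + A y = g`. -/
structure IsMildOn (S : C0Semigroup X) (a b : ℝ) (g y : ℝ → X) : Prop where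
  cont : ContinuousOn y (Set.Icc a b)
  int : IntegrableOn g (Set.Ioc a b)
  eq : ∀ t ∈ Set.Icc a b, y t = S.pos (t - a) (y a) + ∫ s in a..t, S.pos (t - s) (g s)

/-- `p` is a mild solution on `[a,b]` of the backward equation `-p' + A* p = G`, the equation being
tested on each vector. -/
structure IsBackwardMildOn (S : C0Semigroup X) (a b : ℝ) (G p : ℝ → StrongDual ℝ X) : Prop where
  cont : ContinuousOn p (Set.Icc a b)
  int : IntegrableOn G (Set.Ioc a b)
  eq : ∀ t ∈ Set.Icc a b, ∀ x,
    p t x = p b (S.pos (b - t) x) + ∫ s in t..b, G s (S.pos (s - t) x)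

variable {S : C0Semigroup X} {a b : ℝ} {g y : ℝ → X} {G p : ℝ → StrongDual ℝ X}

lemma IsMildOn.mono_right (h : IsMildOn S a b g y) {c : ℝ} (hc : c ≤ b) : IsMildOn S a c g y :=
  ⟨h.cont.mono (Set.Icc_subset_Icc_right hc), h.int.mono_set (Set.Ioc_subset_Ioc_right hc),
    fun t ht => h.eq t ⟨ht.1, ht.2.trans hc⟩⟩

lemma IsMildOn.congr_source (h : IsMildOn S a b g y) {g' : ℝ → X}
    (hg : ∀ᵐ s ∂(volume.restrict (Set.Ioc a b)), g s = g' s) : IsMildOn S a b g' y :=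
  ⟨h.cont, h.int.congr hg, fun t ht => by
    rw [h.eq t ht]
    congr 1
    refine intervalIntegral.integral_congr_ae_restrict ?_
    rw [Set.uIoc_of_le ht.1]
    filter_upwards [ae_restrict_of_ae_restrict_of_subset (Set.Ioc_subset_Ioc_right ht.2) hg]
      with s hs
    rw [hs]⟩

lemma IsBackwardMildOn.congr_source (h : IsBackwardMildOn S a b G p) {G' : ℝ → StrongDual ℝ X}
    (hG : ∀ᵐ s ∂(volume.restrict (Set.Ioc a b)), G s = G' s) : IsBackwardMildOn S a b G' p :=
  ⟨h.cont, h.int.congr hG, fun t ht x => by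
    rw [h.eq t ht x]
    congr 1
    refine intervalIntegral.integral_congr_ae_restrict ?_
    rw [Set.uIoc_of_le ht.2]
    filter_upwards [ae_restrict_of_ae_restrict_of_subset (Set.Ioc_subset_Ioc_left ht.1) hG]
      with s hs
    rw [hs]⟩

variable [CompleteSpace X]

lemma integrableOn_pos_sub (hg : IntegrableOn g (Set.Ioc a b)) (t : ℝ) :
    IntegrableOn (fun s => S.pos (t - s) (g s)) (Set.Ioc a b) := by
  refine Integrable.c0_pos (T := t - a) hg
    (continuous_const.sub continuous_id).aestronglyMeasurable ?_
  filter_upwards [ae_restrict_mem measurableSet_Ioc] with s hs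
  linarith [hs.1]

lemma IsMildOn.add (h : IsMildOn S a b g y) {g' y' : ℝ → X} (h' : IsMildOn S a b g' y') :
    IsMildOn S a b (fun s => g s + g' s) (fun t => y t + y' t) := by
  refine ⟨h.cont.add h'.cont, Integrable.add h.int h'.int, fun t ht => ?_⟩
  simp only [map_add]
  rw [intervalIntegral.integral_add
    ((integrableOn_pos_sub h.int t).ii_sub le_rfl ht.1 ht.2)
    ((integrableOn_pos_sub h'.int t).ii_sub le_rfl ht.1 ht.2), h.eq t ht, h'.eq t ht]
  abel

lemma IsMildOn.sub (h : IsMildOn S a b g y) {g' y' : ℝ → X} (h' : IsMildOn S a b g' y') :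
    IsMildOn S a b (fun s => g s - g' s) (fun t => y t - y' t) := by
  refine ⟨h.cont.sub h'.cont, Integrable.sub h.int h'.int, fun t ht => ?_⟩
  simp only [map_sub]
  rw [intervalIntegral.integral_sub
    ((integrableOn_pos_sub h.int t).ii_sub le_rfl ht.1 ht.2)
    ((integrableOn_pos_sub h'.int t).ii_sub le_rfl ht.1 ht.2), h.eq t ht, h'.eq t ht]
  abel

/-- `s ↦ S (t - s) y(s)` is a primitive of `s ↦ S (t - s) g(s)`. -/
lemma IsMildOn.pos_sub_apply (h : IsMildOn S a b g y) {s t : ℝ} (hs : s ∈ Set.Icc a b)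
    (hst : s ≤ t) :
    S.pos (t - s) (y s) = S.pos (t - a) (y a) + ∫ r in a..s, S.pos (t - r) (g r) := by
  rw [h.eq s hs, map_add, S.pos_sub_comp hs.1 hst, ← ContinuousLinearMap.intervalIntegral_comp_comm
    _ ((integrableOn_pos_sub h.int s).ii_sub le_rfl hs.1 hs.2)]
  congr 1
  refine intervalIntegral.integral_congr fun r hr => ?_
  rw [Set.uIcc_of_le hs.1] at hr
  exact S.pos_sub_comp hr.2 hst _

/-- Multiplication of a mild solution by a scalar primitive. -/
lemma IsMildOn.primitive_smul (h : IsMildOn S a b g y) {v : ℝ → ℝ}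
    (hv : IntegrableOn v (Set.Ioc a b)) :
    IsMildOn S a b (fun s => v s • y s + (∫ r in a..s, v r) • g s)
      (fun t => (∫ r in a..t, v r) • y t) := by
  have hw := continuousOn_primitive_Ioc hv
  have i1 := integrableOn_smul_left hv h.cont
  have i2 := integrableOn_smul_right hw h.int
  refine ⟨hw.smul h.cont, i1.add i2, fun t ht => ?_⟩
  have hab := ht.1
  have hsub : Set.Ioc a t ⊆ Set.Ioc a b := Set.Ioc_subset_Ioc_right ht.2
  -- For fixed t the function s ↦ S(t - s)y(s) is a primitive of s ↦ S(t - s)g(s), so the product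
  -- rule applies although y itself need not be differentiable.
  have := primitive_smul_primitive ht.1 (S.pos (t - a) (y a)) (hv.mono_set hsub)
    ((integrableOn_pos_sub (S := S) h.int t).mono_set hsub)
  simp only [intervalIntegral.integral_same, zero_smul, map_zero, zero_add, map_add, map_smul]
  rw [h.eq t ht, this, intervalIntegral.integral_add]
  · congr 1
    refine intervalIntegral.integral_congr fun s hs => ?_
    rw [Set.uIcc_of_le ht.1] at hs
    rw [h.pos_sub_apply ⟨hs.1, hs.2.trans ht.2⟩ hs.2]
  · simpa using (integrableOn_pos_sub (S := S) i1 t).ii_sub le_rfl ht.1 ht.2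
  · simpa using (integrableOn_pos_sub (S := S) i2 t).ii_sub le_rfl ht.1 ht.2

omit [CompleteSpace X] in
lemma aesm_clm_apply {α Y : Type*} [NormedAddCommGroup Y] [NormedSpace ℝ Y] [MeasurableSpace α]
    {μ : Measure α} {G : α → X →L[ℝ] Y} {x : α → X}
    (hG : AEStronglyMeasurable G μ) (hx : AEStronglyMeasurable x μ) :
    AEStronglyMeasurable (fun s => G s (x s)) μ :=
  (ContinuousLinearMap.id ℝ (X →L[ℝ] Y)).aestronglyMeasurable_comp₂ hG hx

/-- Below the diagonal `pos` is the identity, so the kernel is dominated by M‖G(r)‖‖g(s)‖ on the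
whole square and Fubini applies. -/
lemma integrable_apply_pos_sub (hG : IntegrableOn G (Set.Ioc a b))
    (hg : IntegrableOn g (Set.Ioc a b)) :
    Integrable (fun q : ℝ × ℝ => G q.1 (S.pos (q.1 - q.2) (g q.2)))
      ((volume.restrict (Set.Ioc a b)).prod (volume.restrict (Set.Ioc a b))) := by
  obtain ⟨M, hM1, hM⟩ := S.exists_bound (b - a)
  refine ((hG.norm.mul_prod hg.norm).const_mul M).mono' ?_ ?_
  · exact aesm_clm_apply hG.1.comp_fst (AEStronglyMeasurable.c0_pos
      (continuous_fst.sub continuous_snd).aestronglyMeasurable hg.1.comp_snd)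
  · have : ∀ᵐ q : ℝ × ℝ ∂((volume.restrict (Set.Ioc a b)).prod (volume.restrict (Set.Ioc a b))),
        q ∈ Set.Ioc a b ×ˢ Set.Ioc a b := by
      rw [Measure.prod_restrict]
      exact ae_restrict_mem (measurableSet_Ioc.prod measurableSet_Ioc)
    filter_upwards [this] with q hq
    have h1 : ‖S.pos (q.1 - q.2) (g q.2)‖ ≤ M * ‖g q.2‖ :=
      (S.pos _).le_of_opNorm_le (hM _ (by linarith [hq.1.2, hq.2.1])) _
    calc _ ≤ ‖G q.1‖ * ‖S.pos (q.1 - q.2) (g q.2)‖ := (G q.1).le_opNorm _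
      _ ≤ ‖G q.1‖ * (M * ‖g q.2‖) := by gcongr
      _ = _ := by ring

/-- Duality between forward and backward mild solutions. -/
lemma IsMildOn.duality (hab : a ≤ b) (hy : IsMildOn S a b g y) (hp : IsBackwardMildOn S a b G p) :
    p b (y b) - p a (y a) = (∫ s in a..b, p s (g s)) - ∫ s in a..b, G s (y s) := by
  have hK := integrable_apply_pos_sub (S := S) hp.int hy.int
  -- Expanding p by its backward formula and y by its forward formula produces the same double
  -- integral in the two orders of integration; it cancels, leaving boundary terms.
  have hswap := integral_triangle_swap hab (K := fun r s => G r (S.pos (r - s) (g s))) hK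
  have hI1 := integrableOn_triangle_left (K := fun r s => G r (S.pos (r - s) (g s))) hK
  have hI2 := integrableOn_triangle_right (K := fun r s => G r (S.pos (r - s) (g s))) hK
  have h1 : ∫ s in a..b, p s (g s) = p b (∫ s in a..b, S.pos (b - s) (g s))
      + ∫ s in a..b, ∫ r in s..b, G r (S.pos (r - s) (g s)) := by
    have hi := (integrableOn_pos_sub (S := S) hy.int b).ii hab
    rw [← ContinuousLinearMap.intervalIntegral_comp_comm _ hi,
      ← intervalIntegral.integral_add _ (hI2.ii hab)]
    · refine intervalIntegral.integral_congr fun s hs => ?_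
      rw [Set.uIcc_of_le hab] at hs
      exact hp.eq s hs _
    · exact (IntegrableOn.ii ((p b).integrable_comp (integrableOn_pos_sub (S := S) hy.int b)) hab)
  have h2 : ∫ s in a..b, G s (y s) = (∫ s in a..b, G s (S.pos (s - a) (y a)))
      + ∫ r in a..b, ∫ s in a..r, G r (S.pos (r - s) (g s)) := by
    rw [← intervalIntegral.integral_add _ (hI1.ii hab)]
    · refine intervalIntegral.integral_congr fun s hs => ?_
      rw [Set.uIcc_of_le hab] at hs
      rw [hy.eq s hs, map_add, ← ContinuousLinearMap.intervalIntegral_comp_comm _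
        ((integrableOn_pos_sub hy.int s).ii_sub le_rfl hs.1 hs.2)]
    · refine (integrableOn_apply_left hp.int (Continuous.continuousOn ?_)).ii hab
      exact (S.continuous_pos_apply _).comp (continuous_id.sub continuous_const)
  rw [h1, h2, hswap, hy.eq b ⟨hab, le_rfl⟩, hp.eq a ⟨le_rfl, hab⟩, map_add]
  ring

omit [CompleteSpace X] in
lemma IsBackwardMildOn.mono_left (h : IsBackwardMildOn S a b G p) {c : ℝ} (hc : a ≤ c) :
    IsBackwardMildOn S c b G p :=
  ⟨h.cont.mono (Set.Icc_subset_Icc_left hc), h.int.mono_set (Set.Ioc_subset_Ioc_left hc),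
    fun t ht => h.eq t ⟨hc.trans ht.1, ht.2⟩⟩

/-- The terminal time changes, so the value at c is expanded by the equation as well and the
semigroup law joins the two pieces. -/
lemma IsBackwardMildOn.mono_right (h : IsBackwardMildOn S a b G p) {c : ℝ} (hc : c ≤ b) :
    IsBackwardMildOn S a c G p := by
  refine ⟨h.cont.mono (Set.Icc_subset_Icc_right hc), h.int.mono_set (Set.Ioc_subset_Ioc_right hc),
    fun t ht x => ?_⟩
  have hi : ∀ x, IntegrableOn (fun s => G s (S.pos (s - t) x)) (Set.Ioc a b) := fun x =>
    integrableOn_apply_left h.int ((S.continuous_pos_apply _).comp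
      (continuous_id.sub continuous_const)).continuousOn
  rw [h.eq t ⟨ht.1, ht.2.trans hc⟩, h.eq c ⟨ht.1.trans ht.2, hc⟩, S.pos_sub_comp ht.2 hc,
    ← intervalIntegral.integral_add_adjacent_intervals ((hi x).ii_sub ht.1 ht.2 hc)
      ((hi x).ii_sub (ht.1.trans ht.2) hc le_rfl), add_assoc]
  congr 1
  rw [add_comm]
  congr 1
  refine intervalIntegral.integral_congr fun s hs => ?_
  rw [Set.uIcc_of_le hc] at hs
  rw [S.pos_sub_comp ht.2 hs.1]

/-- The duality product is a primitive. -/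
lemma IsMildOn.duality_primitive (hy : IsMildOn S a b g y)
    (hp : IsBackwardMildOn S a b G p) {t : ℝ} (ht : t ∈ Set.Icc a b) :
    p t (y t) = p a (y a) + ∫ s in a..t, (p s (g s) - G s (y s)) := by
  have h := (hy.mono_right ht.2).duality ht.1 (hp.mono_right ht.2)
  rw [intervalIntegral.integral_sub, ← h]
  · ring
  · exact (integrableOn_apply_right hp.cont hy.int).ii_sub le_rfl ht.1 ht.2
  · exact (integrableOn_apply_left hp.int hy.cont).ii_sub le_rfl ht.1 ht.2

end Mild

/-! ### Existence and a priori bounds for mild solutions. -/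

section Existence

variable {X : Type*} [NormedAddCommGroup X] [NormedSpace ℝ X] [CompleteSpace X]
  {S : C0Semigroup X} {a b : ℝ} {g : ℝ → X}

/-- Time occurs both as upper limit and inside the semigroup. The two roles are separated into two
variables, continuity is obtained by domination, and the result is restricted to the diagonal.
Extending g by zero makes every t₀ interior. -/
lemma continuousOn_duhamel (hg : IntegrableOn g (Set.Ioc a b)) :
    ContinuousOn (fun t => ∫ s in a..t, S.pos (t - s) (g s)) (Set.Icc a b) := by
  intro t₀ ht₀
  have hab : a ≤ b := ht₀.1.trans ht₀.2
  set g' := Set.indicator (Set.Ioc a b) g with hg'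
  have hi : Integrable g' volume := (integrable_indicator_iff measurableSet_Ioc).2 hg
  obtain ⟨M, hM1, hM⟩ := S.exists_bound (t₀ + 1 - (a - 1))
  have key : ContinuousAt (fun q : ℝ × ℝ => ∫ s in a..q.2, S.pos (q.1 - s) (g' s)) (t₀, t₀) := by
    refine intervalIntegral.continuousAt_parametric_primitive_of_dominated
      (F := fun t s => S.pos (t - s) (g' s)) (fun s => M * ‖g' s‖) (a - 1) (b + 1)
      (fun t => ?_) ?_ ?_ ?_ ⟨by linarith, by linarith⟩
      ⟨by linarith [ht₀.1], by linarith [ht₀.2]⟩ (by simp)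
    · exact AEStronglyMeasurable.c0_pos (continuous_const.sub continuous_id).aestronglyMeasurable
        hi.1.restrict
    · filter_upwards [Iio_mem_nhds (lt_add_one t₀)] with t ht
      filter_upwards [ae_restrict_mem measurableSet_uIoc] with s hs
      rw [Set.uIoc_of_le (by linarith)] at hs
      exact (S.pos _).le_of_opNorm_le (hM _ (by
        have : t < t₀ + 1 := ht
        linarith [hs.1])) _
    · exact (hi.norm.const_mul M).intervalIntegrable
    · refine Eventually.of_forall fun s => Continuous.continuousAt ?_
      exact (S.continuous_pos_apply _).comp (continuous_id.sub continuous_const)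
  have h2 : ContinuousAt (fun t => ∫ s in a..t, S.pos (t - s) (g' s)) t₀ :=
    ContinuousAt.comp (f := fun t : ℝ => (t, t)) key (by fun_prop)
  refine h2.continuousWithinAt.congr (fun t ht => ?_) ?_
  all_goals
    refine intervalIntegral.integral_congr_ae_restrict ?_
    filter_upwards [ae_restrict_mem measurableSet_uIoc] with s hs
    first
      | rw [Set.uIoc_of_le ht.1] at hs
        rw [hg', Set.indicator_of_mem (Set.Ioc_subset_Ioc_right ht.2 hs)]
      | rw [Set.uIoc_of_le ht₀.1] at hs
        rw [hg', Set.indicator_of_mem (Set.Ioc_subset_Ioc_right ht₀.2 hs)]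

lemma integral_exp_mul_le {c : ℝ} (hc : 0 < c) (t : ℝ) :
    ∫ s in (0 : ℝ)..t, Real.exp (c * s) ≤ Real.exp (c * t) / c := by
  rw [intervalIntegral.integral_comp_mul_left (fun s => Real.exp s) hc.ne', integral_exp,
    mul_zero, Real.exp_zero, smul_eq_mul, inv_mul_eq_div]
  gcongr
  linarith

lemma integrableOn_bdd_smul {T C : ℝ} {β : ℝ → ℝ} {x : ℝ → X}
    (hβ : AEStronglyMeasurable β (timeMeasure T)) (hC : ∀ᵐ s ∂(timeMeasure T), |β s| ≤ C)
    (hx : IntegrableOn x (Set.Ioc 0 T)) : IntegrableOn (fun s => β s • x s) (Set.Ioc 0 T) :=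
  Integrable.bdd_smul hx C hβ hC

/-- Existence of mild solutions for bounded perturbations of the generator. -/
theorem exists_isMildOn (S : C0Semigroup X) {T : ℝ} (hT : 0 ≤ T) (y₀ : X) {k : ℝ → X}
    (hk : IntegrableOn k (Set.Ioc 0 T)) {β : ℝ → ℝ} {C : ℝ}
    (hβ : AEStronglyMeasurable β (timeMeasure T)) (hC : ∀ᵐ s ∂(timeMeasure T), |β s| ≤ C)
    (L : X →L[ℝ] X) :
    ∃ y : ℝ → X, y 0 = y₀ ∧ IsMildOn S 0 T (fun s => β s • L (y s) + k s) y := by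
  obtain ⟨M, hM1, hM⟩ := S.exists_bound T
  -- When T = 0 the almost everywhere bound does not force C ≥ 0.
  set C' := |C|
  have hC' : ∀ᵐ s ∂(timeMeasure T), |β s| ≤ C' := hC.mono fun s hs => hs.trans (le_abs_self C)
  -- In the unknown e^{-ct}y(t) the Duhamel map has Lipschitz constant at most M·C'·‖L‖/c ≤ 1/2, so
  -- one fixed point covers all of [0,T]. The added 1 keeps c positive when L = 0.
  set c : ℝ := 2 * (M * C' * ‖L‖) + 1 with hc
  have hc0 : 0 < c := by positivity
  let E : C(Set.Icc (0 : ℝ) T, X) → ℝ → X := fun y s => Real.exp (c * s) • Set.IccExtend hT y s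
  have hE : ∀ y, Continuous (E y) := fun y =>
    (Real.continuous_exp.comp (continuous_const.mul continuous_id)).smul y.continuous.Icc_extend'
  have hsrc : ∀ y, IntegrableOn (fun s => β s • L (E y s) + k s) (Set.Ioc 0 T) := fun y =>
    (integrableOn_bdd_smul hβ hC
      (ContinuousOn.integrableOn_Ioc (L.continuous.comp (hE y)).continuousOn)).add hk
  let D : C(Set.Icc (0 : ℝ) T, X) → ℝ → X := fun y t =>
    S.pos t y₀ + ∫ s in (0 : ℝ)..t, S.pos (t - s) (β s • L (E y s) + k s)
  have hD : ∀ y, ContinuousOn (D y) (Set.Icc 0 T) := fun y =>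
    (S.continuous_pos_apply y₀).continuousOn.add (continuousOn_duhamel (hsrc y))
  let Φ : C(Set.Icc (0 : ℝ) T, X) → C(Set.Icc (0 : ℝ) T, X) := fun y =>
    ⟨fun t => Real.exp (-(c * t)) • D y t, by
      have := continuousOn_iff_continuous_domRestrict.1 (hD y)
      exact (Real.continuous_exp.comp (continuous_const.mul continuous_subtype_val).neg).smul this⟩
  have hΦ : ContractingWith (1 / 2) Φ := by
    refine ⟨by norm_num, LipschitzWith.of_dist_le_mul fun y z => ?_⟩
    rw [ContinuousMap.dist_le (by positivity)]
    intro t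
    have ht := t.2
    have e1 : D y t - D z t = ∫ s in (0 : ℝ)..t, S.pos (t - s) (β s • L (E y s - E z s)) := by
      simp only [D]
      rw [add_sub_add_left_eq_sub, ← intervalIntegral.integral_sub
        ((integrableOn_pos_sub (hsrc y) t).ii_sub le_rfl ht.1 ht.2)
        ((integrableOn_pos_sub (hsrc z) t).ii_sub le_rfl ht.1 ht.2)]
      refine intervalIntegral.integral_congr fun s _ => ?_
      simp only [← map_sub, ← smul_sub, add_sub_add_right_eq_sub]
    have e2 : ‖D y t - D z t‖ ≤ ∫ s in (0 : ℝ)..t, M * (C' * (‖L‖ * dist y z)) * Real.exp (c * s) := by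
      rw [e1]
      refine intervalIntegral.norm_integral_le_of_norm_le ht.1 ?_ ?_
      · have h1 := (ae_restrict_iff' measurableSet_Ioc).1 hC'
        filter_upwards [h1] with s hs hst
        have hs' : s ∈ Set.Icc 0 T := ⟨hst.1.le, hst.2.trans ht.2⟩
        have d1 : ‖E y s - E z s‖ ≤ Real.exp (c * s) * dist y z := by
          simp only [E]
          rw [← smul_sub, norm_smul, Real.norm_of_nonneg (Real.exp_pos _).le, ← dist_eq_norm,
            Set.IccExtend_of_mem hT y hs', Set.IccExtend_of_mem hT z hs']
          gcongr
          exact ContinuousMap.dist_apply_le_dist _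
        calc _ ≤ M * ‖β s • L (E y s - E z s)‖ :=
              (S.pos _).le_of_opNorm_le (hM _ (by linarith [ht.2, hst.1])) _
          _ ≤ M * (C' * (‖L‖ * (Real.exp (c * s) * dist y z))) := by
              rw [norm_smul, Real.norm_eq_abs]
              gcongr
              · exact hs ⟨hst.1, hst.2.trans ht.2⟩
              · exact (L.le_opNorm _).trans (by gcongr)
          _ = _ := by ring
      · exact Continuous.intervalIntegrable (by fun_prop) _ _
    rw [intervalIntegral.integral_const_mul] at e2
    have e3 := e2.trans (mul_le_mul_of_nonneg_left (integral_exp_mul_le hc0 t) (by positivity))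
    calc dist (Φ y t) (Φ z t) = Real.exp (-(c * t)) * ‖D y t - D z t‖ := by
          rw [dist_eq_norm]
          simp only [Φ, ContinuousMap.coe_mk]
          rw [← smul_sub, norm_smul, Real.norm_of_nonneg (Real.exp_pos _).le]
      _ ≤ Real.exp (-(c * t)) * (M * (C' * (‖L‖ * dist y z)) * (Real.exp (c * t) / c)) := by gcongr
      _ = (M * C' * ‖L‖ / c) * dist y z := by
          rw [Real.exp_neg]; field_simp
      _ ≤ _ := by
          gcongr
          rw [div_le_iff₀ hc0]
          push_cast
          rw [hc]; linarith
  have : Nonempty C(Set.Icc (0 : ℝ) T, X) := ⟨0⟩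
  set y := ContractingWith.fixedPoint Φ hΦ with hy
  have hfix : Φ y = y := hΦ.fixedPoint_isFixedPt
  have hyE : ∀ t ∈ Set.Icc 0 T, E y t = D y t := by
    intro t ht
    have h1 := congrArg (fun h => h ⟨t, ht⟩) hfix
    simp only [Φ, ContinuousMap.coe_mk] at h1
    simp only [E]
    rw [Set.IccExtend_of_mem hT y ht, ← h1, smul_smul, ← Real.exp_add, add_neg_cancel, Real.exp_zero,
      one_smul]
  have h0 : E y 0 = y₀ := by
    rw [hyE 0 ⟨le_rfl, hT⟩]; simp [D]
  refine ⟨E y, h0, (hE y).continuousOn, hsrc y, fun t ht => ?_⟩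
  rw [h0, hyE t ht, sub_zero]

/-- Grönwall's inequality in integral form. -/
lemma gronwall_integral {T K c : ℝ} (hK : 0 < K) (hc : 0 ≤ c) {φ : ℝ → ℝ}
    (hφ : ContinuousOn φ (Set.Icc 0 T)) (h0 : ∀ t ∈ Set.Icc 0 T, 0 ≤ φ t)
    (h : ∀ t ∈ Set.Icc 0 T, φ t ≤ c + K * ∫ s in (0 : ℝ)..t, φ s) :
    ∀ t ∈ Set.Icc 0 T, φ t ≤ 2 * Real.exp (2 * K * T) * c := by
  intro t ht
  -- At a maximum point of e^{-2Ks}φ(s) the integral term is at most half of φ(t₁), so it is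
  -- absorbed on the left; this produces the factor 2 in the bound.
  obtain ⟨t₁, ht₁, hmax⟩ := isCompact_Icc.exists_isMaxOn ⟨t, ht⟩
    (f := fun s => Real.exp (-(2 * K * s)) * φ s)
    ((Continuous.continuousOn (by fun_prop)).mul hφ)
  set m := Real.exp (-(2 * K * t₁)) * φ t₁ with hm
  have hm0 : 0 ≤ m := mul_nonneg (Real.exp_pos _).le (h0 _ ht₁)
  have hle : ∀ s ∈ Set.Icc 0 T, φ s ≤ m * Real.exp (2 * K * s) := by
    intro s hs
    have : Real.exp (-(2 * K * s)) * φ s ≤ m := hmax hs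
    rw [Real.exp_neg, inv_mul_le_iff₀ (Real.exp_pos _)] at this
    linarith
  have h1 : ∫ s in (0 : ℝ)..t₁, φ s ≤ m * (Real.exp (2 * K * t₁) / (2 * K)) := by
    refine le_trans ?_ (mul_le_mul_of_nonneg_left (integral_exp_mul_le (by positivity) t₁) hm0)
    rw [← intervalIntegral.integral_const_mul]
    refine intervalIntegral.integral_mono_on ht₁.1 ?_ ?_ fun s hs => hle s ⟨hs.1, hs.2.trans ht₁.2⟩
    · exact ContinuousOn.intervalIntegrable_of_Icc ht₁.1
        (hφ.mono (Set.Icc_subset_Icc_right ht₁.2))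
    · exact Continuous.intervalIntegrable (by fun_prop) _ _
  have h2 := h t₁ ht₁
  have h3 : φ t₁ = m * Real.exp (2 * K * t₁) := by
    rw [hm, Real.exp_neg]; field_simp
  have h4 : m * Real.exp (2 * K * t₁) ≤ 2 * c := by
    have : K * (m * (Real.exp (2 * K * t₁) / (2 * K))) = m * Real.exp (2 * K * t₁) / 2 := by
      field_simp
    have h5 := mul_le_mul_of_nonneg_left h1 hK.le
    rw [this] at h5
    linarith
  have h5 : m ≤ 2 * c := by
    refine le_trans (le_mul_of_one_le_right hm0 (Real.one_le_exp ?_)) h4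
    have := ht₁.1
    positivity
  calc φ t ≤ m * Real.exp (2 * K * t) := hle t ht
    _ ≤ 2 * c * Real.exp (2 * K * T) := by
        gcongr
        exact ht.2
    _ = _ := by ring

/-- A priori bound for mild solutions starting at `0`. -/
lemma exists_mild_bound (S : C0Semigroup X) (T : ℝ) (C : ℝ) (L : X →L[ℝ] X) :
    ∃ K, 0 ≤ K ∧ ∀ (β : ℝ → ℝ) (k y : ℝ → X),
      (∀ᵐ s ∂(timeMeasure T), |β s| ≤ C) → IntegrableOn k (Set.Ioc 0 T) →
      IsMildOn S 0 T (fun s => β s • L (y s) + k s) y → y 0 = 0 →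
      ∀ t ∈ Set.Icc 0 T, ‖y t‖ ≤ K * ∫ s in (0 : ℝ)..T, ‖k s‖ := by
  obtain ⟨M, hM1, hM⟩ := S.exists_bound T
  -- The Grönwall constant with rate M|C|‖L‖ + 1, the 1 making the rate positive. It depends on β
  -- only through its bound C.
  refine ⟨2 * Real.exp (2 * (M * (|C| * ‖L‖) + 1) * T) * M, by positivity, ?_⟩
  intro β k y hC hk hy h0 t ht
  have hT : 0 ≤ T := ht.1.trans ht.2
  have hI0 : 0 ≤ ∫ s in (0 : ℝ)..T, ‖k s‖ :=
    intervalIntegral.integral_nonneg hT fun _ _ => norm_nonneg _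
  have := gronwall_integral (T := T) (K := M * (|C| * ‖L‖) + 1)
    (c := M * ∫ s in (0 : ℝ)..T, ‖k s‖) (φ := fun t => ‖y t‖) (by positivity) (by positivity)
    hy.cont.norm (fun _ _ => norm_nonneg _) ?_ t ht
  · simpa [mul_assoc] using this
  intro t ht
  have hyi : IntegrableOn (fun s => ‖y s‖) (Set.Ioc 0 T) := hy.cont.norm.integrableOn_Ioc
  have e1 : ‖y t‖ ≤ ∫ s in (0 : ℝ)..t, (M * (|C| * ‖L‖) * ‖y s‖ + M * ‖k s‖) := by
    rw [hy.eq t ht, h0, map_zero, zero_add]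
    refine intervalIntegral.norm_integral_le_of_norm_le ht.1 ?_ ?_
    · have h1 := (ae_restrict_iff' measurableSet_Ioc).1 hC
      filter_upwards [h1] with s hs hst
      calc _ ≤ M * ‖β s • L (y s) + k s‖ :=
            (S.pos _).le_of_opNorm_le (hM _ (by linarith [ht.2, hst.1])) _
        _ ≤ M * (|C| * (‖L‖ * ‖y s‖) + ‖k s‖) := by
            gcongr
            refine (norm_add_le _ _).trans ?_
            rw [norm_smul, Real.norm_eq_abs]
            have h2 := (hs ⟨hst.1, hst.2.trans ht.2⟩).trans (le_abs_self C)
            have h3 := mul_le_mul h2 (L.le_opNorm (y s)) (norm_nonneg _) (abs_nonneg _)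
            linarith
        _ = _ := by ring
    · exact IntegrableOn.ii_sub ((hyi.const_mul _).add (hk.norm.const_mul M)) le_rfl ht.1 ht.2
  rw [intervalIntegral.integral_add (IntegrableOn.ii_sub (hyi.const_mul _) le_rfl ht.1 ht.2)
    (IntegrableOn.ii_sub (hk.norm.const_mul M) le_rfl ht.1 ht.2),
    intervalIntegral.integral_const_mul, intervalIntegral.integral_const_mul] at e1
  have e2 : ∫ s in (0 : ℝ)..t, ‖k s‖ ≤ ∫ s in (0 : ℝ)..T, ‖k s‖ :=
    intervalIntegral.integral_mono_interval le_rfl ht.1 ht.2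
      (Eventually.of_forall fun _ => norm_nonneg _) (IntegrableOn.ii hk.norm hT)
  have e3 : 0 ≤ ∫ s in (0 : ℝ)..t, ‖y s‖ :=
    intervalIntegral.integral_nonneg ht.1 fun _ _ => norm_nonneg _
  have e4 := mul_le_mul_of_nonneg_left e2 (show 0 ≤ M by linarith)
  nlinarith

end Existence

/-! ### The dual semigroup and backward equations by time reversal. -/

section Reversal

lemma measurePreserving_reverse (T : ℝ) :
    MeasurePreserving (fun s : ℝ => T - s) (timeMeasure T) (timeMeasure T) := by
  have h := (Measure.measurePreserving_sub_left (volume : Measure ℝ) T).restrict_preimage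
    (s := Set.Ioc 0 T) measurableSet_Ioc
  have h2 : (fun s : ℝ => T - s) ⁻¹' Set.Ioc 0 T = Set.Ico 0 T := by
    ext s
    simp only [Set.mem_preimage, Set.mem_Ioc, Set.mem_Ico]
    constructor <;> rintro ⟨h1, h2⟩ <;> constructor <;> linarith
  rw [h2, restrict_Ico_eq_restrict_Ioc] at h
  exact h

variable {X : Type*} [NormedAddCommGroup X] [NormedSpace ℝ X] [CompleteSpace X]

/-- The dual semigroup on a reflexive space. -/
def C0Semigroup.dual (S : C0Semigroup X) (hX : IsReflexiveSpace X) :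
    C0Semigroup (StrongDual ℝ X) where
  toFun t := (ContinuousLinearMap.compL ℝ X X ℝ).flip (S.toFun t)
  toFun_zero := by
    ext φ x; simp [S.toFun_zero]
  toFun_add s t hs ht := by
    ext φ x
    simp [add_comm s t, S.toFun_add t s ht hs]
  continuousOn_orbit φ := by
    refine (S.continuous_dual_pos hX φ).continuousOn.congr fun t ht => ?_
    simp only [S.pos_of_nonneg ht]; rfl

lemma C0Semigroup.dual_pos_apply (S : C0Semigroup X) (hX : IsReflexiveSpace X) (t : ℝ)
    (φ : StrongDual ℝ X) : (S.dual hX).pos t φ = φ.comp (S.pos t) := rfl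

lemma IsMildOn.isMildSolution {S : C0Semigroup X} {T : ℝ} {G : ℝ → X → X} {y : ℝ → X}
    (h : IsMildOn S 0 T (fun s => G s (y s)) y) : IsMildSolution S T (y 0) G y := by
  refine ⟨h.cont, fun t ht => ?_⟩
  rw [h.eq t ht, sub_zero, S.pos_of_nonneg ht.1]
  congr 1
  refine intervalIntegral.integral_congr fun s hs => ?_
  rw [Set.uIcc_of_le ht.1] at hs
  rw [S.pos_of_nonneg (sub_nonneg.2 hs.2)]

lemma IsMildSolution.apply_zero {S : C0Semigroup X} {T : ℝ} (hT : 0 ≤ T) {y₀ : X}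
    {G : ℝ → X → X} {y : ℝ → X} (h : IsMildSolution S T y₀ G y) : y 0 = y₀ := by
  have := h.2 0 ⟨le_rfl, hT⟩
  rwa [intervalIntegral.integral_same, add_zero, S.toFun_zero] at this

lemma IsMildSolution.isMildOn {S : C0Semigroup X} {T : ℝ} (hT : 0 ≤ T) {y₀ : X}
    {G : ℝ → X → X} {y : ℝ → X} (h : IsMildSolution S T y₀ G y)
    (hG : IntegrableOn (fun s => G s (y s)) (Set.Ioc 0 T)) :
    IsMildOn S 0 T (fun s => G s (y s)) y := by
  refine ⟨h.1, hG, fun t ht => ?_⟩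
  rw [h.apply_zero hT, h.2 t ht, sub_zero, S.pos_of_nonneg ht.1]
  congr 1
  refine intervalIntegral.integral_congr fun s hs => ?_
  rw [Set.uIcc_of_le ht.1] at hs
  rw [S.pos_of_nonneg (sub_nonneg.2 hs.2)]

/-- Evaluating the integral in the dual at a vector requires the integrand to be integrable in the
dual norm. Strong continuity of the dual semigroup, hence reflexivity, supplies its measurability.
-/
lemma IsMildBackwardSolution.isBackwardMildOn {S : C0Semigroup X} (hX : IsReflexiveSpace X) {T : ℝ}
    (hT : 0 ≤ T) {pT : StrongDual ℝ X} {G : ℝ → StrongDual ℝ X → StrongDual ℝ X}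
    {p : ℝ → StrongDual ℝ X} (h : IsMildBackwardSolution S T pT G p)
    (hG : IntegrableOn (fun s => G s (p s)) (Set.Ioc 0 T)) :
    IsBackwardMildOn S 0 T (fun s => G s (p s)) p ∧ p T = pT := by
  have h1 : p T = pT := by
    have := h.2 T ⟨hT, le_rfl⟩
    rw [intervalIntegral.integral_same, add_zero, sub_self, S.toFun_zero] at this
    exact this
  refine ⟨⟨h.1, hG, fun t ht x => ?_⟩, h1⟩
  have hi : IntegrableOn (fun s => (G s (p s)).comp (S.pos (s - t))) (Set.Ioc 0 T) := by
    refine Integrable.c0_pos (S := S.dual hX) (T := T - t) (τ := fun s => s - t) hG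
      (continuous_id.sub continuous_const).aestronglyMeasurable ?_
    filter_upwards [ae_restrict_mem measurableSet_Ioc] with s hs
    linarith [hs.2]
  have e : ∫ s in t..T, (G s (p s)).comp (S.toFun (s - t))
      = ∫ s in t..T, (G s (p s)).comp (S.pos (s - t)) := by
    refine intervalIntegral.integral_congr fun s hs => ?_
    rw [Set.uIcc_of_le ht.2] at hs
    rw [S.pos_of_nonneg (sub_nonneg.2 hs.1)]
  rw [h.2 t ht, h1, e, add_apply,
    ContinuousLinearMap.intervalIntegral_apply (hi.ii_sub ht.1 ht.2 le_rfl),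
    S.pos_of_nonneg (sub_nonneg.2 ht.2)]
  rfl

/-- Existence of mild solutions of the backward equation. -/
theorem exists_isMildBackwardSolution (S : C0Semigroup X) (hX : IsReflexiveSpace X) {T : ℝ}
    (hT : 0 ≤ T) (pT : StrongDual ℝ X) {k : ℝ → StrongDual ℝ X}
    (hk : IntegrableOn k (Set.Ioc 0 T)) {β : ℝ → ℝ} {C : ℝ}
    (hβ : AEStronglyMeasurable β (timeMeasure T)) (hC : ∀ᵐ s ∂(timeMeasure T), |β s| ≤ C)
    (L : X →L[ℝ] X) :
    ∃ p, IsMildBackwardSolution S T pT (fun s p => k s + β s • p.comp L) p := by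
  have hr := measurePreserving_reverse T
  -- With t replaced by T - t the backward equation becomes a forward one for the dual semigroup,
  -- with initial value `pT`.
  obtain ⟨q, hq0, hq⟩ := exists_isMildOn (S.dual hX) hT pT (k := fun s => k (T - s))
    (β := fun s => β (T - s)) (C := C) (hr.integrable_comp_of_integrable hk)
    (hβ.comp_measurePreserving hr) (hr.quasiMeasurePreserving.ae hC)
    ((ContinuousLinearMap.compL ℝ X X ℝ).flip L)
  refine ⟨fun t => q (T - t), hq.cont.comp (continuous_const.sub continuous_id).continuousOn
    fun t ht => ⟨by linarith [ht.2], by linarith [ht.1]⟩, fun t ht => ?_⟩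
  simp only
  rw [hq.eq (T - t) ⟨by linarith [ht.2], by linarith [ht.1]⟩, hq0, sub_zero,
    C0Semigroup.dual_pos_apply, S.pos_of_nonneg (sub_nonneg.2 ht.2)]
  congr 1
  have := intervalIntegral.integral_comp_sub_left (a := 0) (b := T - t)
    (fun r => (k r + β r • (q (T - r)).comp L).comp (S.toFun (r - t))) T
  rw [sub_sub_cancel, sub_zero] at this
  rw [← this]
  refine intervalIntegral.integral_congr fun s hs => ?_
  rw [Set.uIcc_of_le (by linarith [ht.2])] at hs
  simp only [C0Semigroup.dual_pos_apply, sub_sub_cancel]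
  rw [S.pos_of_nonneg (by linarith [hs.2]), add_comm, sub_right_comm]
  rfl

end Reversal

/-- A constant y in dom A solves y' + Ay = Ay. Applied to B₁, it accounts for the constant part of
ℬ. -/
lemma isMildOn_const {X : Type*} [NormedAddCommGroup X] [NormedSpace ℝ X] [CompleteSpace X]
    (S : C0Semigroup X) (y : S.opA.domain) (T : ℝ) :
    IsMildOn S 0 T (fun _ => S.opA y) (fun _ => (y : X)) := by
  refine ⟨continuousOn_const, continuousOn_const.integrableOn_Ioc, fun t ht => ?_⟩
  have h := S.pos_apply_sub_self ht.1 y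
  have h2 := intervalIntegral.integral_comp_sub_left (a := 0) (b := t)
    (fun s => S.pos s (S.opA y)) t
  rw [sub_self, sub_zero] at h2
  rw [sub_zero, h2, ← neg_neg (∫ s in (0 : ℝ)..t, S.pos s (S.opA y)), ← h]
  abel

/-! ### Commutation of B₂ with the semigroup; B₂y and B₂*p as mild solutions. -/

namespace GohSetting

variable {H : Type*} [NormedAddCommGroup H] [NormedSpace ℝ H] [CompleteSpace H]
  {P : BilinearProblem H} {E : Type*} [NormedAddCommGroup E] [NormedSpace ℝ E] [CompleteSpace E]
  (G : GohSetting P E)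

lemma ι_pos (t : ℝ) (e : E) : G.ι (G.SE.pos t e) = P.S.pos t (G.ι e) :=
  G.SE_restrict _ (le_max_right _ _) e

lemma ι_avg (ε : ℝ) (e : E) : G.ι (G.SE.avg ε e) = P.S.avg ε (G.ι e) := by
  rw [C0Semigroup.avg_apply, C0Semigroup.avg_apply,
    ← ContinuousLinearMap.intervalIntegral_comp_comm _
      ((G.SE.continuous_pos_apply e).intervalIntegrable _ _)]
  simp only [ι_pos]

/-- With y = S(s)e, the increment from s to r is S(t - r) applied to B₂(S(r-s)y - y) - (S(r-s)B₂y -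
B₂y). Divided by r - s, the argument tends to AB₂y - B₂Ay, and joint continuity takes care of the
outer factor. -/
lemma hasDerivWithinAt_commutator {e : E} (he : G.ι e ∈ P.A.domain) {s t : ℝ} (hs : 0 ≤ s)
    (hst : s < t) :
    HasDerivWithinAt (fun s => P.S.pos (t - s) (P.B₂ (P.S.pos s (G.ι e))))
      (P.S.pos (t - s) (G.M₁ (G.SE.pos s e))) (Set.Ioi s) s := by
  rw [hasDerivWithinAt_iff_tendsto_slope' (by simp)]
  obtain ⟨h1, -⟩ := P.S.pos_mem_domain hs ⟨G.ι e, he⟩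
  simp only at h1
  set y := P.S.pos s (G.ι e) with hy
  have hM : G.M₁ (G.SE.pos s e) = P.A ⟨P.B₂ y, G.B₂_mem _ h1⟩ - P.B₂ (P.A ⟨y, h1⟩) := by
    have := G.M₁_extends (G.SE.pos s e) (by rw [ι_pos]; exact h1)
    simpa only [ι_pos] using this
  have t1 := (P.B₂.continuous.tendsto _).comp (P.S.tendsto_opA ⟨y, h1⟩)
  have t2 := P.S.tendsto_opA ⟨P.B₂ y, G.B₂_mem _ h1⟩
  have t3 := t1.sub t2
  rw [show P.B₂ (-(P.A ⟨y, h1⟩)) - -(P.A ⟨P.B₂ y, G.B₂_mem _ h1⟩) = G.M₁ (G.SE.pos s e) by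
    rw [hM, map_neg]; abel] at t3
  have h2 : Tendsto (fun r : ℝ => r - s) (𝓝[>] s) (𝓝[>] 0) := by
    refine tendsto_nhdsWithin_iff.2 ⟨?_, ?_⟩
    · have : Tendsto (fun r : ℝ => r - s) (𝓝 s) (𝓝 (s - s)) :=
        (continuous_id.sub continuous_const).tendsto s
      rw [sub_self] at this
      exact this.mono_left nhdsWithin_le_nhds
    · filter_upwards [self_mem_nhdsWithin] with r (hr : s < r)
      exact sub_pos.2 hr
  have t4 : Tendsto (fun r : ℝ => t - r) (𝓝[>] s) (𝓝 (t - s)) :=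
    ((continuous_const.sub continuous_id).tendsto s).mono_left nhdsWithin_le_nhds
  refine ((P.S.continuous_pos.tendsto (t - s, _)).comp (t4.prodMk_nhds (t3.comp h2))).congr' ?_
  filter_upwards [self_mem_nhdsWithin, Ioo_mem_nhdsGT hst] with r (hr : s < r) hr'
  have e1 : P.S.pos r (G.ι e) = P.S.pos (r - s) y := by
    rw [hy, ← P.S.pos_add (sub_pos.2 hr).le hs, sub_add_cancel]
  have e2 : P.S.pos (t - s) (P.B₂ y) = P.S.pos (t - r) (P.S.pos (r - s) (P.B₂ y)) :=
    (P.S.pos_sub_comp hr.le hr'.2.le _).symm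
  simp only [Function.comp_apply, slope, vsub_eq_sub]
  rw [e1, ← hy, e2, ← map_sub, ← map_smul, map_smul P.B₂, ← smul_sub, map_sub P.B₂]
  congr 2
  abel

/-- The commutator of the semigroup with `B₂`. -/
lemma commutator_pos {t : ℝ} (ht : 0 ≤ t) (e : E) :
    P.B₂ (P.S.pos t (G.ι e)) = P.S.pos t (P.B₂ (G.ι e))
      + ∫ s in (0 : ℝ)..t, P.S.pos (t - s) (G.M₁ (G.SE.pos s e)) := by
  have hc : Continuous fun e => ∫ s in (0 : ℝ)..t, P.S.pos (t - s) (G.M₁ (G.SE.pos s e)) := by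
    refine intervalIntegral.continuous_parametric_intervalIntegral_of_continuous' ?_ _ _
    refine Continuous.c0_pos (continuous_const.sub continuous_snd) (G.M₁.continuous.comp ?_)
    exact Continuous.c0_pos continuous_snd continuous_fst
  -- Averages taken in E converge to e in E and have image in dom A. Both sides are continuous on E,
  -- so it suffices to treat them.
  have h1 : Tendsto (fun ε : ℝ => P.B₂ (P.S.pos t (G.ι (ε⁻¹ • G.SE.avg ε e)))) (𝓝[>] 0)
      (𝓝 (P.B₂ (P.S.pos t (G.ι e)))) :=
    ((P.B₂.comp ((P.S.pos t).comp G.ι)).continuous.tendsto e).comp (G.SE.tendsto_avg e)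
  have h2 := (((((P.S.pos t).comp (P.B₂.comp G.ι)).continuous.add hc).tendsto e).comp
    (G.SE.tendsto_avg e))
  refine tendsto_nhds_unique h1 (h2.congr' ?_)
  filter_upwards [self_mem_nhdsWithin] with ε (hε : 0 < ε)
  have hm : G.ι (ε⁻¹ • G.SE.avg ε e) ∈ P.A.domain := by
    rw [map_smul, ι_avg]
    exact Submodule.smul_mem _ _ (P.S.avg_mem_generatorDomain hε.le _)
  set e' := ε⁻¹ • G.SE.avg ε e
  have hcs : Continuous fun s => P.S.pos s (G.ι e') := P.S.continuous_pos_apply _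
  have := intervalIntegral.integral_eq_sub_of_hasDeriv_right_of_le ht
    (f := fun s => P.S.pos (t - s) (P.B₂ (P.S.pos s (G.ι e'))))
    (Continuous.c0_pos (continuous_const.sub continuous_id)
      (P.B₂.continuous.comp hcs)).continuousOn
    (fun s hs => G.hasDerivWithinAt_commutator hm hs.1.le hs.2)
    ((Continuous.c0_pos (continuous_const.sub continuous_id)
      (G.M₁.continuous.comp (G.SE.continuous_pos_apply e'))).intervalIntegrable _ _)
  simp only [sub_self, sub_zero, C0Semigroup.pos_zero_apply] at this
  change P.S.pos t (P.B₂ (G.ι e')) + ∫ s in (0 : ℝ)..t, P.S.pos (t - s) (G.M₁ (G.SE.pos s e'))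
    = P.B₂ (P.S.pos t (G.ι e'))
  rw [this]
  abel

/-- Averages along the semigroup, as bounded operators into `E`. -/
lemma exists_avg_lift {ε : ℝ} (hε : 0 ≤ ε) :
    ∃ R : H →L[ℝ] E, ∀ x, G.ι (R x) = P.S.avg ε x := by
  choose R hR using fun x => G.domain_subset _ (P.S.avg_mem_generatorDomain hε x)
  let R' : H →ₗ[ℝ] E :=
    { toFun := R
      map_add' := fun x y => G.ι_injective (by simp only [map_add, hR])
      map_smul' := fun c x => G.ι_injective (by simp only [map_smul, hR, RingHom.id_apply]) }
  have hc : Continuous R' := by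
    -- Closed graph theorem: the map is only known pointwise, through dom A ⊂ E, but its composition
    -- with the injective continuous ι is bounded.
    refine R'.continuous_of_seq_closed_graph fun z x y hz hy => G.ι_injective ?_
    have h1 := (G.ι.continuous.tendsto _).comp hy
    have h2 := ((P.S.avg ε).continuous.tendsto _).comp hz
    have h3 : G.ι ∘ (R' ∘ z) = (P.S.avg ε) ∘ z := by
      ext n; exact hR _
    rw [h3] at h1
    rw [tendsto_nhds_unique h1 h2]
    exact (hR x).symm
  exact ⟨⟨R', hc⟩, hR⟩

lemma lift_pos {ε : ℝ} (hε : 0 ≤ ε) {R : H →L[ℝ] E} (hR : ∀ x, G.ι (R x) = P.S.avg ε x) {t : ℝ}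
    (ht : 0 ≤ t) (x : H) : G.SE.pos t (R x) = R (P.S.pos t x) :=
  G.ι_injective (by rw [ι_pos, hR, hR, P.S.pos_avg_comm ht hε])

lemma lift_ι {ε : ℝ} {R : H →L[ℝ] E} (hR : ∀ x, G.ι (R x) = P.S.avg ε x) (e : E) :
    R (G.ι e) = G.SE.avg ε e :=
  G.ι_injective (by rw [hR, ι_avg])

/-- This is `commutator_pos` read in the dual. Averaging first maps H into E, where M₁ is defined,
so the source consists of bounded functionals on H, norm continuous in time by reflexivity. -/
lemma isBackwardMildOn_avg (hH : IsReflexiveSpace H) (φ : StrongDual ℝ H) {ε : ℝ} (hε : 0 ≤ ε)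
    {R : H →L[ℝ] E} (hR : ∀ x, G.ι (R x) = P.S.avg ε x) (t : ℝ) :
    IsBackwardMildOn P.S 0 t (fun r => -((φ.comp (P.S.pos (t - r))).comp (G.M₁.comp R)))
      (fun s => (φ.comp (P.S.pos (t - s))).comp (P.B₂.comp (P.S.avg ε))) := by
  have hφ : Continuous fun s => φ.comp (P.S.pos (t - s)) :=
    (P.S.continuous_dual_pos hH φ).comp (continuous_const.sub continuous_id)
  refine ⟨(hφ.clm_comp continuous_const).continuousOn,
    (hφ.clm_comp continuous_const).neg.continuousOn.integrableOn_Ioc, fun s hs x => ?_⟩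
  have h := G.commutator_pos (sub_nonneg.2 hs.2) (R x)
  have h2 := intervalIntegral.integral_comp_sub_right (a := s) (b := t)
    (fun r => P.S.pos (t - s - r) (G.M₁ (G.SE.pos r (R x)))) s
  rw [sub_self] at h2
  have h3 : ∫ r in s..t, P.S.pos (t - s - (r - s)) (G.M₁ (G.SE.pos (r - s) (R x)))
      = ∫ r in s..t, P.S.pos (t - r) (G.M₁ (R (P.S.pos (r - s) x))) := by
    refine intervalIntegral.integral_congr fun r hr => ?_
    rw [Set.uIcc_of_le hs.2] at hr
    rw [G.lift_pos hε hR (sub_nonneg.2 hr.1), sub_sub_sub_cancel_right]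
  rw [← h2, h3, hR, P.S.pos_avg_comm (sub_nonneg.2 hs.2) hε] at h
  simp only [ContinuousLinearMap.comp_apply, neg_apply, sub_self, C0Semigroup.pos_zero_apply,
    intervalIntegral.integral_neg]
  rw [h, map_add, ← ContinuousLinearMap.intervalIntegral_comp_comm]
  · ring
  · refine Continuous.intervalIntegrable ?_ _ _
    refine Continuous.c0_pos (continuous_const.sub continuous_id) ((G.M₁.comp R).continuous.comp ?_)
    exact (P.S.continuous_pos_apply x).comp (continuous_id.sub continuous_const)

/-- `B₂ y` is a mild solution if `y` is one with values in `E`. -/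
theorem isMildOn_B₂ (hH : IsReflexiveSpace H) {T : ℝ} {g y : ℝ → H} {ψ : ℝ → E}
    (hy : IsMildOn P.S 0 T g y) (hψ : IntegrableOn ψ (Set.Ioc 0 T))
    (hψy : ∀ᵐ t ∂(timeMeasure T), G.ι (ψ t) = y t) :
    IsMildOn P.S 0 T (fun s => P.B₂ (g s) + G.M₁ (ψ s)) (fun t => P.B₂ (y t)) := by
  refine ⟨P.B₂.continuous.comp_continuousOn hy.cont,
    Integrable.add (P.B₂.integrable_comp hy.int) (G.M₁.integrable_comp hψ), fun t ht => ?_⟩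
  refine (SeparatingDual.eq_iff_forall_dual_eq (R := ℝ)).2 fun φ => ?_
  have hsub : Set.Ioc 0 t ⊆ Set.Ioc 0 T := Set.Ioc_subset_Ioc_right ht.2
  have hgt : IntegrableOn g (Set.Ioc 0 t) := hy.int.mono_set hsub
  have hψt : IntegrableOn ψ (Set.Ioc 0 t) := hψ.mono_set hsub
  have hψyt : ∀ᵐ s ∂(timeMeasure t), G.ι (ψ s) = y s :=
    ae_restrict_of_ae_restrict_of_subset hsub hψy
  obtain ⟨M, hM1, hM⟩ := P.S.exists_bound t
  obtain ⟨N, hN⟩ := P.S.exists_avg_bound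
  obtain ⟨N', hN'⟩ := G.SE.exists_avg_bound
  have hsrc : IntegrableOn (fun s => P.B₂ (g s) + G.M₁ (ψ s)) (Set.Ioc 0 t) :=
    Integrable.add (P.B₂.integrable_comp hgt) (G.M₁.integrable_comp hψt)
  rw [map_add, ← ContinuousLinearMap.intervalIntegral_comp_comm _
    ((integrableOn_pos_sub hsrc t).ii ht.1), sub_zero]
  -- The Duhamel formula for B₂y, tested on φ and regularized. For ε > 0 it is the duality of y with
  -- the backward solution of `isBackwardMildOn_avg`, because on values in E the lifted average is
  -- the average in E. Then ε → 0 by dominated convergence.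
  let I : ℝ → ℝ := fun ε => ∫ s in (0 : ℝ)..t,
    φ (P.S.pos (t - s) (P.B₂ (ε⁻¹ • P.S.avg ε (g s)) + G.M₁ (ε⁻¹ • G.SE.avg ε (ψ s))))
  have key : ∀ᶠ ε : ℝ in 𝓝[>] 0, φ (P.S.pos t (P.B₂ (ε⁻¹ • P.S.avg ε (y 0)))) + I ε
      = φ (P.B₂ (ε⁻¹ • P.S.avg ε (y t))) := by
    filter_upwards [self_mem_nhdsWithin] with ε (hε : 0 < ε)
    obtain ⟨R, hR⟩ := G.exists_avg_lift hε.le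
    have hb := G.isBackwardMildOn_avg hH φ hε.le hR t
    have hyt := hy.mono_right ht.2
    have hd := hyt.duality ht.1 hb
    rw [← intervalIntegral.integral_sub ((integrableOn_apply_right hb.cont hyt.int).ii ht.1)
      ((integrableOn_apply_left hb.int hyt.cont).ii ht.1)] at hd
    have hI : I ε = ε⁻¹ * ∫ s in (0 : ℝ)..t,
        (((φ.comp (P.S.pos (t - s))).comp (P.B₂.comp (P.S.avg ε))) (g s)
          - (-((φ.comp (P.S.pos (t - s))).comp (G.M₁.comp R))) (y s)) := by
      rw [← intervalIntegral.integral_const_mul]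
      refine intervalIntegral.integral_congr_ae_restrict ?_
      rw [Set.uIoc_of_le ht.1]
      filter_upwards [hψyt] with s hs
      simp only [neg_apply, ContinuousLinearMap.comp_apply, sub_neg_eq_add]
      rw [← hs, G.lift_ι hR]
      simp only [map_smul, map_add, smul_eq_mul]
      ring
    rw [hI, ← hd]
    simp only [ContinuousLinearMap.comp_apply, map_smul, smul_eq_mul, sub_self, sub_zero,
      C0Semigroup.pos_zero_apply]
    ring
  have l1 : Tendsto (fun ε : ℝ => φ (P.S.pos t (P.B₂ (ε⁻¹ • P.S.avg ε (y 0))))) (𝓝[>] 0)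
      (𝓝 (φ (P.S.pos t (P.B₂ (y 0))))) :=
    ((φ.comp ((P.S.pos t).comp P.B₂)).continuous.tendsto _).comp (P.S.tendsto_avg (y 0))
  have l2 : Tendsto (fun ε : ℝ => φ (P.B₂ (ε⁻¹ • P.S.avg ε (y t)))) (𝓝[>] 0)
      (𝓝 (φ (P.B₂ (y t)))) :=
    ((φ.comp P.B₂).continuous.tendsto _).comp (P.S.tendsto_avg (y t))
  have l3 : Tendsto I (𝓝[>] 0)
      (𝓝 (∫ s in (0 : ℝ)..t, φ (P.S.pos (t - s) (P.B₂ (g s) + G.M₁ (ψ s))))) := by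
    refine intervalIntegral.tendsto_integral_filter_of_dominated_convergence
      (fun s => ‖φ‖ * (M * (‖P.B₂‖ * (N * ‖g s‖) + ‖G.M₁‖ * (N' * ‖ψ s‖)))) ?_ ?_ ?_ ?_
    · refine Eventually.of_forall fun ε => ?_
      rw [Set.uIoc_of_le ht.1]
      refine φ.continuous.comp_aestronglyMeasurable (AEStronglyMeasurable.c0_pos
        (continuous_const.sub continuous_id).aestronglyMeasurable (AEStronglyMeasurable.add ?_ ?_))
      · exact (P.B₂.comp (ε⁻¹ • P.S.avg ε)).continuous.comp_aestronglyMeasurable hgt.1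
      · exact (G.M₁.comp (ε⁻¹ • G.SE.avg ε)).continuous.comp_aestronglyMeasurable hψt.1
    · filter_upwards [Ioc_mem_nhdsGT one_pos] with ε hε
      refine Eventually.of_forall fun s hs => ?_
      rw [Set.uIoc_of_le ht.1] at hs
      refine φ.le_of_opNorm_le_of_le le_rfl (le_trans ((P.S.pos _).le_of_opNorm_le
        (hM _ (by linarith [hs.1])) _) ?_)
      gcongr
      refine (norm_add_le _ _).trans (add_le_add ?_ ?_)
      · exact P.B₂.le_of_opNorm_le_of_le le_rfl (hN ε hε.1 hε.2 _)
      · exact G.M₁.le_of_opNorm_le_of_le le_rfl (hN' ε hε.1 hε.2 _)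
    · exact IntegrableOn.ii ((((hgt.norm.const_mul N).const_mul _).add
        ((hψt.norm.const_mul N').const_mul _)).const_mul M |>.const_mul _) ht.1
    · refine Eventually.of_forall fun s _ => ?_
      exact ((φ.comp (P.S.pos (t - s))).continuous.tendsto _).comp
        (((P.B₂.continuous.tendsto _).comp (P.S.tendsto_avg (g s))).add
          ((G.M₁.continuous.tendsto _).comp (G.SE.tendsto_avg (ψ s))))
  exact tendsto_nhds_unique l2 ((l1.add l3).congr' key)

/-- `B₂* p` is a backward mild solution if `M₁* p` has a representative in `L¹(0,T;H*)`. -/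
theorem isBackwardMildOn_comp_B₂ {T : ℝ} {Gp p m : ℝ → StrongDual ℝ H}
    (hp : IsBackwardMildOn P.S 0 T Gp p) (hm : G.IsAdjointRep G.M₁ p m) (hT : T = P.T)
    (hmi : IntegrableOn m (Set.Ioc 0 T)) :
    IsBackwardMildOn P.S 0 T (fun s => (Gp s).comp P.B₂ - m s) (fun t => (p t).comp P.B₂) := by
  let L : StrongDual ℝ H →L[ℝ] StrongDual ℝ H := (ContinuousLinearMap.compL ℝ H H ℝ).flip P.B₂
  have hint : IntegrableOn (fun s => (Gp s).comp P.B₂ - m s) (Set.Ioc 0 T) :=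
    Integrable.sub (L.integrable_comp hp.int) hmi
  refine ⟨L.continuous.comp_continuousOn hp.cont, hint, fun t ht x => ?_⟩
  -- For vectors of E, s ↦ B₂S(s - t)e is a forward mild solution with source M₁S(s - t)e. Duality
  -- with p gives the formula once p ∘ M₁ is replaced by m on E.
  have hE : ∀ e : E, p t (P.B₂ (G.ι e)) = p T (P.B₂ (P.S.pos (T - t) (G.ι e)))
      + ∫ s in t..T, ((Gp s).comp P.B₂ - m s) (P.S.pos (s - t) (G.ι e)) := by
    intro e
    have hc : Continuous fun s => G.M₁ (G.SE.pos (s - t) e) := G.M₁.continuous.comp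
      ((G.SE.continuous_pos_apply e).comp (continuous_id.sub continuous_const))
    have hc' : Continuous fun s => P.B₂ (P.S.pos (s - t) (G.ι e)) := P.B₂.continuous.comp
      ((P.S.continuous_pos_apply _).comp (continuous_id.sub continuous_const))
    have hy : IsMildOn P.S t T (fun s => G.M₁ (G.SE.pos (s - t) e))
        (fun s => P.B₂ (P.S.pos (s - t) (G.ι e))) := by
      refine ⟨hc'.continuousOn, hc.continuousOn.integrableOn_Ioc, fun s hs => ?_⟩
      have h2 := intervalIntegral.integral_comp_sub_right (a := t) (b := s)
        (fun r => P.S.pos (s - t - r) (G.M₁ (G.SE.pos r e))) t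
      simp only [sub_self, sub_sub_sub_cancel_right] at h2
      rw [G.commutator_pos (sub_nonneg.2 hs.1), h2, sub_self, C0Semigroup.pos_zero_apply]
    have hpt := hp.mono_left ht.1
    have hd := hy.duality ht.2 hpt
    have i1 := (integrableOn_apply_right hpt.cont hy.int).ii ht.2
    have i2 := (integrableOn_apply_left hpt.int hy.cont).ii ht.2
    rw [← intervalIntegral.integral_sub i1 i2] at hd
    have h3 : ∫ s in t..T, (p s (G.M₁ (G.SE.pos (s - t) e))
          - Gp s (P.B₂ (P.S.pos (s - t) (G.ι e))))
        = -∫ s in t..T, ((Gp s).comp P.B₂ - m s) (P.S.pos (s - t) (G.ι e)) := by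
      rw [← intervalIntegral.integral_neg]
      refine intervalIntegral.integral_congr_ae_restrict ?_
      rw [Set.uIoc_of_le ht.2]
      have hm' : ∀ᵐ s ∂(volume.restrict (Set.Ioc t T)), (m s).comp G.ι = (p s).comp G.M₁ := by
        rw [hT]
        exact ae_restrict_of_ae_restrict_of_subset (Set.Ioc_subset_Ioc_left ht.1) hm
      filter_upwards [hm'] with s hs
      have := congrArg (fun f => f (G.SE.pos (s - t) e)) hs
      simp only [ContinuousLinearMap.comp_apply, ι_pos] at this
      simp only [sub_apply, ContinuousLinearMap.comp_apply]
      rw [this]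
      ring
    rw [h3, sub_self, C0Semigroup.pos_zero_apply] at hd
    linarith
  obtain ⟨M, hM1, hM⟩ := P.S.exists_bound T
  obtain ⟨N, hN⟩ := P.S.exists_avg_bound
  have hintt := hint.mono_set (Set.Ioc_subset_Ioc_left ht.1 : Set.Ioc t T ⊆ Set.Ioc 0 T)
  -- Any x in H is a limit of averages, which come from E. The limit passes under the integral
  -- because m takes values in the dual of H and not only in that of E.
  have l1 : Tendsto (fun ε : ℝ => p t (P.B₂ (ε⁻¹ • P.S.avg ε x))) (𝓝[>] 0) (𝓝 (p t (P.B₂ x))) :=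
    (((p t).comp P.B₂).continuous.tendsto _).comp (P.S.tendsto_avg x)
  have l2 : Tendsto (fun ε : ℝ => p T (P.B₂ (P.S.pos (T - t) (ε⁻¹ • P.S.avg ε x)))) (𝓝[>] 0)
      (𝓝 (p T (P.B₂ (P.S.pos (T - t) x)))) :=
    (((p T).comp (P.B₂.comp (P.S.pos (T - t)))).continuous.tendsto _).comp (P.S.tendsto_avg x)
  have l3 : Tendsto (fun ε : ℝ => ∫ s in t..T, ((Gp s).comp P.B₂ - m s)
      (P.S.pos (s - t) (ε⁻¹ • P.S.avg ε x))) (𝓝[>] 0)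
      (𝓝 (∫ s in t..T, ((Gp s).comp P.B₂ - m s) (P.S.pos (s - t) x))) := by
    refine intervalIntegral.tendsto_integral_filter_of_dominated_convergence
      (fun s => ‖(Gp s).comp P.B₂ - m s‖ * (M * (N * ‖x‖))) ?_ ?_ ?_ ?_
    · refine Eventually.of_forall fun ε => ?_
      rw [Set.uIoc_of_le ht.2]
      exact aesm_clm_apply hintt.1 ((P.S.continuous_pos_apply _).comp
        (continuous_id.sub continuous_const)).aestronglyMeasurable
    · filter_upwards [Ioc_mem_nhdsGT one_pos] with ε hε
      refine Eventually.of_forall fun s hs => ?_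
      rw [Set.uIoc_of_le ht.2] at hs
      refine ContinuousLinearMap.le_of_opNorm_le_of_le _ le_rfl ?_
      refine (ContinuousLinearMap.le_of_opNorm_le_of_le _ (hM _ (by linarith [ht.1, hs.2])) ?_)
      exact hN ε hε.1 hε.2 x
    · exact IntegrableOn.ii (hintt.norm.mul_const _) ht.2
    · refine Eventually.of_forall fun s _ => ?_
      exact ((((Gp s).comp P.B₂ - m s).comp (P.S.pos (s - t))).continuous.tendsto _).comp
        (P.S.tendsto_avg x)
  refine tendsto_nhds_unique l1 ((l2.add l3).congr' ?_)
  filter_upwards [self_mem_nhdsWithin] with ε (hε : 0 < ε)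
  obtain ⟨R, hR⟩ := G.exists_avg_lift hε.le
  have := hE (ε⁻¹ • R x)
  rw [map_smul, hR] at this
  exact this.symm

end GohSetting

/-! ### Bounded controls; state, linearized state, costate and remainder. -/

/-- Essentially bounded measurable scalar functions on `(0,T)`. -/
def IsBddMeas (T : ℝ) (u : ℝ → ℝ) : Prop :=
  AEStronglyMeasurable u (timeMeasure T) ∧ ∃ C, ∀ᵐ t ∂(timeMeasure T), |u t| ≤ C

lemma IsBddMeas.integrableOn {T : ℝ} {u : ℝ → ℝ} (hu : IsBddMeas T u) :
    IntegrableOn u (Set.Ioc 0 T) := by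
  obtain ⟨C, hC⟩ := hu.2
  exact Integrable.of_bound hu.1 C hC

lemma IsBddMeas.add {T : ℝ} {u v : ℝ → ℝ} (hu : IsBddMeas T u) (hv : IsBddMeas T v) :
    IsBddMeas T (fun t => u t + v t) := by
  obtain ⟨C, hC⟩ := hu.2
  obtain ⟨D, hD⟩ := hv.2
  refine ⟨hu.1.add hv.1, C + D, ?_⟩
  filter_upwards [hC, hD] with t h1 h2
  exact (abs_add_le _ _).trans (add_le_add h1 h2)

lemma IsBddMeas.mul {T : ℝ} {u v : ℝ → ℝ} (hu : IsBddMeas T u) (hv : IsBddMeas T v) :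
    IsBddMeas T (fun t => u t * v t) := by
  obtain ⟨C, hC⟩ := hu.2
  obtain ⟨D, hD⟩ := hv.2
  refine ⟨hu.1.mul hv.1, |C| * D, ?_⟩
  filter_upwards [hC, hD] with t h1 h2
  rw [abs_mul]
  exact mul_le_mul (h1.trans (le_abs_self C)) h2 (abs_nonneg _) (abs_nonneg _)

lemma IsBddMeas.smul_integrableOn {X : Type*} [NormedAddCommGroup X] [NormedSpace ℝ X]
    {T : ℝ} {u : ℝ → ℝ} {x : ℝ → X} (hu : IsBddMeas T u) (hx : IntegrableOn x (Set.Ioc 0 T)) :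
    IntegrableOn (fun s => u s • x s) (Set.Ioc 0 T) := by
  obtain ⟨C, hC⟩ := hu.2
  exact Integrable.bdd_smul hx C hu.1 hC

lemma IsBddMeas.mul_integrableOn {T : ℝ} {u : ℝ → ℝ} {x : ℝ → ℝ} (hu : IsBddMeas T u)
    (hx : IntegrableOn x (Set.Ioc 0 T)) : IntegrableOn (fun s => u s * x s) (Set.Ioc 0 T) :=
  hu.smul_integrableOn hx

lemma ContinuousOn.isBddMeas {T : ℝ} {u : ℝ → ℝ} (hu : ContinuousOn u (Set.Icc 0 T)) :
    IsBddMeas T u := by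
  obtain ⟨C, hC⟩ := isCompact_Icc.exists_bound_of_continuousOn hu
  refine ⟨hu.aesm_Ioc, C, ?_⟩
  filter_upwards [ae_restrict_mem measurableSet_Ioc] with t ht
  exact hC t (Set.Ioc_subset_Icc_self ht)

lemma continuousOn_primitive' {T : ℝ} {v : ℝ → ℝ} (hv : IntegrableOn v (Set.Ioc 0 T)) :
    ContinuousOn (primitive v) (Set.Icc 0 T) :=
  continuousOn_primitive_Ioc hv

namespace BilinearProblem

variable {H : Type*} [NormedAddCommGroup H] [NormedSpace ℝ H]
  (P : BilinearProblem H) {u v : ℝ → ℝ}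

lemma isBddMeas_of_mem_Uad (hu : u ∈ P.Uad) : IsBddMeas P.T u := by
  refine ⟨hu.1.1, max |P.um| |P.uM|, ?_⟩
  filter_upwards [hu.2] with t ht
  exact abs_le_max_abs_abs ht.1 ht.2

variable [CompleteSpace H]

/-- The state is picked by `Classical.epsilon`, so existence alone makes it a mild solution;
uniqueness is not needed. The linearized state and the costate are treated in the same way. -/
lemma isMildOn_state (hu : IsBddMeas P.T u) :
    IsMildOn P.S 0 P.T (fun s => P.f s + u s • P.calB u s) (P.state u) ∧
      P.state u 0 = P.Ψ₀ := by
  obtain ⟨C, hC⟩ := hu.2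
  have hT := P.T_pos.le
  have hex : ∃ y, IsMildSolution P.S P.T P.Ψ₀ (fun s y => P.f s + u s • (P.B₁ + P.B₂ y)) y := by
    obtain ⟨y, hy0, hy⟩ := exists_isMildOn P.S hT P.Ψ₀ (k := fun s => P.f s + u s • P.B₁)
      (Integrable.add P.integrable_f (hu.integrableOn.smul_const P.B₁)) hu.1 hC P.B₂
    refine ⟨y, ?_⟩
    rw [← hy0]
    refine IsMildOn.isMildSolution (hy.congr_source (Eventually.of_forall fun s => ?_))
    simp only [smul_add]
    abel
  have h := Classical.epsilon_spec hex
  refine ⟨IsMildSolution.isMildOn hT h ?_, h.apply_zero hT⟩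
  exact Integrable.add P.integrable_f (hu.smul_integrableOn
    (continuousOn_const.add (P.B₂.continuous.comp_continuousOn h.1)).integrableOn_Ioc)

lemma continuousOn_state (hu : IsBddMeas P.T u) : ContinuousOn (P.state u) (Set.Icc 0 P.T) :=
  (P.isMildOn_state hu).1.cont

lemma continuousOn_calB (hu : IsBddMeas P.T u) : ContinuousOn (P.calB u) (Set.Icc 0 P.T) :=
  continuousOn_const.add (P.B₂.continuous.comp_continuousOn (P.continuousOn_state hu))

lemma isMildOn_linState (hu : IsBddMeas P.T u) (hv : IsBddMeas P.T v) :
    IsMildOn P.S 0 P.T (fun s => u s • P.B₂ (P.linState u v s) + v s • P.calB u s)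
      (P.linState u v) ∧ P.linState u v 0 = 0 := by
  obtain ⟨C, hC⟩ := hu.2
  have hT := P.T_pos.le
  have hk := hv.smul_integrableOn (P.continuousOn_calB hu).integrableOn_Ioc
  have hex : ∃ y, IsMildSolution P.S P.T 0 (fun s y => u s • P.B₂ y + v s • P.calB u s) y := by
    obtain ⟨y, hy0, hy⟩ := exists_isMildOn P.S hT 0 hk hu.1 hC P.B₂
    refine ⟨y, ?_⟩
    rw [← hy0]
    exact IsMildOn.isMildSolution hy
  have h := Classical.epsilon_spec hex
  refine ⟨IsMildSolution.isMildOn hT h ?_, h.apply_zero hT⟩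
  exact Integrable.add (hu.smul_integrableOn
    (P.B₂.continuous.comp_continuousOn h.1).integrableOn_Ioc) hk

lemma integrableOn_Ψd : IntegrableOn P.Ψd (Set.Ioc 0 P.T) :=
  P.memLp_Ψd.integrable le_top

lemma integrableOn_Q (hu : IsBddMeas P.T u) :
    IntegrableOn (fun s => P.Q (P.state u s - P.Ψd s)) (Set.Ioc 0 P.T) :=
  P.Q.integrable_comp (Integrable.sub (P.continuousOn_state hu).integrableOn_Ioc P.integrableOn_Ψd)

lemma isBackwardMildOn_costate (hH : IsReflexiveSpace H) (hu : IsBddMeas P.T u) :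
    IsBackwardMildOn P.S 0 P.T
      (fun s => P.Q (P.state u s - P.Ψd s) + u s • (P.costate u s).comp P.B₂) (P.costate u) ∧
      P.costate u P.T = P.QT (P.state u P.T - P.ΨdT) := by
  obtain ⟨C, hC⟩ := hu.2
  have hT := P.T_pos.le
  have hex := exists_isMildBackwardSolution P.S hH hT (P.QT (P.state u P.T - P.ΨdT))
    (P.integrableOn_Q hu) hu.1 hC P.B₂
  have h := Classical.epsilon_spec hex
  refine IsMildBackwardSolution.isBackwardMildOn hH hT h ?_
  have h1 : Integrable _ (timeMeasure P.T) := P.integrableOn_Q hu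
  have h2 : Integrable _ (timeMeasure P.T) := hu.smul_integrableOn
    (((ContinuousLinearMap.compL ℝ H H ℝ).flip P.B₂).continuous.comp_continuousOn
      h.1).integrableOn_Ioc
  exact h1.add h2

/-- The second order remainder of the state. -/
def remState (u v : ℝ → ℝ) (t : ℝ) : H :=
  P.state (fun s => u s + v s) t - P.state u t - P.linState u v t

/-- In the difference of the three equations every first order term cancels. The product vB₂z is the
only forcing left, which makes the remainder of second order. -/
lemma isMildOn_remState (hu : IsBddMeas P.T u) (hv : IsBddMeas P.T v) :
    IsMildOn P.S 0 P.T (fun s => (u s + v s) • P.B₂ (P.remState u v s)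
      + v s • P.B₂ (P.linState u v s)) (P.remState u v) ∧ P.remState u v 0 = 0 := by
  obtain ⟨h1, h1'⟩ := P.isMildOn_state (hu.add hv)
  obtain ⟨h2, h2'⟩ := P.isMildOn_state hu
  obtain ⟨h3, h3'⟩ := P.isMildOn_linState hu hv
  refine ⟨((h1.sub h2).sub h3).congr_source (Eventually.of_forall fun s => ?_), ?_⟩
  · simp only [remState, calB, map_sub, smul_sub, add_smul, smul_add]
    abel
  · rw [remState, h1', h2', h3']; simp

/-- The variation of the state is a mild solution. -/
lemma isMildOn_variation (hu : IsBddMeas P.T u) (hv : IsBddMeas P.T v) :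
    IsMildOn P.S 0 P.T (fun s => u s • P.B₂ (P.linState u v s + P.remState u v s)
      + v s • (P.calB u s + P.B₂ (P.linState u v s + P.remState u v s)))
      (fun s => P.linState u v s + P.remState u v s) := by
  have h := (P.isMildOn_linState hu hv).1.add (P.isMildOn_remState hu hv).1
  refine h.congr_source (Eventually.of_forall fun s => ?_)
  generalize P.linState u v s = z
  generalize P.remState u v s = y
  simp only [map_add, smul_add, add_smul]
  abel

end BilinearProblem

/-! ### The equations of ℬ and of the Goh transform. -/

namespace GohSetting

variable {H : Type*} [NormedAddCommGroup H] [NormedSpace ℝ H] [CompleteSpace H]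
  {P : BilinearProblem H} {E : Type*} [NormedAddCommGroup E] [NormedSpace ℝ E] [CompleteSpace E]
  (G : GohSetting P E) {u v : ℝ → ℝ} {ψ : ℝ → E}

lemma IsStateRep.integrableOn {G : GohSetting P E} (hψ : G.IsStateRep u ψ) :
    IntegrableOn ψ (Set.Ioc 0 P.T) :=
  hψ.1.integrable (by norm_num)

/-- The source `A B₁ + B₂ f + M₁ Ψ̂` of the equation of the Goh transform. -/
def gohSource (ψ : ℝ → E) (t : ℝ) : H :=
  P.A ⟨P.B₁, G.B₁_mem⟩ + P.B₂ (P.f t) + G.M₁ (ψ t)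

lemma memLp_gohSource (hf : MemLp P.f ⊤ (timeMeasure P.T)) (hψ : G.IsStateRep u ψ) :
    MemLp (G.gohSource ψ) 2 (timeMeasure P.T) := by
  have h1 : MemLp (fun _ : ℝ => P.A ⟨P.B₁, G.B₁_mem⟩) 2 (timeMeasure P.T) := memLp_const _
  have h2 : MemLp (fun t => P.B₂ (P.f t)) 2 (timeMeasure P.T) :=
    P.B₂.comp_memLp' (hf.mono_exponent le_top)
  have h3 : MemLp (fun t => G.M₁ (ψ t)) 2 (timeMeasure P.T) := G.M₁.comp_memLp' hψ.1
  exact (h1.add h2).add h3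

/-- The constant B₁ contributes AB₁, and `isMildOn_B₂` applied to the state contributes the rest. -/
lemma isMildOn_calB (hH : IsReflexiveSpace H) (hu : IsBddMeas P.T u) (hψ : G.IsStateRep u ψ) :
    IsMildOn P.S 0 P.T (fun s => G.gohSource ψ s + u s • P.B₂ (P.calB u s)) (P.calB u) := by
  refine ((isMildOn_const P.S ⟨P.B₁, G.B₁_mem⟩ P.T).add (G.isMildOn_B₂ hH
    (P.isMildOn_state hu).1 hψ.integrableOn hψ.2)).congr_source (Eventually.of_forall fun s => ?_)
  simp only [gohSource, map_add, map_smul]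
  abel

/-- The point of the Goh transform: the derivative of wℬ contains vℬ and cancels the forcing of z,
so that v disappears and only w is left in the source. -/
lemma isMildOn_gohXi (hH : IsReflexiveSpace H) (hu : IsBddMeas P.T u) (hψ : G.IsStateRep u ψ)
    (hv : IsBddMeas P.T v) :
    IsMildOn P.S 0 P.T (fun s => u s • P.B₂ (gohXi P u v s) + -(primitive v s • G.gohSource ψ s))
      (gohXi P u v) ∧ gohXi P u v 0 = 0 := by
  have h1 := (G.isMildOn_calB hH hu hψ).primitive_smul hv.integrableOn
  obtain ⟨h2, h2'⟩ := P.isMildOn_linState hu hv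
  refine ⟨(h2.sub h1).congr_source (Eventually.of_forall fun s => ?_), ?_⟩
  · simp only [gohXi, primitive, map_sub, smul_sub, smul_add, map_smul]
    rw [smul_comm (u s)]
    abel
  · rw [gohXi, h2']; simp [primitive]

end GohSetting

/-! ### The exact second order expansion and its integration by parts. -/

section Expansion

/-- Integration by parts for scalar functions given as primitives. -/
lemma primitive_mul_eq {T k : ℝ} {α β F : ℝ → ℝ}
    (hα : IntegrableOn α (Set.Ioc 0 T)) (hβ : IntegrableOn β (Set.Ioc 0 T))
    (hF : ∀ t ∈ Set.Icc 0 T, F t = k + ∫ s in (0 : ℝ)..t, β s) {t : ℝ} (ht : t ∈ Set.Icc 0 T) :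
    primitive α t * F t = (∫ s in (0 : ℝ)..t, α s * F s)
      + ∫ s in (0 : ℝ)..t, primitive α s * β s := by
  have hsub : Set.Ioc 0 t ⊆ Set.Ioc 0 T := Set.Ioc_subset_Ioc_right ht.2
  rw [hF t ht]
  refine (primitive_mul_primitive ht.1 k (hα.mono_set hsub) (hβ.mono_set hsub)).trans ?_
  congr 1
  refine intervalIntegral.integral_congr fun s hs => ?_
  rw [Set.uIcc_of_le ht.1] at hs
  rw [hF s ⟨hs.1, hs.2.trans ht.2⟩]

/-- With w² written as a primitive, `primitive_mul_eq` can also be used with w² as the weight. -/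
lemma primitive_sq {T : ℝ} {v : ℝ → ℝ} (hv : IntegrableOn v (Set.Ioc 0 T))
    {t : ℝ} (ht : t ∈ Set.Icc 0 T) :
    primitive v t ^ 2 = primitive (fun s => 2 * (primitive v s * v s)) t := by
  have h := primitive_mul_eq (k := 0) hv hv (F := primitive v) (fun t _ => (zero_add _).symm) ht
  change _ = ∫ s in (0 : ℝ)..t, 2 * (primitive v s * v s)
  rw [intervalIntegral.integral_const_mul, two_mul, sq, h]
  congr 1
  exact intervalIntegral.integral_congr fun s _ => mul_comm _ _

lemma integral_add_add {T : ℝ} (hT : 0 ≤ T) {f g h : ℝ → ℝ} (hf : IntegrableOn f (Set.Ioc 0 T))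
    (hg : IntegrableOn g (Set.Ioc 0 T)) (hh : IntegrableOn h (Set.Ioc 0 T)) :
    ∫ t in (0 : ℝ)..T, (f t + g t + h t) = (∫ t in (0 : ℝ)..T, f t) + (∫ t in (0 : ℝ)..T, g t)
      + ∫ t in (0 : ℝ)..T, h t := by
  rw [← intervalIntegral.integral_add (hf.ii hT) (hg.ii hT)]
  exact intervalIntegral.integral_add (IntegrableOn.ii (Integrable.add hf hg) hT) (hh.ii hT)

lemma integral_add_sub {T : ℝ} (hT : 0 ≤ T) {f g h : ℝ → ℝ} (hf : IntegrableOn f (Set.Ioc 0 T))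
    (hg : IntegrableOn g (Set.Ioc 0 T)) (hh : IntegrableOn h (Set.Ioc 0 T)) :
    ∫ t in (0 : ℝ)..T, (f t + g t - h t) = (∫ t in (0 : ℝ)..T, f t) + (∫ t in (0 : ℝ)..T, g t)
      - ∫ t in (0 : ℝ)..T, h t := by
  rw [← intervalIntegral.integral_add (hf.ii hT) (hg.ii hT)]
  exact intervalIntegral.integral_sub (IntegrableOn.ii (Integrable.add hf hg) hT) (hh.ii hT)

variable {H : Type*} [NormedAddCommGroup H] [NormedSpace ℝ H] [CompleteSpace H]
  {E : Type*} [NormedAddCommGroup E] [NormedSpace ℝ E] [CompleteSpace E]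

namespace BilinearProblem

variable (P : BilinearProblem H) {u v : ℝ → ℝ} {m₁ : ℝ → StrongDual ℝ H}

/-- The functional `B₂* Q(Ψ̂ - Ψ_d) - M₁* p̂`. -/
def gohDual (P : BilinearProblem H) (u : ℝ → ℝ) (m₁ : ℝ → StrongDual ℝ H) (t : ℝ) :
    StrongDual ℝ H :=
  (P.Q (P.state u t - P.Ψd t)).comp P.B₂ - m₁ t

/-- The part of the quadratic form that is not reduced to a function of `w` when expressed with the
state `x` instead of its Goh transform. -/
def auxForm (P : BilinearProblem H) (u : ℝ → ℝ) (m₁ : ℝ → StrongDual ℝ H) (x : ℝ → H)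
    (w : ℝ → ℝ) : ℝ :=
  P.QT (x P.T) (x P.T) + 2 * w P.T * P.costate u P.T (P.B₂ (x P.T))
    + ∫ t in (0 : ℝ)..P.T, (P.Q (x t) (x t) + 2 * (w t * P.gohDual u m₁ t (x t)))

lemma integrableOn_gohDual (hu : IsBddMeas P.T u) (hm₁c : ContinuousOn m₁ (Set.Icc 0 P.T)) :
    IntegrableOn (P.gohDual u m₁) (Set.Ioc 0 P.T) :=
  Integrable.sub (((ContinuousLinearMap.compL ℝ H H ℝ).flip P.B₂).integrable_comp
    (P.integrableOn_Q hu)) hm₁c.integrableOn_Ioc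

/-- The second order expansion of the cost, before integration by parts. -/
lemma two_mul_cost_sub (hH : IsReflexiveSpace H) (hu : IsBddMeas P.T u) (hv : IsBddMeas P.T v) :
    2 * (P.reducedCost (fun t => u t + v t) - P.reducedCost u
        - ∫ t in (0 : ℝ)..P.T, P.Lam u t * v t)
      = (∫ t in (0 : ℝ)..P.T, P.Q (P.linState u v t + P.remState u v t)
          (P.linState u v t + P.remState u v t))
        + P.QT (P.linState u v P.T + P.remState u v P.T)
          (P.linState u v P.T + P.remState u v P.T)
        + 2 * ∫ t in (0 : ℝ)..P.T, v t *
          P.costate u t (P.B₂ (P.linState u v t + P.remState u v t)) := by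
  have hT := P.T_pos.le
  obtain ⟨hp, hpT⟩ := P.isBackwardMildOn_costate hH hu
  have hδ := P.isMildOn_variation hu hv
  have hδ0 : P.linState u v 0 + P.remState u v 0 = 0 := by
    rw [(P.isMildOn_linState hu hv).2, (P.isMildOn_remState hu hv).2, add_zero]
  have hst : ∀ t, P.state (fun s => u s + v s) t
      = P.state u t + (P.linState u v t + P.remState u v t) := fun t => by
    rw [remState]; abel
  have hB := P.continuousOn_calB hu
  have hΨ := P.continuousOn_state hu
  have hQ := P.integrableOn_Q hu
  -- The terms with û cancel in this pairing. It trades ⟨p̂(T),δ(T)⟩, the first order part of the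
  -- terminal cost, for the running one and for ∫v⟨p̂,ℬ + B₂δ⟩.
  have hdual := hδ.duality_primitive hp (t := P.T) ⟨hT, le_rfl⟩
  simp only [hδ0] at hdual
  simp only [reducedCost, cost, hst]
  have hδc := hδ.cont
  clear hst hδ0
  set δ : ℝ → H := fun t => P.linState u v t + P.remState u v t with hδdef
  have i1 : IntegrableOn (fun t => P.costate u t (P.calB u t)) (Set.Ioc 0 P.T) :=
    (hp.cont.clm_apply hB).integrableOn_Ioc
  have i2 : IntegrableOn (fun t => P.costate u t (P.B₂ (δ t))) (Set.Ioc 0 P.T) :=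
    (hp.cont.clm_apply (P.B₂.continuous.comp_continuousOn hδc)).integrableOn_Ioc
  have i3 : IntegrableOn (fun t => P.Q (P.state u t - P.Ψd t) (δ t)) (Set.Ioc 0 P.T) :=
    integrableOn_apply_left hQ hδc
  have i4 : IntegrableOn (fun t => P.Q (δ t) (δ t)) (Set.Ioc 0 P.T) :=
    integrableOn_bilin_right P.Q hδc hδc.integrableOn_Ioc
  have hbd : MemLp (fun t => P.state u t - P.Ψd t) ⊤ (timeMeasure P.T) := by
    obtain ⟨C, hC⟩ := isCompact_Icc.exists_bound_of_continuousOn hΨ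
    refine (memLp_top_of_bound hΨ.aesm_Ioc C ?_).sub P.memLp_Ψd
    filter_upwards [ae_restrict_mem measurableSet_Ioc] with t ht
    exact hC t (Set.Ioc_subset_Icc_self ht)
  have i5 : IntegrableOn (fun t => P.Q (P.state u t - P.Ψd t) (P.state u t - P.Ψd t))
      (Set.Ioc 0 P.T) :=
    (MemLp.of_bilin (r := 1) (fun x y => P.Q x y) ‖P.Q‖₊
      (hbd.mono_exponent (p := 2) le_top) (hbd.mono_exponent (p := 2) le_top)
      (P.Q.aestronglyMeasurable_comp₂ hbd.1 hbd.1)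
      (Eventually.of_forall fun t => P.Q.le_opNorm₂ _ _)).integrable le_rfl
  have vi := hv.integrableOn
  have j1 := hv.mul_integrableOn i1
  have j2 := hv.mul_integrableOn i2
  have e1 : ∫ t in (0 : ℝ)..P.T, (u t + v t)
      = (∫ t in (0 : ℝ)..P.T, u t) + ∫ t in (0 : ℝ)..P.T, v t :=
    intervalIntegral.integral_add (hu.integrableOn.ii hT) (vi.ii hT)
  have e2 : ∫ t in (0 : ℝ)..P.T, P.Lam u t * v t = P.α * (∫ t in (0 : ℝ)..P.T, v t)
      + ∫ t in (0 : ℝ)..P.T, v t * P.costate u t (P.calB u t) := by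
    rw [← intervalIntegral.integral_const_mul, ← intervalIntegral.integral_add
      (IntegrableOn.ii (vi.const_mul _) hT) (j1.ii hT)]
    refine intervalIntegral.integral_congr fun t _ => ?_
    simp only [Lam]
    ring
  have e3 : ∫ t in (0 : ℝ)..P.T, P.Q (P.state u t + δ t - P.Ψd t) (P.state u t + δ t - P.Ψd t)
      = (∫ t in (0 : ℝ)..P.T, P.Q (P.state u t - P.Ψd t) (P.state u t - P.Ψd t))
        + 2 * (∫ t in (0 : ℝ)..P.T, P.Q (P.state u t - P.Ψd t) (δ t))
        + ∫ t in (0 : ℝ)..P.T, P.Q (δ t) (δ t) := by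
    have i6 : IntegrableOn (fun t => 2 * P.Q (P.state u t - P.Ψd t) (δ t)) (Set.Ioc 0 P.T) :=
      Integrable.const_mul i3 2
    rw [← intervalIntegral.integral_const_mul, ← integral_add_add hT i5 i6 i4]
    refine intervalIntegral.integral_congr fun t _ => ?_
    rw [add_sub_right_comm]
    simp only [map_add, add_apply]
    rw [P.Q_symm (δ t) (P.state u t - P.Ψd t)]
    ring
  have e4 : P.QT (P.state u P.T + δ P.T - P.ΨdT) (P.state u P.T + δ P.T - P.ΨdT)
      = P.QT (P.state u P.T - P.ΨdT) (P.state u P.T - P.ΨdT)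
        + 2 * P.costate u P.T (δ P.T) + P.QT (δ P.T) (δ P.T) := by
    rw [hpT, add_sub_right_comm]
    simp only [map_add, add_apply]
    rw [P.QT_symm (δ P.T) (P.state u P.T - P.ΨdT)]
    ring
  have e5 : P.costate u P.T (δ P.T)
      = (∫ t in (0 : ℝ)..P.T, v t * P.costate u t (P.calB u t))
        + (∫ t in (0 : ℝ)..P.T, v t * P.costate u t (P.B₂ (δ t)))
        - ∫ t in (0 : ℝ)..P.T, P.Q (P.state u t - P.Ψd t) (δ t) := by
    rw [hdual, map_zero, zero_add, ← integral_add_sub hT j1 j2 i3]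
    refine intervalIntegral.integral_congr fun t _ => ?_
    simp only [add_apply, smul_apply, ContinuousLinearMap.comp_apply, map_add, map_smul,
      smul_eq_mul, hδdef]
    ring
  rw [e1, e2, e3, e4, e5]
  ring

end BilinearProblem

namespace GohSetting

variable {P : BilinearProblem H} (G : GohSetting P E) {u v : ℝ → ℝ} {ψ : ℝ → E}
  {m₁ : ℝ → StrongDual ℝ H}

/-- The derivative of `⟨B₂* p̂, ℬ⟩`. -/
def gohRate (G : GohSetting P E) (u : ℝ → ℝ) (ψ : ℝ → E) (m₁ : ℝ → StrongDual ℝ H) (t : ℝ) : ℝ :=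
  P.costate u t (P.B₂ (G.gohSource ψ t)) - P.gohDual u m₁ t (P.calB u t)

lemma isBackwardMildOn_costate_B₂ (hH : IsReflexiveSpace H) (hu : IsBddMeas P.T u)
    (hm₁ : G.IsAdjointRep G.M₁ (P.costate u) m₁) (hm₁c : ContinuousOn m₁ (Set.Icc 0 P.T)) :
    IsBackwardMildOn P.S 0 P.T
      (fun s => P.gohDual u m₁ s + u s • ((P.costate u s).comp P.B₂).comp P.B₂)
      (fun s => (P.costate u s).comp P.B₂) := by
  have h := G.isBackwardMildOn_comp_B₂ (P.isBackwardMildOn_costate hH hu).1 hm₁ rfl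
    hm₁c.integrableOn_Ioc
  refine h.congr_source (Eventually.of_forall fun s => ?_)
  ext x
  simp only [BilinearProblem.gohDual, sub_apply, add_apply, smul_apply,
    ContinuousLinearMap.comp_apply]
  ring

lemma integrableOn_gohSource (hf : MemLp P.f ⊤ (timeMeasure P.T)) (hψ : G.IsStateRep u ψ) :
    IntegrableOn (G.gohSource ψ) (Set.Ioc 0 P.T) :=
  (G.memLp_gohSource hf hψ).integrable (by norm_num)

lemma integrableOn_gohRate (hH : IsReflexiveSpace H) (hu : IsBddMeas P.T u)
    (hf : MemLp P.f ⊤ (timeMeasure P.T)) (hψ : G.IsStateRep u ψ)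
    (hm₁c : ContinuousOn m₁ (Set.Icc 0 P.T)) :
    IntegrableOn (G.gohRate u ψ m₁) (Set.Ioc 0 P.T) := by
  have h1 : Integrable (fun t => P.costate u t (P.B₂ (G.gohSource ψ t))) (timeMeasure P.T) :=
    integrableOn_apply_right (P.isBackwardMildOn_costate hH hu).1.cont
      (P.B₂.integrable_comp (G.integrableOn_gohSource hf hψ))
  have h2 : Integrable (fun t => P.gohDual u m₁ t (P.calB u t)) (timeMeasure P.T) :=
    integrableOn_apply_left (P.integrableOn_gohDual hu hm₁c) (P.continuousOn_calB hu)
  exact h1.sub h2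

/-- Integration by parts of `∫ v ⟨p̂, B₂ δ⟩`. -/
lemma two_mul_integral_costate_B₂ (hH : IsReflexiveSpace H) (hu : IsBddMeas P.T u)
    (hv : IsBddMeas P.T v) (hf : MemLp P.f ⊤ (timeMeasure P.T)) (hψ : G.IsStateRep u ψ)
    (hm₁ : G.IsAdjointRep G.M₁ (P.costate u) m₁) (hm₁c : ContinuousOn m₁ (Set.Icc 0 P.T)) :
    2 * ∫ t in (0 : ℝ)..P.T, v t * P.costate u t (P.B₂ (P.linState u v t + P.remState u v t))
      = 2 * primitive v P.T * P.costate u P.T (P.B₂ (P.linState u v P.T + P.remState u v P.T))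
        - primitive v P.T ^ 2 * P.costate u P.T (P.B₂ (P.calB u P.T))
        + (∫ t in (0 : ℝ)..P.T, primitive v t ^ 2 * G.gohRate u ψ m₁ t)
        + 2 * (∫ t in (0 : ℝ)..P.T,
          primitive v t * P.gohDual u m₁ t (P.linState u v t + P.remState u v t))
        - 2 * ∫ t in (0 : ℝ)..P.T, primitive v t * v t *
          P.costate u t (P.B₂ (P.B₂ (P.linState u v t + P.remState u v t))) := by
  have hT := P.T_pos.le
  have hp := (P.isBackwardMildOn_costate hH hu).1
  have hπ := G.isBackwardMildOn_costate_B₂ hH hu hm₁ hm₁c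
  have hδ := P.isMildOn_variation hu hv
  have hBm := G.isMildOn_calB hH hu hψ
  have hδ0 : P.linState u v 0 + P.remState u v 0 = 0 := by
    rw [(P.isMildOn_linState hu hv).2, (P.isMildOn_remState hu hv).2, add_zero]
  have hB := P.continuousOn_calB hu
  have hℓ := P.integrableOn_gohDual hu hm₁c
  have hd1 := fun t ht => hδ.duality_primitive hπ (t := t) ht
  have hd2 := fun t ht => hBm.duality_primitive hπ (t := t) ht
  simp only [hδ0] at hd1
  have hδc := hδ.cont
  clear hδ0 hδ
  set δ : ℝ → H := fun t => P.linState u v t + P.remState u v t with hδdef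
  have i1 : IntegrableOn (fun t => P.costate u t (P.B₂ (P.calB u t))) (Set.Ioc 0 P.T) :=
    (hp.cont.clm_apply (P.B₂.continuous.comp_continuousOn hB)).integrableOn_Ioc
  have i2 : IntegrableOn (fun t => P.costate u t (P.B₂ (P.B₂ (δ t)))) (Set.Ioc 0 P.T) :=
    (hp.cont.clm_apply (P.B₂.continuous.comp_continuousOn
      (P.B₂.continuous.comp_continuousOn hδc))).integrableOn_Ioc
  have i3 : IntegrableOn (fun t => P.gohDual u m₁ t (δ t)) (Set.Ioc 0 P.T) :=
    integrableOn_apply_left hℓ hδc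
  have vi := hv.integrableOn
  have wb : IsBddMeas P.T (primitive v) := (continuousOn_primitive' vi).isBddMeas
  have j1 := hv.mul_integrableOn i1
  have j2 := hv.mul_integrableOn i2
  have jβ : Integrable (fun t => v t * P.costate u t (P.B₂ (P.calB u t))
      + v t * P.costate u t (P.B₂ (P.B₂ (δ t))) - P.gohDual u m₁ t (δ t)) (timeMeasure P.T) :=
    (Integrable.add j1 j2).sub i3
  have f1 : ∀ t ∈ Set.Icc 0 P.T, P.costate u t (P.B₂ (δ t)) = 0 + ∫ s in (0 : ℝ)..t,
      (v s * P.costate u s (P.B₂ (P.calB u s)) + v s * P.costate u s (P.B₂ (P.B₂ (δ s)))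
        - P.gohDual u m₁ s (δ s)) := by
    intro t ht
    have := hd1 t ht
    rw [map_zero] at this
    refine this.trans ?_
    congr 1
    refine intervalIntegral.integral_congr fun s _ => ?_
    simp only [add_apply, smul_apply, ContinuousLinearMap.comp_apply, map_add, map_smul,
      smul_eq_mul, hδdef]
    ring
  have f2 : ∀ t ∈ Set.Icc 0 P.T, P.costate u t (P.B₂ (P.calB u t))
      = P.costate u 0 (P.B₂ (P.calB u 0)) + ∫ s in (0 : ℝ)..t, G.gohRate u ψ m₁ s := by
    intro t ht
    refine (hd2 t ht).trans ?_
    congr 1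
    refine intervalIntegral.integral_congr fun s _ => ?_
    simp only [gohRate, add_apply, smul_apply, ContinuousLinearMap.comp_apply, map_add, map_smul,
      smul_eq_mul]
    ring
  have hTm : P.T ∈ Set.Icc 0 P.T := ⟨hT, le_rfl⟩
  -- Integration by parts with v = w'. The derivative of ⟨B₂*p̂,δ⟩ still contains v⟨B₂*p̂,ℬ⟩, which
  -- leaves an integral of wv⟨p̂,B₂ℬ⟩.
  have g1 := primitive_mul_eq vi jβ f1 hTm
  have wv : IntegrableOn (fun s => 2 * (primitive v s * v s)) (Set.Ioc 0 P.T) :=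
    Integrable.const_mul (wb.mul_integrableOn vi) 2
  have hr := G.integrableOn_gohRate hH hu hf hψ hm₁c
  -- That leftover is removed by a second integration by parts, with 2wv = (w²)'. Only the triple
  -- product with B₂²δ still carries v.
  have g2 := primitive_mul_eq wv hr f2 hTm
  rw [← primitive_sq vi hTm] at g2
  have g3 : ∫ s in (0 : ℝ)..P.T, primitive (fun s => 2 * (primitive v s * v s)) s
      * G.gohRate u ψ m₁ s = ∫ s in (0 : ℝ)..P.T, primitive v s ^ 2 * G.gohRate u ψ m₁ s := by
    refine intervalIntegral.integral_congr fun s hs => ?_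
    rw [Set.uIcc_of_le hT] at hs
    rw [primitive_sq vi hs]
  have k1 : IntegrableOn (fun s => primitive v s * v s * P.costate u s (P.B₂ (P.calB u s)))
      (Set.Ioc 0 P.T) := (wb.mul hv).mul_integrableOn i1
  have k2 : IntegrableOn (fun s => primitive v s * v s * P.costate u s (P.B₂ (P.B₂ (δ s))))
      (Set.Ioc 0 P.T) := (wb.mul hv).mul_integrableOn i2
  have k3 : IntegrableOn (fun s => primitive v s * P.gohDual u m₁ s (δ s)) (Set.Ioc 0 P.T) :=
    wb.mul_integrableOn i3
  have g4 : ∫ s in (0 : ℝ)..P.T, 2 * (primitive v s * v s) * P.costate u s (P.B₂ (P.calB u s))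
      = 2 * ∫ s in (0 : ℝ)..P.T, primitive v s * v s * P.costate u s (P.B₂ (P.calB u s)) := by
    rw [← intervalIntegral.integral_const_mul]
    exact intervalIntegral.integral_congr fun s _ => mul_assoc _ _ _
  have g5 : ∫ s in (0 : ℝ)..P.T, primitive v s * (v s * P.costate u s (P.B₂ (P.calB u s))
        + v s * P.costate u s (P.B₂ (P.B₂ (δ s))) - P.gohDual u m₁ s (δ s))
      = (∫ s in (0 : ℝ)..P.T, primitive v s * v s * P.costate u s (P.B₂ (P.calB u s)))
        + (∫ s in (0 : ℝ)..P.T, primitive v s * v s * P.costate u s (P.B₂ (P.B₂ (δ s))))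
        - ∫ s in (0 : ℝ)..P.T, primitive v s * P.gohDual u m₁ s (δ s) := by
    rw [← integral_add_sub hT k1 k2 k3]
    refine intervalIntegral.integral_congr fun s _ => ?_
    ring
  rw [g3, g4] at g2
  rw [g5] at g1
  linarith

/-- Since ℬ is the image of e + B₂ψ with e representing B₁, r equals B₂ applied to `gohSource` minus
M₁(e + B₂ψ); on E, p̂ ∘ M₁ is m₁. One of the two copies of B₂AB₁ comes from M₁e. -/
lemma costate_r (hm₁ : G.IsAdjointRep G.M₁ (P.costate u) m₁) (hψ : G.IsStateRep u ψ) :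
    ∀ᵐ t ∂(timeMeasure P.T), P.costate u t (G.r ψ t)
      = P.costate u t (P.B₂ (G.gohSource ψ t)) - m₁ t (P.calB u t) := by
  obtain ⟨e, he⟩ := G.domain_subset P.B₁ G.B₁_mem
  have hM : G.M₁ e = P.A ⟨P.B₂ P.B₁, G.B₂_mem _ G.B₁_mem⟩ - P.B₂ (P.A ⟨P.B₁, G.B₁_mem⟩) := by
    have := G.M₁_extends e (by rw [he]; exact G.B₁_mem)
    simpa only [he] using this
  filter_upwards [hm₁, hψ.2] with t h1 h2
  have h3 : P.calB u t = G.ι (e + G.B₂E (ψ t)) := by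
    rw [BilinearProblem.calB, map_add, he, G.B₂E_restrict, h2]
  have h4 : m₁ t (G.ι (e + G.B₂E (ψ t))) = P.costate u t (G.M₁ (e + G.B₂E (ψ t))) :=
    congrArg (fun f => f (e + G.B₂E (ψ t))) h1
  rw [h3, h4, map_add, hM]
  simp only [r, bracketM₁, gohSource, map_add, map_sub, map_smul, sub_apply,
    ContinuousLinearMap.comp_apply, smul_eq_mul]
  ring

/-- The transformed quadratic form, expressed with the linearized state. -/
lemma Omega_eq_auxForm (hH : IsReflexiveSpace H) (hu : IsBddMeas P.T u)
    (hv : IsBddMeas P.T v) (hf : MemLp P.f ⊤ (timeMeasure P.T)) (hψ : G.IsStateRep u ψ)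
    (hm₁ : G.IsAdjointRep G.M₁ (P.costate u) m₁) (hm₁c : ContinuousOn m₁ (Set.Icc 0 P.T)) :
    Omega G u ψ m₁ (gohXi P u v) (primitive v) (primitive v P.T)
      = P.auxForm u m₁ (P.linState u v) (primitive v)
        - primitive v P.T ^ 2 * P.costate u P.T (P.B₂ (P.calB u P.T))
        + ∫ t in (0 : ℝ)..P.T, primitive v t ^ 2 * G.gohRate u ψ m₁ t := by
  have hT := P.T_pos.le
  have hp := (P.isBackwardMildOn_costate hH hu).1
  have hB := P.continuousOn_calB hu
  have hz := (P.isMildOn_linState hu hv).1.cont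
  have hξ := (G.isMildOn_gohXi hH hu hψ hv).1.cont
  have hℓ := P.integrableOn_gohDual hu hm₁c
  have hQ := P.integrableOn_Q hu
  have hr := G.integrableOn_gohRate hH hu hf hψ hm₁c
  have wc := continuousOn_primitive' hv.integrableOn
  have wb : IsBddMeas P.T (primitive v) := wc.isBddMeas
  have wb2 : IsBddMeas P.T (fun t => 2 * primitive v t) := (wc.const_mul 2).isBddMeas
  have wbs : IsBddMeas P.T (fun t => primitive v t ^ 2) := (wc.pow 2).isBddMeas
  have a1 : Integrable (fun t => P.Q (gohXi P u v t) (gohXi P u v t)) (timeMeasure P.T) :=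
    integrableOn_bilin_right P.Q hξ hξ.integrableOn_Ioc
  have a2 : Integrable (fun t => 2 * primitive v t * P.Q (gohXi P u v t) (P.calB u t))
      (timeMeasure P.T) :=
    wb2.mul_integrableOn (integrableOn_bilin_right P.Q hξ hB.integrableOn_Ioc)
  have a3 : Integrable (fun t => 2 * primitive v t * P.Q (P.state u t - P.Ψd t)
      (P.B₂ (gohXi P u v t))) (timeMeasure P.T) :=
    wb2.mul_integrableOn (integrableOn_apply_left hQ (P.B₂.continuous.comp_continuousOn hξ))
  have a4 : Integrable (fun t => 2 * primitive v t * m₁ t (gohXi P u v t)) (timeMeasure P.T) :=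
    wb2.mul_integrableOn (hm₁c.clm_apply hξ).integrableOn_Ioc
  have a5 : Integrable (fun t => P.Q (P.linState u v t) (P.linState u v t)
      + 2 * (primitive v t * P.gohDual u m₁ t (P.linState u v t))) (timeMeasure P.T) :=
    Integrable.add (integrableOn_bilin_right P.Q hz hz.integrableOn_Ioc)
      (Integrable.const_mul (wb.mul_integrableOn (integrableOn_apply_left hℓ hz)) 2)
  have a6 : Integrable (fun t => primitive v t ^ 2 * G.gohRate u ψ m₁ t) (timeMeasure P.T) :=
    wbs.mul_integrableOn hr
  have a7 : Integrable (fun t => P.Q (gohXi P u v t) (gohXi P u v t)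
      + 2 * primitive v t * P.Q (gohXi P u v t) (P.calB u t)
      + 2 * primitive v t * P.Q (P.state u t - P.Ψd t) (P.B₂ (gohXi P u v t))
      - 2 * primitive v t * m₁ t (gohXi P u v t)) (timeMeasure P.T) := ((a1.add a2).add a3).sub a4
  -- Inserting z = ξ + wℬ, the w² terms are q(ℬ), twice `gohDual` at ℬ and `gohRate`. By `costate_r`
  -- their sum is R.
  have hae : ∀ᵐ t ∂(timeMeasure P.T),
      (P.Q (P.linState u v t) (P.linState u v t)
        + 2 * (primitive v t * P.gohDual u m₁ t (P.linState u v t))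
        + primitive v t ^ 2 * G.gohRate u ψ m₁ t)
      - (P.Q (gohXi P u v t) (gohXi P u v t) + 2 * primitive v t * P.Q (gohXi P u v t) (P.calB u t)
        + 2 * primitive v t * P.Q (P.state u t - P.Ψd t) (P.B₂ (gohXi P u v t))
        - 2 * primitive v t * m₁ t (gohXi P u v t))
      = primitive v t ^ 2 * G.R u ψ t := by
    filter_upwards [G.costate_r hm₁ hψ] with t ht
    have hzt : P.linState u v t = gohXi P u v t + primitive v t • P.calB u t := by
      rw [gohXi]; abel
    rw [R, ht, hzt, gohRate, BilinearProblem.gohDual]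
    simp only [map_add, map_smul, add_apply, smul_apply, sub_apply, smul_eq_mul,
      ContinuousLinearMap.comp_apply]
    rw [P.Q_symm (P.calB u t) (gohXi P u v t)]
    ring
  have e1 : OmegaB G u ψ (primitive v)
      = ((∫ t in (0 : ℝ)..P.T, (P.Q (P.linState u v t) (P.linState u v t)
          + 2 * (primitive v t * P.gohDual u m₁ t (P.linState u v t))))
        + ∫ t in (0 : ℝ)..P.T, primitive v t ^ 2 * G.gohRate u ψ m₁ t)
        - OmegaA P u m₁ (gohXi P u v) (primitive v) := by
    rw [OmegaA, OmegaB, ← integral_add_sub hT a5 a6 a7]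
    refine intervalIntegral.integral_congr_ae_restrict ?_
    rw [Set.uIoc_of_le hT]
    filter_upwards [hae] with t ht
    exact ht.symm
  -- Passing from ξ(T) to z(T) in the term linear in h subtracts 2h²⟨p̂(T),B₂ℬ(T)⟩, which reverses
  -- the sign of the h² term.
  have e2 : OmegaT P u (gohXi P u v) (primitive v P.T)
      = P.QT (P.linState u v P.T) (P.linState u v P.T)
        + 2 * primitive v P.T * P.costate u P.T (P.B₂ (P.linState u v P.T))
        - primitive v P.T ^ 2 * P.costate u P.T (P.B₂ (P.calB u P.T)) := by
    have hzt : P.linState u v P.T = gohXi P u v P.T + primitive v P.T • P.calB u P.T := by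
      rw [gohXi]; abel
    rw [OmegaT, ← hzt, hzt]
    simp only [map_add, map_smul, smul_eq_mul, BilinearProblem.calB, smul_add]
    ring
  rw [Omega, e1, e2, BilinearProblem.auxForm]
  ring

/-- The exact remainder of the second order expansion. -/
lemma two_mul_remainder (hH : IsReflexiveSpace H) (hu : IsBddMeas P.T u)
    (hv : IsBddMeas P.T v) (hf : MemLp P.f ⊤ (timeMeasure P.T)) (hψ : G.IsStateRep u ψ)
    (hm₁ : G.IsAdjointRep G.M₁ (P.costate u) m₁) (hm₁c : ContinuousOn m₁ (Set.Icc 0 P.T)) :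
    2 * (P.reducedCost (fun t => u t + v t) - (P.reducedCost u
        + (∫ t in (0 : ℝ)..P.T, P.Lam u t * v t)
        + 1 / 2 * Omega G u ψ m₁ (gohXi P u v) (primitive v) (primitive v P.T)))
      = P.auxForm u m₁ (fun t => P.linState u v t + P.remState u v t) (primitive v)
        - P.auxForm u m₁ (P.linState u v) (primitive v)
        - 2 * ∫ t in (0 : ℝ)..P.T, primitive v t * v t *
          P.costate u t (P.B₂ (P.B₂ (P.linState u v t + P.remState u v t))) := by
  have hT := P.T_pos.le
  have h1 := P.two_mul_cost_sub hH hu hv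
  have h2 := G.two_mul_integral_costate_B₂ hH hu hv hf hψ hm₁ hm₁c
  have h3 := G.Omega_eq_auxForm hH hu hv hf hψ hm₁ hm₁c
  have hδ := (P.isMildOn_variation hu hv).cont
  have wb : IsBddMeas P.T (primitive v) := (continuousOn_primitive' hv.integrableOn).isBddMeas
  have i1 : IntegrableOn (fun t => P.Q (P.linState u v t + P.remState u v t)
      (P.linState u v t + P.remState u v t)) (Set.Ioc 0 P.T) :=
    integrableOn_bilin_right P.Q hδ hδ.integrableOn_Ioc
  have i2 := wb.mul_integrableOn (integrableOn_apply_left (P.integrableOn_gohDual hu hm₁c) hδ)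
  have e : P.auxForm u m₁ (fun t => P.linState u v t + P.remState u v t) (primitive v)
      = P.QT (P.linState u v P.T + P.remState u v P.T) (P.linState u v P.T + P.remState u v P.T)
        + 2 * primitive v P.T * P.costate u P.T (P.B₂ (P.linState u v P.T + P.remState u v P.T))
        + ((∫ t in (0 : ℝ)..P.T, P.Q (P.linState u v t + P.remState u v t)
          (P.linState u v t + P.remState u v t))
        + 2 * ∫ t in (0 : ℝ)..P.T,
          primitive v t * P.gohDual u m₁ t (P.linState u v t + P.remState u v t)) := by
    rw [BilinearProblem.auxForm, ← intervalIntegral.integral_const_mul,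
      ← intervalIntegral.integral_add (i1.ii hT) (IntegrableOn.ii (Integrable.const_mul i2 2) hT)]
  rw [e]
  linarith

end GohSetting

end Expansion

/-! ### Estimates of ξ, of the state remainder and of the cubic term. -/

section Estimates

/-- The Cauchy-Schwarz inequality on `(0,T)`. -/
lemma integral_abs_mul_le_sqrt {T : ℝ} (hT : 0 ≤ T) {f g : ℝ → ℝ}
    (hf : MemLp f 2 (timeMeasure T)) (hg : MemLp g 2 (timeMeasure T)) :
    ∫ t in (0 : ℝ)..T, |f t| * |g t|
      ≤ √(∫ t in (0 : ℝ)..T, f t ^ 2) * √(∫ t in (0 : ℝ)..T, g t ^ 2) := by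
  rw [intervalIntegral.integral_of_le hT, intervalIntegral.integral_of_le hT,
    intervalIntegral.integral_of_le hT]
  have h := integral_mul_norm_le_Lp_mul_Lq (μ := timeMeasure T) (f := f) (g := g)
    (p := 2) (q := 2) Real.HolderConjugate.two_two (by simpa using hf) (by simpa using hg)
  simpa [Real.sqrt_eq_rpow] using h

lemma IsBddMeas.memLp {T : ℝ} {u : ℝ → ℝ} (hu : IsBddMeas T u) : MemLp u 2 (timeMeasure T) := by
  obtain ⟨C, hC⟩ := hu.2
  exact (memLp_top_of_bound hu.1 C hC).mono_exponent le_top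

lemma MeasureTheory.MemLp.exists_ae_bound {X : Type*} [NormedAddCommGroup X] {T : ℝ} {f : ℝ → X}
    (hf : MemLp f ⊤ (timeMeasure T)) : ∃ C, 0 ≤ C ∧ ∀ᵐ t ∂(timeMeasure T), ‖f t‖ ≤ C := by
  refine ⟨(eLpNormEssSup f (timeMeasure T)).toReal, ENNReal.toReal_nonneg, ?_⟩
  have h := hf.2
  rw [eLpNorm_exponent_top] at h
  filter_upwards [ae_le_eLpNormEssSup (f := f) (μ := timeMeasure T)] with t ht
  simpa using ENNReal.toReal_mono h.ne ht

lemma abs_primitive_le {T : ℝ} {v : ℝ → ℝ} (hv : IntegrableOn v (Set.Ioc 0 T)) {t : ℝ}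
    (ht : t ∈ Set.Icc 0 T) : |primitive v t| ≤ ∫ s in (0 : ℝ)..T, |v s| := by
  refine (intervalIntegral.abs_integral_le_integral_abs ht.1).trans ?_
  exact intervalIntegral.integral_mono_interval le_rfl ht.1 ht.2
    (Eventually.of_forall fun _ => abs_nonneg _) (IntegrableOn.ii hv.norm (ht.1.trans ht.2))

/-- `∫ w² v q` is controlled by `sup |w|` if `q` is a polynomial. -/
lemma exists_cubic_polynomial_bound {T : ℝ} (hT : 0 ≤ T) (q : Polynomial ℝ) :
    ∃ C, 0 ≤ C ∧ ∀ v : ℝ → ℝ, IsBddMeas T v →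
      |∫ t in (0 : ℝ)..T, primitive v t ^ 2 * v t * q.eval t| ≤ C * (∫ t in (0 : ℝ)..T, |v t|) *
        ((∫ t in (0 : ℝ)..T, primitive v t ^ 2) + primitive v T ^ 2) := by
  obtain ⟨C₁, hC₁⟩ := (isCompact_Icc (a := (0 : ℝ)) (b := T)).exists_bound_of_continuousOn
    q.continuous.continuousOn
  obtain ⟨C₂, hC₂⟩ := (isCompact_Icc (a := (0 : ℝ)) (b := T)).exists_bound_of_continuousOn
    (Polynomial.derivative q).continuous.continuousOn
  have hTm : T ∈ Set.Icc 0 T := ⟨hT, le_rfl⟩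
  have hC₁0 : 0 ≤ C₁ := (norm_nonneg _).trans (hC₁ T hTm)
  have hC₂0 : 0 ≤ C₂ := (norm_nonneg _).trans (hC₂ T hTm)
  refine ⟨C₁ + C₂, by positivity, fun v hv => ?_⟩
  have vi := hv.integrableOn
  have wc := continuousOn_primitive' vi
  have wb : IsBddMeas T (primitive v) := wc.isBddMeas
  have iw2 : IntegrableOn (fun t => primitive v t ^ 2) (Set.Ioc 0 T) :=
    (wc.pow 2).integrableOn_Ioc
  have i1 : IntegrableOn (fun s => 2 * (primitive v s * v s)) (Set.Ioc 0 T) :=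
    Integrable.const_mul (wb.mul_integrableOn vi) 2
  have i2 : IntegrableOn (fun s => 3 * (primitive v s ^ 2 * v s)) (Set.Ioc 0 T) :=
    Integrable.const_mul ((wc.pow 2).isBddMeas.mul_integrableOn vi) 3
  -- As w²v = (w³)'/3, integration by parts against q leaves w(T)³q(T) and ∫w³q', each with a spare
  -- factor |w| ≤ ‖v‖₁.
  have hcube : ∀ t ∈ Set.Icc 0 T, primitive (fun s => 3 * (primitive v s ^ 2 * v s)) t
      = primitive v t ^ 3 := by
    intro t ht
    have h := primitive_mul_eq (k := 0) vi i1 (F := fun t => primitive v t ^ 2)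
      (fun t ht => by rw [zero_add]; exact primitive_sq vi ht) ht
    have hsub : Set.Ioc 0 t ⊆ Set.Ioc 0 T := Set.Ioc_subset_Ioc_right ht.2
    rw [← intervalIntegral.integral_add] at h
    · rw [pow_succ', h]
      exact intervalIntegral.integral_congr fun s _ => by ring
    · exact IntegrableOn.ii (IntegrableOn.mono_set
        (integrableOn_smul_left vi (wc.pow 2)) hsub) ht.1
    · exact IntegrableOn.ii (IntegrableOn.mono_set (wb.mul_integrableOn i1) hsub) ht.1
  have hq : ∀ t ∈ Set.Icc 0 T, q.eval t = q.eval 0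
      + ∫ s in (0 : ℝ)..t, (Polynomial.derivative q).eval s := by
    intro t _
    rw [intervalIntegral.integral_eq_sub_of_hasDerivAt (f := fun s => q.eval s)
      (fun s _ => q.hasDerivAt s) ((Polynomial.continuous _).intervalIntegrable _ _)]
    ring
  have hmain := primitive_mul_eq i2
    ((Polynomial.derivative q).continuous.continuousOn.integrableOn_Ioc) hq hTm
  rw [hcube T hTm] at hmain
  have e1 : ∫ s in (0 : ℝ)..T, 3 * (primitive v s ^ 2 * v s) * q.eval s
      = 3 * ∫ s in (0 : ℝ)..T, primitive v s ^ 2 * v s * q.eval s := by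
    rw [← intervalIntegral.integral_const_mul]
    exact intervalIntegral.integral_congr fun s _ => mul_assoc _ _ _
  have e2 : ∫ s in (0 : ℝ)..T, primitive (fun s => 3 * (primitive v s ^ 2 * v s)) s
        * (Polynomial.derivative q).eval s
      = ∫ s in (0 : ℝ)..T, primitive v s ^ 3 * (Polynomial.derivative q).eval s := by
    refine intervalIntegral.integral_congr fun s hs => ?_
    rw [Set.uIcc_of_le hT] at hs
    rw [hcube s hs]
  rw [e1, e2] at hmain
  set a := ∫ t in (0 : ℝ)..T, |v t| with ha
  have ha0 : 0 ≤ a := intervalIntegral.integral_nonneg hT fun _ _ => abs_nonneg _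
  set n := ∫ t in (0 : ℝ)..T, primitive v t ^ 2 with hn
  have hn0 : 0 ≤ n := intervalIntegral.integral_nonneg hT fun _ _ => sq_nonneg _
  have b1 : |primitive v T ^ 3 * q.eval T| ≤ a * primitive v T ^ 2 * C₁ := by
    rw [abs_mul, pow_succ', abs_mul, abs_of_nonneg (sq_nonneg (primitive v T))]
    gcongr
    · exact abs_primitive_le vi hTm
    · exact hC₁ T hTm
  have b2 : |∫ s in (0 : ℝ)..T, primitive v s ^ 3 * (Polynomial.derivative q).eval s|
      ≤ a * C₂ * n := by
    rw [hn, ← intervalIntegral.integral_const_mul]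
    rw [← Real.norm_eq_abs]
    refine intervalIntegral.norm_integral_le_of_norm_le hT (Eventually.of_forall fun s hs => ?_) ?_
    · have hs' := Set.Ioc_subset_Icc_self hs
      rw [Real.norm_eq_abs, abs_mul, pow_succ', abs_mul, abs_of_nonneg (sq_nonneg (primitive v s)),
        mul_right_comm]
      gcongr
      · exact abs_primitive_le vi hs'
      · exact hC₂ s hs'
    · exact IntegrableOn.ii (Integrable.const_mul iw2 _) hT
  have b3 : 3 * |∫ s in (0 : ℝ)..T, primitive v s ^ 2 * v s * q.eval s|
      ≤ a * primitive v T ^ 2 * C₁ + a * C₂ * n := by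
    rw [← abs_of_pos (show (0 : ℝ) < 3 by norm_num), ← abs_mul,
      eq_sub_of_add_eq hmain.symm]
    exact (abs_sub _ _).trans (add_le_add b1 b2)
  have hw0 := sq_nonneg (primitive v T)
  have p1 : 0 ≤ a * primitive v T ^ 2 * C₂ := by positivity
  have p2 : 0 ≤ a * n * C₁ := by positivity
  have p3 := abs_nonneg (∫ s in (0 : ℝ)..T, primitive v s ^ 2 * v s * q.eval s)
  nlinarith

/-- For a continuous weight `β`, the integrals `∫ w² v β` are negligible. -/
lemma isLittleO_cubic {T : ℝ} (hT : 0 ≤ T) {v : ℕ → ℝ → ℝ} (hv : PontryaginTendsto T v)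
    {β : ℝ → ℝ} (hβ : ContinuousOn β (Set.Icc 0 T)) :
    (fun k => ∫ t in (0 : ℝ)..T, primitive (v k) t ^ 2 * v k t * β t) =o[atTop]
      (fun k => (∫ t in (0 : ℝ)..T, primitive (v k) t ^ 2) + primitive (v k) T ^ 2) := by
  obtain ⟨hm, ⟨C, hC⟩, hv0⟩ := hv
  rw [isLittleO_iff]
  intro c hc
  -- With |v| ≤ |C| + 1 this accuracy makes the approximation error at most (c/2)‖w‖₂². The other
  -- c/2 is left for the polynomial part.
  obtain ⟨q, hq⟩ := exists_polynomial_near_of_continuousOn 0 T β hβ (c / (2 * (|C| + 1)))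
    (by positivity)
  obtain ⟨D, hD0, hD⟩ := exists_cubic_polynomial_bound hT q
  have hev : ∀ᶠ k in atTop, D * ∫ t in (0 : ℝ)..T, |v k t| ≤ c / 2 := by
    have := hv0.const_mul D
    rw [mul_zero] at this
    exact this.eventually_le_const (by positivity)
  filter_upwards [hev] with k hk
  have hb : IsBddMeas T (v k) := ⟨hm k, C, hC k⟩
  have wc := continuousOn_primitive' hb.integrableOn
  have iw2 : IntegrableOn (fun t => primitive (v k) t ^ 2) (Set.Ioc 0 T) :=
    (wc.pow 2).integrableOn_Ioc
  have h2 : IsBddMeas T (fun t => primitive (v k) t ^ 2 * v k t) := (wc.pow 2).isBddMeas.mul hb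
  set n := ∫ t in (0 : ℝ)..T, primitive (v k) t ^ 2 with hn
  have hn0 : 0 ≤ n := intervalIntegral.integral_nonneg hT fun _ _ => sq_nonneg _
  have hN0 : 0 ≤ n + primitive (v k) T ^ 2 := by positivity
  have e : ∫ t in (0 : ℝ)..T, primitive (v k) t ^ 2 * v k t * β t
      = (∫ t in (0 : ℝ)..T, primitive (v k) t ^ 2 * v k t * q.eval t)
        - ∫ t in (0 : ℝ)..T, primitive (v k) t ^ 2 * v k t * (q.eval t - β t) := by
    rw [← intervalIntegral.integral_sub]
    · exact intervalIntegral.integral_congr fun t _ => by ring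
    · exact (h2.mul_integrableOn q.continuous.continuousOn.integrableOn_Ioc).ii hT
    · exact (h2.mul_integrableOn (q.continuous.continuousOn.sub hβ).integrableOn_Ioc).ii hT
  have b1 : |∫ t in (0 : ℝ)..T, primitive (v k) t ^ 2 * v k t * (q.eval t - β t)|
      ≤ c / 2 * n := by
    rw [hn, ← intervalIntegral.integral_const_mul]
    rw [← Real.norm_eq_abs]
    refine intervalIntegral.norm_integral_le_of_norm_le hT ?_
      (IntegrableOn.ii (Integrable.const_mul iw2 _) hT)
    filter_upwards [(ae_restrict_iff' measurableSet_Ioc).1 (hC k)] with t ht hts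
    rw [Real.norm_eq_abs, abs_mul, abs_mul, abs_of_nonneg (sq_nonneg (primitive (v k) t))]
    have h3 := (hq t (Set.Ioc_subset_Icc_self hts)).le
    have h4 : |v k t| ≤ |C| + 1 := (ht hts).trans ((le_abs_self C).trans (by linarith))
    calc _ ≤ primitive (v k) t ^ 2 * (|C| + 1) * (c / (2 * (|C| + 1))) := by gcongr
      _ = _ := by field_simp
  have b2 := hD (v k) hb
  rw [Real.norm_eq_abs, Real.norm_eq_abs, abs_of_nonneg hN0, e]
  refine (abs_sub _ _).trans ?_
  have b3 := mul_le_mul_of_nonneg_right hk hN0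
  have := sq_nonneg (primitive (v k) T)
  nlinarith

variable {H : Type*} [NormedAddCommGroup H] [NormedSpace ℝ H] [CompleteSpace H]
  {E : Type*} [NormedAddCommGroup E] [NormedSpace ℝ E] [CompleteSpace E]

namespace BilinearProblem

variable (P : BilinearProblem H) {u : ℝ → ℝ} {m₁ : ℝ → StrongDual ℝ H}

lemma exists_gohDual_bound (hu : IsBddMeas P.T u) (hm₁c : ContinuousOn m₁ (Set.Icc 0 P.T)) :
    ∃ C, 0 ≤ C ∧ ∀ᵐ t ∂(timeMeasure P.T), ‖P.gohDual u m₁ t‖ ≤ C := by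
  obtain ⟨C₁, hC₁⟩ := isCompact_Icc.exists_bound_of_continuousOn (P.continuousOn_state hu)
  obtain ⟨C₂, hC₂⟩ := isCompact_Icc.exists_bound_of_continuousOn hm₁c
  obtain ⟨C₃, hC₃0, hC₃⟩ := P.memLp_Ψd.exists_ae_bound
  have hTm : P.T ∈ Set.Icc 0 P.T := ⟨P.T_pos.le, le_rfl⟩
  have h1 := (norm_nonneg _).trans (hC₁ _ hTm)
  have h2 := (norm_nonneg _).trans (hC₂ _ hTm)
  refine ⟨‖P.Q‖ * (C₁ + C₃) * ‖P.B₂‖ + C₂, by positivity, ?_⟩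
  filter_upwards [hC₃, ae_restrict_mem measurableSet_Ioc] with t h3 ht
  have ht' := Set.Ioc_subset_Icc_self ht
  refine (norm_sub_le _ _).trans (add_le_add ?_ (hC₂ t ht'))
  refine (ContinuousLinearMap.opNorm_comp_le _ _).trans ?_
  gcongr
  exact P.Q.le_of_opNorm_le_of_le le_rfl ((norm_sub_le _ _).trans (add_le_add (hC₁ t ht') h3))

/-- Perturbation of `auxForm`. -/
lemma abs_auxForm_sub_le (hu : IsBddMeas P.T u) (hm₁c : ContinuousOn m₁ (Set.Icc 0 P.T))
    {z η : ℝ → H} {w : ℝ → ℝ} (hz : ContinuousOn z (Set.Icc 0 P.T))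
    (hη : ContinuousOn η (Set.Icc 0 P.T)) (hw : ContinuousOn w (Set.Icc 0 P.T)) {e k b c : ℝ}
    (hc : ∀ᵐ t ∂(timeMeasure P.T), ‖P.gohDual u m₁ t‖ ≤ c)
    (hzb : ∀ t ∈ Set.Icc 0 P.T, ‖z t‖ ≤ k + b * |w t|)
    (hηb : ∀ t ∈ Set.Icc 0 P.T, ‖η t‖ ≤ e) :
    |P.auxForm u m₁ (fun t => z t + η t) w - P.auxForm u m₁ z w|
      ≤ ‖P.QT‖ * e * (e + 2 * (k + b * |w P.T|))
        + 2 * |w P.T| * (‖P.costate u P.T‖ * (‖P.B₂‖ * e))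
        + (P.T * (‖P.Q‖ * e * (e + 2 * k))
          + (2 * ‖P.Q‖ * b + 2 * c) * e * ∫ t in (0 : ℝ)..P.T, |w t|) := by
  have hT := P.T_pos.le
  have hTm : P.T ∈ Set.Icc 0 P.T := ⟨hT, le_rfl⟩
  have he : 0 ≤ e := (norm_nonneg _).trans (hηb _ hTm)
  have hℓ := P.integrableOn_gohDual hu hm₁c
  have i : ∀ x : ℝ → H, ContinuousOn x (Set.Icc 0 P.T) →
      IntegrableOn (fun t => P.Q (x t) (x t) + 2 * (w t * P.gohDual u m₁ t (x t)))
        (Set.Ioc 0 P.T) := fun x hx =>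
    Integrable.add (integrableOn_bilin_right P.Q hx hx.integrableOn_Ioc)
      (Integrable.const_mul (hw.isBddMeas.mul_integrableOn (integrableOn_apply_left hℓ hx)) 2)
  -- Factoring the increment of a quadratic form leaves one full factor η, which carries the
  -- smallness e.
  have quad : ∀ (B : H →L[ℝ] StrongDual ℝ H) (hB : ∀ x y, B x y = B y x) (x y : H),
      B (x + y) (x + y) - B x x = B y (y + (2 : ℝ) • x) := by
    intro B hB x y
    simp only [map_add, add_apply, map_smul, smul_eq_mul]
    rw [hB x y]
    ring
  have quadb : ∀ (B : H →L[ℝ] StrongDual ℝ H) (x y : H) (r : ℝ), ‖x‖ ≤ r → ‖y‖ ≤ e →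
      |B y (y + (2 : ℝ) • x)| ≤ ‖B‖ * e * (e + 2 * r) := by
    intro B x y r hx hy
    refine (B.le_opNorm₂ _ _).trans ?_
    gcongr
    refine (norm_add_le _ _).trans (add_le_add hy ?_)
    rw [norm_smul, Real.norm_of_nonneg (by norm_num)]
    gcongr
  have b1 := quadb P.QT _ _ _ (hzb _ hTm) (hηb _ hTm)
  have b2 : |2 * w P.T * P.costate u P.T (P.B₂ (η P.T))|
      ≤ 2 * |w P.T| * (‖P.costate u P.T‖ * (‖P.B₂‖ * e)) := by
    rw [abs_mul, abs_mul, abs_of_pos (show (0 : ℝ) < 2 by norm_num)]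
    gcongr
    exact (P.costate u P.T).le_of_opNorm_le_of_le le_rfl
      (P.B₂.le_of_opNorm_le_of_le le_rfl (hηb _ hTm))
  have b3 : |(∫ t in (0 : ℝ)..P.T, (P.Q (z t + η t) (z t + η t)
        + 2 * (w t * P.gohDual u m₁ t (z t + η t))))
      - ∫ t in (0 : ℝ)..P.T, (P.Q (z t) (z t) + 2 * (w t * P.gohDual u m₁ t (z t)))|
      ≤ P.T * (‖P.Q‖ * e * (e + 2 * k))
          + (2 * ‖P.Q‖ * b + 2 * c) * e * ∫ t in (0 : ℝ)..P.T, |w t| := by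
    have iw : IntegrableOn (fun t => |w t|) (Set.Ioc 0 P.T) := hw.norm.integrableOn_Ioc
    have ic : ∫ t in (0 : ℝ)..P.T, (‖P.Q‖ * e * (e + 2 * k)
        + (2 * ‖P.Q‖ * b + 2 * c) * e * |w t|) = P.T * (‖P.Q‖ * e * (e + 2 * k))
          + (2 * ‖P.Q‖ * b + 2 * c) * e * ∫ t in (0 : ℝ)..P.T, |w t| := by
      rw [intervalIntegral.integral_add (by simp)
        (IntegrableOn.ii (Integrable.const_mul iw _) hT), intervalIntegral.integral_const_mul]
      simp
      ring
    have hzη : ContinuousOn (fun t => z t + η t) (Set.Icc 0 P.T) := hz.add hη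
    rw [← intervalIntegral.integral_sub ((i _ hzη).ii hT) ((i _ hz).ii hT), ← ic]
    rw [← Real.norm_eq_abs]
    refine intervalIntegral.norm_integral_le_of_norm_le hT ?_ ?_
    · filter_upwards [(ae_restrict_iff' measurableSet_Ioc).1 hc] with t ht hts
      have hts' := Set.Ioc_subset_Icc_self hts
      have q1 := quadb P.Q _ _ _ (hzb _ hts') (hηb _ hts')
      have q2 : |2 * (w t * P.gohDual u m₁ t (η t))| ≤ 2 * (|w t| * (c * e)) := by
        rw [abs_mul, abs_mul, abs_of_pos (show (0 : ℝ) < 2 by norm_num)]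
        gcongr
        exact (P.gohDual u m₁ t).le_of_opNorm_le_of_le (ht hts) (hηb _ hts')
      have q3 : P.Q (z t + η t) (z t + η t) + 2 * (w t * P.gohDual u m₁ t (z t + η t))
          - (P.Q (z t) (z t) + 2 * (w t * P.gohDual u m₁ t (z t)))
          = P.Q (η t) (η t + (2 : ℝ) • z t) + 2 * (w t * P.gohDual u m₁ t (η t)) := by
        rw [← quad P.Q P.Q_symm, map_add (P.gohDual u m₁ t)]
        ring
      rw [q3, Real.norm_eq_abs]
      refine (abs_add_le _ _).trans ((add_le_add q1 q2).trans (le_of_eq ?_))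
      ring
    · exact IntegrableOn.ii (Integrable.add (integrable_const _) (Integrable.const_mul iw _)) hT
  have e1 : P.auxForm u m₁ (fun t => z t + η t) w - P.auxForm u m₁ z w
      = P.QT (η P.T) (η P.T + (2 : ℝ) • z P.T) + 2 * w P.T * P.costate u P.T (P.B₂ (η P.T))
        + ((∫ t in (0 : ℝ)..P.T, (P.Q (z t + η t) (z t + η t)
          + 2 * (w t * P.gohDual u m₁ t (z t + η t))))
        - ∫ t in (0 : ℝ)..P.T, (P.Q (z t) (z t) + 2 * (w t * P.gohDual u m₁ t (z t)))) := by
    rw [← quad P.QT P.QT_symm, auxForm, auxForm]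
    simp only [map_add]
    ring
  rw [e1]
  exact (abs_add_le _ _).trans (add_le_add ((abs_add_le _ _).trans (add_le_add b1 b2)) b3)

/-- The second order remainder of the state is small compared with `‖w‖₂` if the linearized state
is controlled by `w`. -/
lemma exists_remState_bound (hu : IsBddMeas P.T u) (C k b : ℝ) (hk : 0 ≤ k) (hb : 0 ≤ b) :
    ∃ K, 0 ≤ K ∧ ∀ v : ℝ → ℝ, AEStronglyMeasurable v (timeMeasure P.T) →
      (∀ᵐ t ∂(timeMeasure P.T), |v t| ≤ C) →
      (∀ t ∈ Set.Icc 0 P.T, ‖P.linState u v t‖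
        ≤ k * √(∫ s in (0 : ℝ)..P.T, primitive v s ^ 2) + b * |primitive v t|) →
      ∀ t ∈ Set.Icc 0 P.T, ‖P.remState u v t‖
        ≤ K * ((∫ s in (0 : ℝ)..P.T, |v s|) + √(∫ s in (0 : ℝ)..P.T, v s ^ 2))
          * √(∫ s in (0 : ℝ)..P.T, primitive v s ^ 2) := by
  obtain ⟨C', hC'⟩ := hu.2
  -- The coefficient û + v is bounded uniformly over the admissible v, so the constant is fixed
  -- before v.
  obtain ⟨K, hK0, hK⟩ := exists_mild_bound P.S P.T (C' + C) P.B₂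
  refine ⟨K * (‖P.B₂‖ * (k + b)), by positivity, fun v hm hC hz t ht => ?_⟩
  have hT := P.T_pos.le
  have hv : IsBddMeas P.T v := ⟨hm, C, hC⟩
  have hzc := (P.isMildOn_linState hu hv).1.cont
  have wc := continuousOn_primitive' hv.integrableOn
  have hsrc : IntegrableOn (fun s => v s • P.B₂ (P.linState u v s)) (Set.Ioc 0 P.T) :=
    hv.smul_integrableOn (P.B₂.continuous.comp_continuousOn hzc).integrableOn_Ioc
  obtain ⟨h1, h2⟩ := P.isMildOn_remState hu hv
  have hB : ∀ᵐ s ∂(timeMeasure P.T), |u s + v s| ≤ C' + C := by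
    filter_upwards [hC', hC] with s h3 h4
    exact (abs_add_le _ _).trans (add_le_add h3 h4)
  refine (hK (fun s => u s + v s) _ _ hB hsrc h1 h2 t ht).trans ?_
  set n := √(∫ s in (0 : ℝ)..P.T, primitive v s ^ 2) with hn
  have hn0 : 0 ≤ n := Real.sqrt_nonneg _
  set a₁ := ∫ s in (0 : ℝ)..P.T, |v s| with ha₁
  have ha₁0 : 0 ≤ a₁ := intervalIntegral.integral_nonneg hT fun _ _ => abs_nonneg _
  set a₂ := √(∫ s in (0 : ℝ)..P.T, v s ^ 2) with ha₂
  have ha₂0 : 0 ≤ a₂ := Real.sqrt_nonneg _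
  have i1 : IntegrableOn (fun s => |v s|) (Set.Ioc 0 P.T) := hv.integrableOn.norm
  have i2 : IntegrableOn (fun s => |v s| * |primitive v s|) (Set.Ioc 0 P.T) :=
    integrableOn_smul_left i1 wc.norm
  have e1 : ∫ s in (0 : ℝ)..P.T, ‖v s • P.B₂ (P.linState u v s)‖
      ≤ ∫ s in (0 : ℝ)..P.T, (‖P.B₂‖ * (k * n) * |v s| + ‖P.B₂‖ * b * (|v s| * |primitive v s|)) := by
    refine intervalIntegral.integral_mono_on hT (IntegrableOn.ii hsrc.norm hT)
      (IntegrableOn.ii (Integrable.add (Integrable.const_mul i1 _) (Integrable.const_mul i2 _)) hT)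
      fun s hs => ?_
    rw [norm_smul, Real.norm_eq_abs]
    calc _ ≤ |v s| * (‖P.B₂‖ * (k * n + b * |primitive v s|)) := by
          gcongr
          exact P.B₂.le_of_opNorm_le_of_le le_rfl (hz s hs)
      _ = _ := by ring
  rw [intervalIntegral.integral_add (IntegrableOn.ii (Integrable.const_mul i1 _) hT)
    (IntegrableOn.ii (Integrable.const_mul i2 _) hT), intervalIntegral.integral_const_mul,
    intervalIntegral.integral_const_mul] at e1
  -- The part of z proportional to |w(t)| is paired with v in L², which is where ‖v‖₂ enters the
  -- rate.
  have e2 := integral_abs_mul_le_sqrt hT hv.memLp wc.isBddMeas.memLp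
  have e3 : ‖P.B₂‖ * b * (∫ s in (0 : ℝ)..P.T, |v s| * |primitive v s|)
      ≤ ‖P.B₂‖ * b * (a₂ * n) := by gcongr
  have e4 : ∫ s in (0 : ℝ)..P.T, ‖v s • P.B₂ (P.linState u v s)‖
      ≤ ‖P.B₂‖ * (k + b) * (a₁ + a₂) * n := by
    refine e1.trans ((add_le_add le_rfl e3).trans ?_)
    have p1 : 0 ≤ ‖P.B₂‖ * k * a₂ * n := by positivity
    have p2 : 0 ≤ ‖P.B₂‖ * b * a₁ * n := by positivity
    nlinarith
  calc _ ≤ K * (‖P.B₂‖ * (k + b) * (a₁ + a₂) * n) := by gcongr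
    _ = _ := by ring

end BilinearProblem

namespace GohSetting

variable {P : BilinearProblem H} (G : GohSetting P E) {u : ℝ → ℝ} {ψ : ℝ → E}
  {m₁ : ℝ → StrongDual ℝ H}

/-- The Goh transform `ξ` is controlled by the `L²` norm of `w`. -/
lemma exists_gohXi_bound (hH : IsReflexiveSpace H) (hu : IsBddMeas P.T u)
    (hf : MemLp P.f ⊤ (timeMeasure P.T)) (hψ : G.IsStateRep u ψ) :
    ∃ k, 0 ≤ k ∧ ∀ v : ℝ → ℝ, IsBddMeas P.T v → ∀ t ∈ Set.Icc 0 P.T,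
      ‖gohXi P u v t‖ ≤ k * √(∫ s in (0 : ℝ)..P.T, primitive v s ^ 2) := by
  obtain ⟨C', hC'⟩ := hu.2
  obtain ⟨K, hK0, hK⟩ := exists_mild_bound P.S P.T C' P.B₂
  refine ⟨K * √(∫ s in (0 : ℝ)..P.T, ‖G.gohSource ψ s‖ ^ 2), by positivity, fun v hv t ht => ?_⟩
  have hT := P.T_pos.le
  have wc := continuousOn_primitive' hv.integrableOn
  obtain ⟨h1, h2⟩ := G.isMildOn_gohXi hH hu hψ hv
  have hsrc : IntegrableOn (fun s => -(primitive v s • G.gohSource ψ s)) (Set.Ioc 0 P.T) :=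
    Integrable.neg (integrableOn_smul_right wc (G.integrableOn_gohSource hf hψ))
  refine (hK u _ _ hC' hsrc h1 h2 t ht).trans ?_
  -- The source is square integrable because the state is in L²(0,T;E); this is what turns the bound
  -- into one by ‖w‖₂.
  have e := integral_abs_mul_le_sqrt hT wc.isBddMeas.memLp (G.memLp_gohSource hf hψ).norm
  have e2 : ∫ s in (0 : ℝ)..P.T, ‖-(primitive v s • G.gohSource ψ s)‖
      = ∫ s in (0 : ℝ)..P.T, |primitive v s| * |‖G.gohSource ψ s‖| := by
    refine intervalIntegral.integral_congr fun s _ => ?_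
    simp only [norm_neg, norm_smul, Real.norm_eq_abs, abs_norm]
  rw [e2]
  calc _ ≤ K * (√(∫ s in (0 : ℝ)..P.T, primitive v s ^ 2)
        * √(∫ s in (0 : ℝ)..P.T, ‖G.gohSource ψ s‖ ^ 2)) := by gcongr
    _ = _ := by ring

/-- Bound of the remainder of the second order expansion, up to a cubic term in `w`. -/
lemma exists_remainder_bound (hH : IsReflexiveSpace H) (hu : IsBddMeas P.T u)
    (hf : MemLp P.f ⊤ (timeMeasure P.T)) (hψ : G.IsStateRep u ψ)
    (hm₁ : G.IsAdjointRep G.M₁ (P.costate u) m₁) (hm₁c : ContinuousOn m₁ (Set.Icc 0 P.T)) (C : ℝ) :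
    ∃ D, 0 ≤ D ∧ ∀ v : ℝ → ℝ, AEStronglyMeasurable v (timeMeasure P.T) →
      (∀ᵐ t ∂(timeMeasure P.T), |v t| ≤ C) →
      (∫ s in (0 : ℝ)..P.T, |v s|) + √(∫ s in (0 : ℝ)..P.T, v s ^ 2) ≤ 1 →
      |2 * (P.reducedCost (fun t => u t + v t) - (P.reducedCost u
        + (∫ t in (0 : ℝ)..P.T, P.Lam u t * v t)
        + 1 / 2 * Omega G u ψ m₁ (gohXi P u v) (primitive v) (primitive v P.T)))|
      ≤ D * ((∫ s in (0 : ℝ)..P.T, |v s|) + √(∫ s in (0 : ℝ)..P.T, v s ^ 2))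
          * ((∫ t in (0 : ℝ)..P.T, primitive v t ^ 2) + primitive v P.T ^ 2)
        + 2 * |∫ t in (0 : ℝ)..P.T, primitive v t ^ 2 * v t
          * P.costate u t (P.B₂ (P.B₂ (P.calB u t)))| := by
  have hT := P.T_pos.le
  have hTm : P.T ∈ Set.Icc 0 P.T := ⟨hT, le_rfl⟩
  have hpc := (P.isBackwardMildOn_costate hH hu).1.cont
  have hB := P.continuousOn_calB hu
  obtain ⟨k, hk0, hk⟩ := G.exists_gohXi_bound hH hu hf hψ
  obtain ⟨b, hb⟩ := isCompact_Icc.exists_bound_of_continuousOn hB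
  have hb0 : 0 ≤ b := (norm_nonneg _).trans (hb _ hTm)
  obtain ⟨K, hK0, hK⟩ := P.exists_remState_bound hu C k b hk0 hb0
  obtain ⟨c, hc0, hc⟩ := P.exists_gohDual_bound hu hm₁c
  obtain ⟨d, hd⟩ := isCompact_Icc.exists_bound_of_continuousOn hpc
  have hd0 : 0 ≤ d := (norm_nonneg _).trans (hd _ hTm)
  -- The summands are the constants of `t1` to `t5` below, the last one doubled because the triple
  -- product occurs with factor 2.
  refine ⟨‖P.QT‖ * K * (K + 2 * k + 2 * b) + 2 * (d * (‖P.B₂‖ * K))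
    + P.T * (‖P.Q‖ * K * (K + 2 * k)) + (2 * ‖P.Q‖ * b + 2 * c) * K * √P.T
    + 2 * (d * (‖P.B₂‖ * (‖P.B₂‖ * (k + K)))), by have := P.T_pos; positivity,
    fun v hm hC hκ => ?_⟩
  have hv : IsBddMeas P.T v := ⟨hm, C, hC⟩
  have wc := continuousOn_primitive' hv.integrableOn
  have hzt : ∀ t, P.linState u v t = gohXi P u v t + primitive v t • P.calB u t := fun t => by
    rw [gohXi]; abel
  have hzb : ∀ t ∈ Set.Icc 0 P.T, ‖P.linState u v t‖
      ≤ k * √(∫ s in (0 : ℝ)..P.T, primitive v s ^ 2) + b * |primitive v t| := by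
    intro t ht
    rw [hzt]
    refine (norm_add_le _ _).trans (add_le_add (hk v hv t ht) ?_)
    rw [norm_smul, Real.norm_eq_abs, mul_comm]
    gcongr
    exact hb t ht
  have hηb := hK v hm hC hzb
  have hzc := (P.isMildOn_linState hu hv).1.cont
  have hηc := (P.isMildOn_remState hu hv).1.cont
  have hξc := (G.isMildOn_gohXi hH hu hψ hv).1.cont
  have hξb := hk v hv
  have hcs1 := integral_abs_mul_le_sqrt hT wc.isBddMeas.memLp hv.memLp
  have hcs2 := integral_abs_mul_le_sqrt hT wc.isBddMeas.memLp
    (memLp_const (1 : ℝ) : MemLp (fun _ : ℝ => (1 : ℝ)) 2 (timeMeasure P.T))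
  simp only [abs_one, mul_one, one_pow, intervalIntegral.integral_const, sub_zero, smul_eq_mul]
    at hcs2
  have hnsq : (∫ t in (0 : ℝ)..P.T, primitive v t ^ 2)
      = √(∫ s in (0 : ℝ)..P.T, primitive v s ^ 2) ^ 2 :=
    (Real.sq_sqrt (intervalIntegral.integral_nonneg hT fun _ _ => sq_nonneg _)).symm
  have ha₁0 : 0 ≤ ∫ s in (0 : ℝ)..P.T, |v s| :=
    intervalIntegral.integral_nonneg hT fun _ _ => abs_nonneg _
  have haux := P.abs_auxForm_sub_le hu hm₁c hzc hηc wc hc hzb hηb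
  rw [G.two_mul_remainder hH hu hv hf hψ hm₁ hm₁c, hnsq]
  -- With δ = (ξ + η) + wℬ, the first part brings a factor ‖w‖₂ and is bounded by ‖v‖₂‖w‖₂². The
  -- second is the cubic integral, kept as it stands.
  have hsplit : ∫ t in (0 : ℝ)..P.T, primitive v t * v t *
        P.costate u t (P.B₂ (P.B₂ (P.linState u v t + P.remState u v t)))
      = (∫ t in (0 : ℝ)..P.T, primitive v t * v t *
        P.costate u t (P.B₂ (P.B₂ (gohXi P u v t + P.remState u v t))))
        + ∫ t in (0 : ℝ)..P.T, primitive v t ^ 2 * v t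
          * P.costate u t (P.B₂ (P.B₂ (P.calB u t))) := by
    rw [← intervalIntegral.integral_add]
    · refine intervalIntegral.integral_congr fun t _ => ?_
      simp only [hzt, map_add, map_smul, smul_eq_mul]
      ring
    · exact ((wc.isBddMeas.mul hv).mul_integrableOn (hpc.clm_apply
        (P.B₂.continuous.comp_continuousOn (P.B₂.continuous.comp_continuousOn
          (hξc.add hηc)))).integrableOn_Ioc).ii hT
    · exact (((wc.pow 2).isBddMeas.mul hv).mul_integrableOn (hpc.clm_apply
        (P.B₂.continuous.comp_continuousOn (P.B₂.continuous.comp_continuousOn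
          hB))).integrableOn_Ioc).ii hT
  rw [hsplit]
  have hpT := hd _ hTm
  set n := √(∫ s in (0 : ℝ)..P.T, primitive v s ^ 2) with hn
  have hn0 : 0 ≤ n := Real.sqrt_nonneg _
  set a₁ := ∫ s in (0 : ℝ)..P.T, |v s| with ha₁
  set a₂ := √(∫ s in (0 : ℝ)..P.T, v s ^ 2) with ha₂
  have ha₂0 : 0 ≤ a₂ := Real.sqrt_nonneg _
  set κ := a₁ + a₂ with hκd
  have hκ0 : 0 ≤ κ := by positivity
  -- One power of κ is enough; in products with a second factor η the other power is discarded by κ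
  -- ≤ 1.
  have hKκ : K * κ * n ≤ K * n := by
    have := mul_le_mul_of_nonneg_left hκ (by positivity : 0 ≤ K * n)
    linarith
  have hcub : |∫ t in (0 : ℝ)..P.T, primitive v t * v t *
        P.costate u t (P.B₂ (P.B₂ (gohXi P u v t + P.remState u v t)))|
      ≤ d * (‖P.B₂‖ * (‖P.B₂‖ * (k * n + K * n))) * (n * a₂) := by
    refine le_trans ?_ (mul_le_mul_of_nonneg_left hcs1 (by positivity))
    rw [← intervalIntegral.integral_const_mul]
    rw [← Real.norm_eq_abs]
    refine intervalIntegral.norm_integral_le_of_norm_le hT (Eventually.of_forall fun t hts => ?_) ?_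
    · have ht := Set.Ioc_subset_Icc_self hts
      rw [Real.norm_eq_abs, abs_mul, abs_mul, mul_comm]
      gcongr
      refine (P.costate u t).le_of_opNorm_le_of_le (hd t ht) ?_
      refine P.B₂.le_of_opNorm_le_of_le le_rfl (P.B₂.le_of_opNorm_le_of_le le_rfl ?_)
      exact (norm_add_le _ _).trans (add_le_add (hξb t ht) ((hηb t ht).trans hKκ))
    · exact IntegrableOn.ii (Integrable.const_mul
        (integrableOn_smul_right wc.norm hv.integrableOn.norm) _) hT
  set X := ∫ t in (0 : ℝ)..P.T, primitive v t * v t *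
        P.costate u t (P.B₂ (P.B₂ (gohXi P u v t + P.remState u v t)))
  set Y := ∫ t in (0 : ℝ)..P.T, primitive v t ^ 2 * v t
          * P.costate u t (P.B₂ (P.B₂ (P.calB u t)))
  set A := P.auxForm u m₁ (fun t => P.linState u v t + P.remState u v t) (primitive v)
    - P.auxForm u m₁ (P.linState u v) (primitive v)
  have hwT : primitive v P.T ^ 2 = |primitive v P.T| ^ 2 := (sq_abs _).symm
  rw [hwT]
  set ω := |primitive v P.T|
  have hω0 : 0 ≤ ω := abs_nonneg _
  have hnN : n ^ 2 ≤ n ^ 2 + ω ^ 2 := le_add_of_nonneg_right (sq_nonneg ω)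
  have hnω : n * ω ≤ n ^ 2 + ω ^ 2 := by nlinarith [sq_nonneg (n - ω), sq_nonneg (n + ω)]
  set N := n ^ 2 + ω ^ 2
  have t1 : ‖P.QT‖ * (K * κ * n) * (K * κ * n + 2 * (k * n + b * ω))
      ≤ ‖P.QT‖ * K * (K + 2 * k + 2 * b) * κ * N := by
    calc _ ≤ ‖P.QT‖ * (K * κ * n) * (K * n + 2 * (k * n + b * ω)) := by gcongr
      _ = ‖P.QT‖ * K * κ * ((K + 2 * k) * n ^ 2 + 2 * b * (n * ω)) := by ring
      _ ≤ ‖P.QT‖ * K * κ * ((K + 2 * k) * N + 2 * b * N) := by gcongr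
      _ = _ := by ring
  have t2 : 2 * ω * (‖P.costate u P.T‖ * (‖P.B₂‖ * (K * κ * n)))
      ≤ 2 * (d * (‖P.B₂‖ * K)) * κ * N := by
    calc _ ≤ 2 * ω * (d * (‖P.B₂‖ * (K * κ * n))) := by gcongr
      _ = 2 * (d * (‖P.B₂‖ * K)) * κ * (n * ω) := by ring
      _ ≤ _ := by gcongr
  have hTp := P.T_pos
  have t3 : P.T * (‖P.Q‖ * (K * κ * n) * (K * κ * n + 2 * (k * n)))
      ≤ P.T * (‖P.Q‖ * K * (K + 2 * k)) * κ * N := by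
    calc _ ≤ P.T * (‖P.Q‖ * (K * κ * n) * (K * n + 2 * (k * n))) := by gcongr
      _ = P.T * (‖P.Q‖ * K * (K + 2 * k)) * κ * n ^ 2 := by ring
      _ ≤ _ := by gcongr
  have t4 : (2 * ‖P.Q‖ * b + 2 * c) * (K * κ * n) * (∫ t in (0 : ℝ)..P.T, |primitive v t|)
      ≤ (2 * ‖P.Q‖ * b + 2 * c) * K * √P.T * κ * N := by
    calc _ ≤ (2 * ‖P.Q‖ * b + 2 * c) * (K * κ * n) * (n * √P.T) := by gcongr
      _ = (2 * ‖P.Q‖ * b + 2 * c) * K * √P.T * κ * n ^ 2 := by ring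
      _ ≤ _ := by gcongr
  have t5 : d * (‖P.B₂‖ * (‖P.B₂‖ * (k * n + K * n))) * (n * a₂)
      ≤ d * (‖P.B₂‖ * (‖P.B₂‖ * (k + K))) * κ * N := by
    calc _ = d * (‖P.B₂‖ * (‖P.B₂‖ * (k + K))) * a₂ * n ^ 2 := by ring
      _ ≤ _ := by
        gcongr
        linarith
  have hA := haux.trans (add_le_add (add_le_add t1 t2) (add_le_add t3 t4))
  have hX := hcub.trans t5
  have tri : |A - 2 * (X + Y)| ≤ |A| + (2 * |X| + 2 * |Y|) := by
    refine (abs_sub _ _).trans (add_le_add le_rfl ?_)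
    rw [abs_mul, abs_of_pos (show (0 : ℝ) < 2 by norm_num), ← mul_add]
    gcongr
    exact abs_add_le _ _
  linarith

end GohSetting

end Estimates

/-! ### Pontryagin sequences and the conclusion. -/

/-- Along a Pontryagin sequence `‖v‖₁ + ‖v‖₂` tends to zero. -/
lemma PontryaginTendsto.tendsto_norms {T : ℝ} (hT : 0 ≤ T) {v : ℕ → ℝ → ℝ}
    (hv : PontryaginTendsto T v) :
    Tendsto (fun k => (∫ s in (0 : ℝ)..T, |v k s|) + √(∫ s in (0 : ℝ)..T, v k s ^ 2))
      atTop (𝓝 0) := by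
  obtain ⟨hm, ⟨C, hC⟩, hv0⟩ := hv
  have h2 : Tendsto (fun k => ∫ s in (0 : ℝ)..T, v k s ^ 2) atTop (𝓝 0) := by
    -- Since |v| ≤ C, v² ≤ C|v|: the uniform bound upgrades L¹ convergence to L² convergence.
    have hlim : Tendsto (fun k => C * ∫ s in (0 : ℝ)..T, |v k s|) atTop (𝓝 0) := by
      simpa using hv0.const_mul C
    refine squeeze_zero (fun k => intervalIntegral.integral_nonneg hT fun _ _ => sq_nonneg _)
      (fun k => ?_) hlim
    have hb : IsBddMeas T (v k) := ⟨hm k, C, hC k⟩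
    rw [← intervalIntegral.integral_const_mul, intervalIntegral.integral_of_le hT,
      intervalIntegral.integral_of_le hT]
    refine integral_mono_ae ?_ (Integrable.const_mul hb.integrableOn.norm C) ?_
    · exact hb.memLp.integrable_sq
    · filter_upwards [hC k] with t ht
      rw [← sq_abs, sq]
      exact mul_le_mul_of_nonneg_right ht (abs_nonneg _)
  simpa using hv0.add ((Real.continuous_sqrt.tendsto 0).comp h2)

end

theorem mainTheorem6 {H : Type*} [NormedAddCommGroup H] [NormedSpace ℝ H] [CompleteSpace H]
    (hH : IsReflexiveSpace H) (P : BilinearProblem H)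
    {E : Type*} [NormedAddCommGroup E] [NormedSpace ℝ E] [CompleteSpace E] (G : GohSetting P E)
    (u : ℝ → ℝ) (hu : u ∈ P.Uad)
    (hf : MemLp P.f ⊤ (timeMeasure P.T))
    (ψ : ℝ → E) (hψ : G.IsStateRep u ψ)
    (hbr : MemLp (fun t => G.bracketM₁ (ψ t)) ⊤ (timeMeasure P.T))
    (hBf : HasContinuousRep P.T (fun t => P.B₂ (P.B₂ (P.f t))))
    (hΨd : HasContinuousRep P.T P.Ψd)
    (m₁ m₂ : ℝ → StrongDual ℝ H)
    (hm₁ : G.IsAdjointRep G.M₁ (P.costate u) m₁) (hm₁c : ContinuousOn m₁ (Set.Icc 0 P.T))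
    (hm₂ : G.IsAdjointRep G.M₂ (P.costate u) m₂) (hm₂c : ContinuousOn m₂ (Set.Icc 0 P.T))
    (v : ℕ → ℝ → ℝ) (hv : PontryaginTendsto P.T v) :
    (fun k => P.reducedCost (fun t => u t + v k t)
        - (P.reducedCost u + (∫ t in (0 : ℝ)..P.T, P.Lam u t * v k t)
          + 1 / 2 * Omega G u ψ m₁ (gohXi P u (v k)) (primitive (v k)) (primitive (v k) P.T)))
      =o[atTop]
    (fun k => (∫ t in (0 : ℝ)..P.T, primitive (v k) t ^ 2) + primitive (v k) P.T ^ 2) := by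
  have hT := P.T_pos.le
  have hu' := P.isBddMeas_of_mem_Uad hu
  have hκ := hv.tendsto_norms hT
  have hpc := (P.isBackwardMildOn_costate hH hu').1.cont
  have hβ : ContinuousOn (fun t => P.costate u t (P.B₂ (P.B₂ (P.calB u t)))) (Set.Icc 0 P.T) :=
    hpc.clm_apply (P.B₂.continuous.comp_continuousOn
      (P.B₂.continuous.comp_continuousOn (P.continuousOn_calB hu')))
  have hcub := isLittleO_cubic hT hv hβ
  obtain ⟨hm, ⟨C, hC⟩, -⟩ := hv
  obtain ⟨D, hD0, hD⟩ := G.exists_remainder_bound hH hu' hf hψ hm₁ hm₁c C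
  have hDκ := hκ.const_mul D
  rw [mul_zero] at hDκ
  rw [isLittleO_iff] at hcub ⊢
  intro c hc
  -- Twice the error is at most Dκ times the scale plus twice the cubic term. The thresholds c and
  -- c/2 make the total 2c times the scale.
  filter_upwards [hκ.eventually_le_const one_pos, hDκ.eventually_le_const hc,
    hcub (half_pos hc)] with k h1 h2 h3
  have h4 := hD (v k) (hm k) (hC k) h1
  have hN : 0 ≤ (∫ t in (0 : ℝ)..P.T, primitive (v k) t ^ 2) + primitive (v k) P.T ^ 2 :=
    add_nonneg (intervalIntegral.integral_nonneg hT fun _ _ => sq_nonneg _) (sq_nonneg _)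
  rw [Real.norm_eq_abs, Real.norm_of_nonneg hN] at h3 ⊢
  rw [abs_mul, abs_of_pos (show (0 : ℝ) < 2 by norm_num)] at h4
  have h5 := mul_le_mul_of_nonneg_right h2 hN
  linarith
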